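/- Let $\beta\in(0,1)$ and consider on $[0,1]\times[0,T]$ the two problems $$\partial_tq+a(-i\partial_x)^3q=0,\quad q(x,0)=q_0(x),\quad q(0,t)=q(1,t)=0,\quad \partial_xq(0,t)=\beta\,\partial_xq(1,t),$$ with $a=i$ (first problem) and $a=-i$ (second problem). Call $q_0$ admissible if $q_0\in C^\infty[0,1]$ and, for all $m\ge0$, $q_0^{(3m)}(0)=q_0^{(3m)}(1)=0$ and $q_0^{(3m+1)}(0)=\beta q_0^{(3m+1)}(1)$. A problem is well-posed on $[0,T]$ if for every admissible $q_0$ it has exactly one solution $q\in C^\infty([0,1]\times[0,T])$, and ill-posed otherwise. Let $\omega=e^{2\pi i/3}$, $c_j(\rho)=-a\rho^3(i\rho)^{-(j+1)}$ and $\hat f(\rho)=\int_0^1e^{-i\rho x}f(x)\,dx$. Let $\mathcal A(\rho)$ be the $3\times3$ matrix with rows $\big(c_2(\rho_r),\,-c_2(\rho_r)e^{-i\rho_r},\,c_1(\rho_r)(\beta-e^{-i\rho_r})\big)$, $\rho_r=\omega^r\rho$, $r=0,1,2$; let $\Delta_P=\det\mathcal A$ and let $\Delta^f_l(\rho)$ be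 the determinant of $\mathcal A(\rho)$ with its $l$-th column replaced by $(\hat f(\rho_r))_{r=0,1,2}$. Put $N^+_{f,0}=N^-_{f,0}=0$ and $$N^+_{f,1}=\beta c_1\Delta^f_3,\quad N^+_{f,2}=c_2\Delta^f_1,\quad N^-_{f,1}=c_1\Delta^f_3,\quad N^-_{f,2}=c_2\Delta^f_2 .$$ A problem is well-conditioned if for every $q_T\in C^\infty[0,1]$ all the functions $\eta=N^\pm_{q_T,j}$ ($j=0,1,2$) are entire and $\eta(\rho)/\Delta_P(\rho)\to0$ as $\rho\to\infty$ within $D=\{\operatorname{Re}(a\rho^3)<0\}$, away from the zeros of $\Delta_P$ (that is, for each $\varepsilon>0$, at distance at least $\varepsilon$ from all of them). The series representation of the solution consists of the two series $$i\sum_{\sigma\in K^+}\operatorname*{res}_{\rho=\sigma}\frac{e^{i\rho x-a\rho^3t}}{\Delta_P(\rho)}\sum_jN^+_{q_0,j}(\rho),\qquad i\sum_{\sigma\in K^-}\operatorname*{res}_{\rho=\sigma}\frac{e^{i\rho(x-1)-a\rho^3t}}{\Delta_P(\rho)}\sum_jN^-_{q_0,j}(\rho),$$ where $K^\pm$ is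 the set of zeros of $\Delta_P$ with $\pm\operatorname{Im}\sigma>0$. Then: 1. Both problems are well-conditioned. 2. There are sequences $(\lambda_k)_{k\ge1}$, $(\mu_k)_{k\ge1}$, the same for $a=i$ and $a=-i$, such that $\Delta_P(0)=0$ and the nonzero zeros of $\Delta_P$, counted with multiplicity, are exactly the numbers $\omega^j\lambda_k,\ \omega^j\mu_k$ ($j=0,1,2$, $k\ge1$), and $$\lambda_k=(2k-\tfrac13)\pi+i\log\beta+O(e^{-\sqrt3k\pi/2}),\qquad \mu_k=-(2k-\tfrac13)\pi+i\log\beta+O(e^{-\sqrt3k\pi/2}).$$ Moreover $$\operatorname{Re}(\mp i\lambda_k^3)=\pm3\big[(2k-\tfrac13)\pi\big]^2\log\beta+O(1),\qquad \operatorname{Re}(\mp i\mu_k^3)=\pm3\big[(2k-\tfrac13)\pi\big]^2\log\beta+O(1),$$ and, for all $k\ge1$, $\operatorname{Re}(-i\lambda_k^3)$ and $\operatorname{Re}(-i\mu_k^3)$ are negative, while $\operatorname{Re}(i\lambda_k^3)$ and $\operatorname{Re}(i\mu_k^3)$ are positive. 3. For every admissible $q_0$ and every $x\in[0,1]$, both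 series converge absolutely at $t=0$ for either problem, and for the first problem they do so for all $t\ge0$. 4. For the second problem there is an admissible $q_0$ such that, for every $x\in[0,1]$ and every $t>0$, each of the two series has unbounded terms, hence diverges, and such that for no $T>0$ does a $C^\infty([0,1]\times[0,T])$ solution exist. 5. Consequently the second problem, $\partial_tq-i(-i\partial_x)^3q=0$, is ill-posed for every $T>0$, although it is well-conditioned: the decay of the ratios $\eta/\Delta_P$ alone does not suffice for well-posedness. -/

import Mathlib

open Filter Topology Asymptotics
open scoped ContDiff

noncomputable section

namespace ThirdOrderIBVP

/-! The problems are `∂_t q + a (-i ∂_x)^3 q = 0` on `[0,1] × [0,T]`, with `a = i` or `a = -i`,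
`q(x,0) = q₀(x)`, `q(0,t) = q(1,t) = 0` and `∂_x q(0,t) = β ∂_x q(1,t)`. -/

/-- The `j`-th derivative (one-sided at the end points) of a function on `[0,1]`. -/
def dx (j : ℕ) (f : ℝ → ℂ) (x : ℝ) : ℂ := iteratedDerivWithin j f (Set.Icc 0 1) x

/-- Initial data: smooth functions on `[0,1]` compatible with the boundary conditions to every
order. (If `q` is a smooth solution then so are all its time derivatives, that is, up to
constants, all `∂_x^{3m} q`; hence these conditions are necessary for a smooth solution.) -/
structure Admissible (β : ℝ) (q₀ : ℝ → ℂ) : Prop where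
  smooth : ContDiffOn ℝ ∞ q₀ (Set.Icc 0 1)
  left : ∀ m : ℕ, dx (3 * m) q₀ 0 = 0
  right : ∀ m : ℕ, dx (3 * m) q₀ 1 = 0
  coupled : ∀ m : ℕ, dx (3 * m + 1) q₀ 0 = β * dx (3 * m + 1) q₀ 1

/-- `q` is a `C^∞([0,1] × [0,T])` solution of the problem with initial datum `q₀`. -/
structure IsSolution (a : ℂ) (β T : ℝ) (q₀ : ℝ → ℂ) (q : ℝ → ℝ → ℂ) : Prop where
  smooth : ContDiffOn ℝ ∞ (fun p : ℝ × ℝ => q p.1 p.2) (Set.Icc 0 1 ×ˢ Set.Icc 0 T)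
  pde : ∀ x ∈ Set.Icc (0 : ℝ) 1, ∀ t ∈ Set.Icc (0 : ℝ) T,
    derivWithin (fun s => q x s) (Set.Icc 0 T) t
      + a * ((-Complex.I) ^ 3 * dx 3 (fun y => q y t) x) = 0
  initial : ∀ x ∈ Set.Icc (0 : ℝ) 1, q x 0 = q₀ x
  left : ∀ t ∈ Set.Icc (0 : ℝ) T, q 0 t = 0
  right : ∀ t ∈ Set.Icc (0 : ℝ) T, q 1 t = 0
  coupled : ∀ t ∈ Set.Icc (0 : ℝ) T,
    dx 1 (fun y => q y t) 0 = β * dx 1 (fun y => q y t) 1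

/-- Well-posedness: every compatible smooth initial datum has one and only one smooth solution
on `[0,1] × [0,T]`. -/
def WellPosed (a : ℂ) (β T : ℝ) : Prop :=
  ∀ q₀ : ℝ → ℂ, Admissible β q₀ →
    ∃ q : ℝ → ℝ → ℂ, IsSolution a β T q₀ q ∧
      ∀ q' : ℝ → ℝ → ℂ, IsSolution a β T q₀ q' →
        ∀ x ∈ Set.Icc (0 : ℝ) 1, ∀ t ∈ Set.Icc (0 : ℝ) T, q' x t = q x t

/-- Ill-posedness is the failure of well-posedness. -/
def IllPosed (a : ℂ) (β T : ℝ) : Prop := ¬ WellPosed a β T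

/-- The primitive cube root of unity `ω = exp(2πi/3)`, written `om` in the code. -/
def om : ℂ := Complex.exp (2 * Real.pi * Complex.I / 3)

/-- The coefficients `c_j(ρ) = -a ρ³ (iρ)^{-(j+1)}`, `j = 0, 1, 2`, with the power of `ρ`
cancelled. -/
def coeff (a : ℂ) (j : Fin 3) (ρ : ℂ) : ℂ :=
  -a * (Complex.I ^ ((j : ℕ) + 1))⁻¹ * ρ ^ (2 - (j : ℕ))

/-- The Fourier transform on `[0,1]`. -/
def fourier (f : ℝ → ℂ) (ρ : ℂ) : ℂ :=
  ∫ x in (0 : ℝ)..1, Complex.exp (-Complex.I * ρ * x) * f x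

/-- The PDE characteristic matrix. With `F_j`, `G_j` the `t`-transforms
`∫_0^T e^{aρ³s} ∂_x^j q(·,s) ds` at `x = 0` and `x = 1`, the global relation at `ω^r ρ` is
`∑_j c_j(ω^r ρ) (F_j - e^{-iω^r ρ} G_j) = q̂₀(ω^r ρ) - e^{aρ³T} q̂_T(ω^r ρ)`.
The boundary conditions give `F_0 = G_0 = 0` and `F_1 = β G_1`, which leaves a linear system
for `(F_2, G_2, G_1)`, with this matrix. -/
def charMatrix (a : ℂ) (β : ℝ) (ρ : ℂ) : Matrix (Fin 3) (Fin 3) ℂ :=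
  Matrix.of fun r =>
    ![coeff a 2 (om ^ (r : ℕ) * ρ),
      -(coeff a 2 (om ^ (r : ℕ) * ρ) * Complex.exp (-Complex.I * (om ^ (r : ℕ) * ρ))),
      coeff a 1 (om ^ (r : ℕ) * ρ) * (β - Complex.exp (-Complex.I * (om ^ (r : ℕ) * ρ)))]

/-- The PDE characteristic determinant `Δ_P`. -/
def ΔP (a : ℂ) (β : ℝ) (ρ : ℂ) : ℂ := (charMatrix a β ρ).det

/-- The Cramer determinants of the system with right-hand side `f̂(ω^r ρ)`. -/
def cramerDet (a : ℂ) (β : ℝ) (f : ℝ → ℂ) (ρ : ℂ) : Fin 3 → ℂ :=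
  (charMatrix a β ρ).cramer fun r => fourier f (om ^ (r : ℕ) * ρ)

/-- The functions `ζ_j`, `j ∈ J⁺` (if `f = q₀`), or `η_j`, `j ∈ J⁺` (if `f = q_T`): `Δ_P` times
the contribution of `f` to `c_j F_j`, where `F_j` is the transform of `∂_x^j q(0,·)`. -/
def numPlus (a : ℂ) (β : ℝ) (f : ℝ → ℂ) (j : Fin 3) (ρ : ℂ) : ℂ :=
  coeff a j ρ * ![0, β * cramerDet a β f ρ 2, cramerDet a β f ρ 0] j

/-- The functions `ζ_j` or `η_j`, `j ∈ J⁻`: the same for `c_j G_j`, where `G_j` is the transform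
of `∂_x^j q(1,·)`. -/
def numMinus (a : ℂ) (β : ℝ) (f : ℝ → ℂ) (j : Fin 3) (ρ : ℂ) : ℂ :=
  coeff a j ρ * ![0, cramerDet a β f ρ 2, cramerDet a β f ρ 1] j

/-- `h(ρ) → 0` as `ρ → ∞` within `D = {Re (a ρ³) < 0}`, away from the zeros of `Δ_P`. -/
def DecaysInD (a : ℂ) (β : ℝ) (h : ℂ → ℂ) : Prop :=
  ∀ ε > (0 : ℝ), Tendsto h
    (Bornology.cobounded ℂ ⊓
      𝓟 {ρ : ℂ | (a * ρ ^ 3).re < 0 ∧ ∀ σ : ℂ, ΔP a β σ = 0 → ε ≤ dist ρ σ}) (𝓝 0)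

/-- Well-conditioning: every `η_j` is entire and `η_j/Δ_P` decays in `D` away from the zeros of
`Δ_P`, whatever the smooth function `q_T` in the definition of `η_j`. -/
def WellConditioned (a : ℂ) (β : ℝ) : Prop :=
  ∀ qT : ℝ → ℂ, ContDiffOn ℝ ∞ qT (Set.Icc 0 1) → ∀ j : Fin 3,
    (Differentiable ℂ (numPlus a β qT j) ∧
      DecaysInD a β fun ρ => numPlus a β qT j ρ / ΔP a β ρ) ∧
    (Differentiable ℂ (numMinus a β qT j) ∧
      DecaysInD a β fun ρ => numMinus a β qT j ρ / ΔP a β ρ)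

/-- The residue of `f` at an isolated singularity `c` (the circle integrals do not depend on `r`
for small `r > 0`). -/
def residue (f : ℂ → ℂ) (c : ℂ) : ℂ :=
  limUnder (𝓝[>] (0 : ℝ)) fun r => (2 * Real.pi * Complex.I)⁻¹ * ∮ z in C(c, r), f z

/-- The zeros `σ_k`, `k ∈ K⁺`, of `Δ_P` in the open upper half plane. -/
def zerosPlus (a : ℂ) (β : ℝ) : Set ℂ := {σ | ΔP a β σ = 0 ∧ 0 < σ.im}

/-- The zeros `σ_k`, `k ∈ K⁻`, of `Δ_P` in the open lower half plane. -/
def zerosMinus (a : ℂ) (β : ℝ) : Set ℂ := {σ | ΔP a β σ = 0 ∧ σ.im < 0}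

/-- The term at `σ = σ_k`, `k ∈ K⁺`, of the series representation of the solution. At a simple
zero it equals `e^{iσx - aσ³t} f_k(q₀)`. -/
def termPlus (a : ℂ) (β : ℝ) (q₀ : ℝ → ℂ) (x t : ℝ) (σ : ℂ) : ℂ :=
  Complex.I * residue (fun ρ => Complex.exp (Complex.I * ρ * x - a * ρ ^ 3 * t) / ΔP a β ρ
    * ∑ j : Fin 3, numPlus a β q₀ j ρ) σ

/-- The term at `σ = σ_k`, `k ∈ K⁻`, of the series representation of the solution. At a simple
zero it equals `e^{iσ(x-1) - aσ³t} f_k(q₀)`. -/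
def termMinus (a : ℂ) (β : ℝ) (q₀ : ℝ → ℂ) (x t : ℝ) (σ : ℂ) : ℂ :=
  Complex.I * residue (fun ρ => Complex.exp (Complex.I * ρ * (x - 1) - a * ρ ^ 3 * t) / ΔP a β ρ
    * ∑ j : Fin 3, numMinus a β q₀ j ρ) σ

/-- Both series of the representation converge absolutely at `(x,t)`. -/
def SeriesConverges (a : ℂ) (β : ℝ) (q₀ : ℝ → ℂ) (x t : ℝ) : Prop :=
  Summable (fun σ : zerosPlus a β => termPlus a β q₀ x t σ) ∧
  Summable (fun σ : zerosMinus a β => termMinus a β q₀ x t σ)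

/-- The terms of each of the two series are unbounded at `(x,t)`, so that each series diverges,
in whatever order it is summed. -/
def SeriesDiverges (a : ℂ) (β : ℝ) (q₀ : ℝ → ℂ) (x t : ℝ) : Prop :=
  ¬ BddAbove (Set.range fun σ : zerosPlus a β => ‖termPlus a β q₀ x t σ‖) ∧
  ¬ BddAbove (Set.range fun σ : zerosMinus a β => ‖termMinus a β q₀ x t σ‖)

/-- The number of pairs `(j,k)`, `j ∈ {0,1,2}`, `k ≥ 1`, with `ω^j s_k = ρ`. -/
def occurrences (s : ℕ → ℂ) (ρ : ℂ) : ℕ∞ :=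
  Set.encard {p : Fin 3 × ℕ | 1 ≤ p.2 ∧ om ^ (p.1 : ℕ) * s p.2 = ρ}

/-- `(2k - 1/3)π`. -/
def asymRe (k : ℕ) : ℝ := (2 * (k : ℝ) - 1 / 3) * Real.pi

end ThirdOrderIBVP

end

/-!
The nontrivial factor of `Δ_P = a³ (ω - ω²) ρ F(ρ)` is
`F(ρ) = ∑_r ω^r (e_r + β e_r⁻¹)`, `e_r = e^{iω^r ρ}` (`charF`, `ΔP_eq`), which does not depend on
`a`. Up to factors, `F` is invariant under `ρ ↦ ωρ` and `ρ ↦ -ρ̄`, so it is enough to study it in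
the sector `|arg ρ| ≤ π/6` (`sector_induction`). There `F ≈ ω² e_2 (1 + βω² e^{iρ})`, with a
relative error of order `e^{-Re ρ / 2}`, so that `F` is as large as the sum `gr` of all the
exponentials and their inverses, except near the points `(2k - 1/3)π + i log β`
(`InSector.exists_int_near`).

*The zeros.* On circles of radius `(2K + 2/3)π` the quotient of `ρ F(ρ)` by
`-8 ∏_r sin (ω^r ρ / 2)` has positive real part. By Rouché's theorem both functions have the same
number `6K + 3` of zeros inside (`exists_zeroCount_eq`), and `F` has `6K` nonzero ones. Each annulus
between consecutive circles therefore contains six zeros. One of them may be taken in the sector,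
close to its lattice point; its orbit and that of its mirror image have three points each and are
all there is (`exists_zero_in_annulus`). The finitely many small zeros form orbits as well, and can
be distributed over the first places of two sequences (`exists_small_enum`,
`exists_zero_sequences`).

*The sign of the exponents.* A zero `σ` gives an adjoint eigenfunction `ψ`, with `ψ''' = iσ³ ψ`,
`ψ(0) = ψ(1) = 0` and `ψ'(1) = β ψ'(0)`. Integrating `Re (ψ''' ψ̄)` by parts yields
`Re (iσ³) ∫ |ψ|² = (1 - β²) |ψ'(0)|² / 2 > 0` (`re_I_mul_cube_pos`).

*Well-conditioning and convergence.* The transform of a smooth function is `O(1/ρ)` relative to the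
exponentials, and the numerators are `O(gr)`; away from the zeros `|Δ_P| ≥ c |ρ| gr`
(`exists_norm_charF_ge`), whence `wellConditioned`. For data vanishing at the end points the
transform is `O(1/ρ²)`, and at a large zero `|F'| ≥ c gr` (`exists_norm_charF'_ge`), so the residues
are `O(|σ|⁻²)` when the time factor is bounded (`seriesConverges`). It is so at `t = 0`, and for
`a = i` at all later times by the sign of the exponents.

*Divergence and nonexistence.* For `a = -i` the factor `|e^{iσ³t}|` grows like `e^{ct|σ|²}` along
the zeros `σ_k` near `(2k - 1/3)π + i log β`, because `log β < 0`. The datum is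
`∑_k e^{-4|σ_k|} φ_k` with the eigenfunctions `φ_k` (`datum`), which is admissible. By Lagrange's
identity the eigenfunctions are biorthogonal to the adjoint ones, the diagonal pairings being
proportional to `F'(σ_k)` (`cube_sub_mul_integral`, `integral_efun_mul_efun_self`), so that its
coefficients are no smaller than exponentially small. The terms of both series are then unbounded
for every `t > 0` (`GrowingZeros.seriesDiverges`). The coefficient `y` of a solution along an
adjoint eigenfunction satisfies `y' = iσ³ y`; at the final time the coefficients would be larger
than those of any bounded function (`GrowingZeros.not_exists_isSolution`).
-/

namespace ThirdOrderIBVP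

/-! ### The cube root of unity and the characteristic determinant -/

lemma om_eq : om = -1 / 2 + (Real.sqrt 3 / 2 : ℝ) * Complex.I := by
  have h : (2 * Real.pi * Complex.I / 3 : ℂ) = ((Real.pi - Real.pi / 3 : ℝ) : ℂ) * Complex.I := by
    push_cast; ring
  rw [om, h, Complex.exp_mul_I, ← Complex.ofReal_cos, ← Complex.ofReal_sin, Real.cos_pi_sub,
    Real.sin_pi_sub, Real.cos_pi_div_three, Real.sin_pi_div_three]
  push_cast; ring

lemma om_cube : om ^ 3 = 1 := by
  rw [om, ← Complex.exp_nat_mul, Complex.exp_eq_one_iff]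
  exact ⟨1, by push_cast; ring⟩

lemma om_re : om.re = -1 / 2 := by
  have h : om = ((-1 / 2 : ℝ) : ℂ) + (Real.sqrt 3 / 2 : ℝ) * Complex.I := by
    rw [om_eq]; push_cast; ring
  rw [h]; simp

lemma om_im : om.im = Real.sqrt 3 / 2 := by
  have h : om = ((-1 / 2 : ℝ) : ℂ) + (Real.sqrt 3 / 2 : ℝ) * Complex.I := by
    rw [om_eq]; push_cast; ring
  rw [h]; simp

lemma om_sq : om ^ 2 = -1 - om := by
  have h3 : Real.sqrt 3 ^ 2 = 3 := Real.sq_sqrt (by norm_num)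
  apply Complex.ext
  · simp [pow_two, om_re, om_im]; nlinarith
  · simp [pow_two, om_re, om_im]; ring

lemma conj_om : (starRingEnd ℂ) om = om ^ 2 := by
  apply Complex.ext
  · rw [om_sq]; simp [om_re]; norm_num
  · rw [om_sq]; simp [om_im]

lemma om_sub_sq : om - om ^ 2 = Complex.I * Real.sqrt 3 := by
  rw [om_sq, om_eq]; push_cast; ring

lemma norm_om : ‖om‖ = 1 := by
  have h := congrArg norm om_cube
  rw [norm_pow, norm_one] at h
  exact (pow_eq_one_iff_of_nonneg (norm_nonneg _) (by norm_num)).1 h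

lemma om_ne_zero : om ≠ 0 := by
  intro h; have := norm_om; rw [h] at this; simp at this

/-- The exponential `e^{iω^r ρ}`. -/
noncomputable def ee (r : ℕ) (ρ : ℂ) : ℂ := Complex.exp (Complex.I * (om ^ r * ρ))

lemma ee_ne_zero (r : ℕ) (ρ : ℂ) : ee r ρ ≠ 0 := Complex.exp_ne_zero _

lemma exp_neg_eq (r : ℕ) (ρ : ℂ) : Complex.exp (-Complex.I * (om ^ r * ρ)) = (ee r ρ)⁻¹ := by
  rw [ee, ← Complex.exp_neg]; congr 1; ring

lemma ee_prod (ρ : ℂ) : ee 0 ρ * ee 1 ρ * ee 2 ρ = 1 := by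
  simp only [ee, ← Complex.exp_add]
  rw [om_sq]
  ring_nf
  simp

lemma ee_mod (r : ℕ) (ρ : ℂ) : ee (r + 3) ρ = ee r ρ := by
  rw [ee, ee, pow_add, om_cube, mul_one]

lemma ee_om (r : ℕ) (ρ : ℂ) : ee r (om * ρ) = ee (r + 1) ρ := by
  rw [ee, ee, pow_succ]; ring_nf

/-- `F(ρ) = ∑_r ω^r (e^{iω^r ρ} + β e^{-iω^r ρ})`, the nontrivial factor of the characteristic
determinant. -/
noncomputable def charF (β : ℝ) (ρ : ℂ) : ℂ :=
  (ee 0 ρ + β * (ee 0 ρ)⁻¹) + om * (ee 1 ρ + β * (ee 1 ρ)⁻¹)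
    + om ^ 2 * (ee 2 ρ + β * (ee 2 ρ)⁻¹)

lemma coeff_one (a ρ : ℂ) : coeff a 1 ρ = a * ρ := by
  simp [coeff]

lemma coeff_two (a ρ : ℂ) : coeff a 2 ρ = -a * Complex.I := by
  simp [coeff, Complex.I_pow_three]

lemma ee_inv_zero (ρ : ℂ) : (ee 0 ρ)⁻¹ = ee 1 ρ * ee 2 ρ :=
  inv_eq_of_mul_eq_one_right (by rw [← ee_prod ρ]; ring)

lemma ee_inv_one (ρ : ℂ) : (ee 1 ρ)⁻¹ = ee 0 ρ * ee 2 ρ :=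
  inv_eq_of_mul_eq_one_right (by rw [← ee_prod ρ]; ring)

lemma ee_inv_two (ρ : ℂ) : (ee 2 ρ)⁻¹ = ee 0 ρ * ee 1 ρ :=
  inv_eq_of_mul_eq_one_right (by rw [← ee_prod ρ]; ring)

lemma charMatrix_apply (a : ℂ) (β : ℝ) (ρ : ℂ) (r : Fin 3) :
    charMatrix a β ρ r = ![-a * Complex.I, a * Complex.I * (ee r ρ)⁻¹,
      a * om ^ (r : ℕ) * ρ * (β - (ee r ρ)⁻¹)] := by
  ext j
  rw [← exp_neg_eq]
  fin_cases j <;> simp [charMatrix, coeff_one, coeff_two]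
  left; ring

lemma ΔP_eq (a : ℂ) (β : ℝ) (ρ : ℂ) : ΔP a β ρ = a ^ 3 * (om - om ^ 2) * ρ * charF β ρ := by
  rw [ΔP, Matrix.det_fin_three]
  simp only [charMatrix_apply]
  simp [charF, ee_inv_zero, ee_inv_one, ee_inv_two]
  have h1 := ee_prod ρ
  have h2 := om_sq
  have h3 := Complex.I_sq
  generalize ee 0 ρ = x at *
  generalize ee 1 ρ = y at *
  generalize ee 2 ρ = z at *
  generalize om = w at *
  generalize Complex.I = i at *
  grind

lemma cramerDet_two (a : ℂ) (β : ℝ) (f : ℝ → ℂ) (ρ : ℂ) : cramerDet a β f ρ 2 =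
    a ^ 2 * (fourier f ρ * ((ee 2 ρ)⁻¹ - (ee 1 ρ)⁻¹)
      + fourier f (om * ρ) * ((ee 0 ρ)⁻¹ - (ee 2 ρ)⁻¹)
      + fourier f (om ^ 2 * ρ) * ((ee 1 ρ)⁻¹ - (ee 0 ρ)⁻¹)) := by
  rw [cramerDet, Matrix.cramer_apply, Matrix.det_fin_three]
  simp [charMatrix_apply]
  have h3 := Complex.I_sq
  generalize Complex.I = i at *
  grind

lemma cramerDet_zero (a : ℂ) (β : ℝ) (f : ℝ → ℂ) (ρ : ℂ) : cramerDet a β f ρ 0 =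
    a ^ 2 * Complex.I * ρ *
     (fourier f ρ * (om ^ 2 * ((ee 1 ρ)⁻¹ * β - ee 0 ρ) - om * ((ee 2 ρ)⁻¹ * β - ee 0 ρ))
      + fourier f (om * ρ) * (((ee 2 ρ)⁻¹ * β - ee 1 ρ) - om ^ 2 * ((ee 0 ρ)⁻¹ * β - ee 1 ρ))
      + fourier f (om ^ 2 * ρ) *
        (om * ((ee 0 ρ)⁻¹ * β - ee 2 ρ) - ((ee 1 ρ)⁻¹ * β - ee 2 ρ))) := by
  rw [cramerDet, Matrix.cramer_apply, Matrix.det_fin_three]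
  simp [charMatrix_apply, ee_inv_zero, ee_inv_one, ee_inv_two]
  have h1 := ee_prod ρ
  generalize ee 0 ρ = x at *
  generalize ee 1 ρ = y at *
  generalize ee 2 ρ = z at *
  generalize om = w at *
  generalize Complex.I = i at *
  grind

lemma cramerDet_one (a : ℂ) (β : ℝ) (f : ℝ → ℂ) (ρ : ℂ) : cramerDet a β f ρ 1 =
    -a ^ 2 * Complex.I * ρ *
     (fourier f ρ * (om * (β - (ee 1 ρ)⁻¹) - om ^ 2 * (β - (ee 2 ρ)⁻¹))
      + fourier f (om * ρ) * (om ^ 2 * (β - (ee 2 ρ)⁻¹) - (β - (ee 0 ρ)⁻¹))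
      + fourier f (om ^ 2 * ρ) * ((β - (ee 0 ρ)⁻¹) - om * (β - (ee 1 ρ)⁻¹))) := by
  rw [cramerDet, Matrix.cramer_apply, Matrix.det_fin_three]
  simp [charMatrix_apply]
  ring

/-- The relation `A X = Δ_P f̂` satisfied by the Cramer determinants `X`, row by row. -/
lemma cramer_row (a : ℂ) (β : ℝ) (f : ℝ → ℂ) (ρ : ℂ) (r : Fin 3) :
    -a * Complex.I * cramerDet a β f ρ 0 + a * Complex.I * (ee r ρ)⁻¹ * cramerDet a β f ρ 1
      + a * om ^ (r : ℕ) * ρ * (β - (ee r ρ)⁻¹) * cramerDet a β f ρ 2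
    = ΔP a β ρ * fourier f (om ^ (r : ℕ) * ρ) := by
  have h := congrFun (Matrix.mulVec_cramer (charMatrix a β ρ)
    fun r => fourier f (om ^ (r : ℕ) * ρ)) r
  simpa [Matrix.mulVec, dotProduct, Fin.sum_univ_three, charMatrix_apply, cramerDet, ΔP] using h

/-! ### The exponential family of eigenfunctions -/

/-- The `n`-th derivative in `z` of `∑_r (e_{r+2} - e_{r+1}) e^{iω^r ρ z}`, where
`e_r = e^{iω^r ρ}`. For `n = 0` this function solves `u''' = (iρ)³ u` and vanishes at `0` and `1`;
at a zero of `charF β` it is an eigenfunction of the spatial problem, and at minus a zero it is an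
eigenfunction of the adjoint one. -/
noncomputable def efun (ρ : ℂ) (n : ℕ) (z : ℂ) : ℂ :=
  (ee 2 ρ - ee 1 ρ) * (Complex.I * ρ) ^ n * Complex.exp (Complex.I * ρ * z)
  + (ee 0 ρ - ee 2 ρ) * (Complex.I * (om * ρ)) ^ n * Complex.exp (Complex.I * (om * ρ) * z)
  + (ee 1 ρ - ee 0 ρ) * (Complex.I * (om ^ 2 * ρ)) ^ n
    * Complex.exp (Complex.I * (om ^ 2 * ρ) * z)

lemma hasDerivAt_efun (ρ : ℂ) (n : ℕ) (z : ℂ) :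
    HasDerivAt (efun ρ n) (efun ρ (n + 1) z) z := by
  have key : ∀ c d : ℂ, HasDerivAt (fun z => d * c ^ n * Complex.exp (c * z))
      (d * c ^ (n + 1) * Complex.exp (c * z)) z := by
    intro c d
    have h := (((hasDerivAt_id z).const_mul c).cexp).const_mul (d * c ^ n)
    refine h.congr_deriv ?_
    simp; ring
  exact ((key _ _).add (key _ _)).add (key _ _)

lemma efun_add_three (ρ : ℂ) (n : ℕ) (z : ℂ) :
    efun ρ (n + 3) z = (Complex.I * ρ) ^ 3 * efun ρ n z := by
  have h1 : (Complex.I * (om * ρ)) ^ 3 = (Complex.I * ρ) ^ 3 := by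
    linear_combination (Complex.I * ρ) ^ 3 * om_cube
  have h2 : (Complex.I * (om ^ 2 * ρ)) ^ 3 = (Complex.I * ρ) ^ 3 := by
    linear_combination (Complex.I * ρ) ^ 3 * (om ^ 3 + 1) * om_cube
  simp only [efun, pow_add _ n 3, h1, h2]
  ring

lemma efun_three_mul_add (ρ : ℂ) (m n : ℕ) (z : ℂ) :
    efun ρ (3 * m + n) z = (Complex.I * ρ) ^ (3 * m) * efun ρ n z := by
  induction m with
  | zero => simp
  | succ m ih =>
    rw [show 3 * (m + 1) + n = (3 * m + n) + 3 by ring, efun_add_three, ih]; ring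

lemma efun_left (ρ : ℂ) : efun ρ 0 0 = 0 := by simp [efun]

lemma exp_eq_ee_zero (ρ : ℂ) : Complex.exp (Complex.I * ρ) = ee 0 ρ := by simp [ee]

lemma exp_eq_ee_one (ρ : ℂ) : Complex.exp (Complex.I * (om * ρ)) = ee 1 ρ := by simp [ee]

lemma exp_eq_ee_two (ρ : ℂ) : Complex.exp (Complex.I * (om ^ 2 * ρ)) = ee 2 ρ := by simp [ee]

lemma efun_right (ρ : ℂ) : efun ρ 0 1 = 0 := by
  simp only [efun, mul_one, exp_eq_ee_one, exp_eq_ee_two]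
  rw [exp_eq_ee_zero]; ring

lemma efun_one_left (ρ : ℂ) : efun ρ 1 0 =
    Complex.I * ρ * (om - om ^ 2) * (ee 0 ρ + om * ee 1 ρ + om ^ 2 * ee 2 ρ) := by
  have h := om_cube
  simp [efun]
  generalize om = w at *
  generalize ee 0 ρ = x at *
  generalize ee 1 ρ = y at *
  generalize ee 2 ρ = z at *
  generalize Complex.I = i at *
  grind

lemma efun_one_right (ρ : ℂ) : efun ρ 1 1 = -(Complex.I * ρ * (om - om ^ 2) *
    ((ee 0 ρ)⁻¹ + om * (ee 1 ρ)⁻¹ + om ^ 2 * (ee 2 ρ)⁻¹)) := by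
  have h := om_cube
  simp only [efun, mul_one, exp_eq_ee_one, exp_eq_ee_two, ee_inv_zero, ee_inv_one, ee_inv_two,
    pow_one]
  rw [exp_eq_ee_zero]
  generalize om = w at *
  generalize ee 0 ρ = x at *
  generalize ee 1 ρ = y at *
  generalize ee 2 ρ = z at *
  generalize Complex.I = i at *
  grind

/-- At a zero of `charF β` the function `efun ρ 0` satisfies the coupling condition of the spatial
problem. -/
lemma efun_coupled (β : ℝ) (ρ : ℂ) : efun ρ 1 0 - β * efun ρ 1 1 =
    Complex.I * ρ * (om - om ^ 2) * charF β ρ := by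
  rw [efun_one_left, efun_one_right, charF]; ring

lemma ee_neg (r : ℕ) (ρ : ℂ) : ee r (-ρ) = (ee r ρ)⁻¹ := by
  rw [ee, ee, ← Complex.exp_neg]; congr 1; ring

/-- At a zero `ρ` of `charF β` the function `efun (-ρ) 0` satisfies the coupling condition
`ψ'(1) = β ψ'(0)` of the adjoint problem. -/
lemma efun_neg_coupled (β : ℝ) (ρ : ℂ) : β * efun (-ρ) 1 0 - efun (-ρ) 1 1 =
    -(Complex.I * ρ * (om - om ^ 2) * charF β ρ) := by
  rw [efun_one_left, efun_one_right, charF]; simp only [ee_neg, inv_inv]; ring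

/-! ### Symmetries -/

lemma charF_om (β : ℝ) (ρ : ℂ) : charF β (om * ρ) = om ^ 2 * charF β ρ := by
  have h := om_cube
  have h3 : ee 3 ρ = ee 0 ρ := ee_mod 0 ρ
  simp only [charF, ee_om, zero_add, Nat.reduceAdd, h3]
  linear_combination (-(ee 1 ρ + β * (ee 1 ρ)⁻¹) - om * (ee 2 ρ + β * (ee 2 ρ)⁻¹)) * h

lemma ee_zero_neg_conj (ρ : ℂ) : ee 0 (-(starRingEnd ℂ) ρ) = (starRingEnd ℂ) (ee 0 ρ) := by
  rw [ee, ee, ← Complex.exp_conj]; simp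

lemma ee_one_neg_conj (ρ : ℂ) : ee 1 (-(starRingEnd ℂ) ρ) = (starRingEnd ℂ) (ee 2 ρ) := by
  rw [ee, ee, ← Complex.exp_conj]
  simp only [map_mul, map_pow, Complex.conj_I, conj_om]
  congr 1
  linear_combination (Complex.I * om * (starRingEnd ℂ) ρ) * om_cube

lemma ee_two_neg_conj (ρ : ℂ) : ee 2 (-(starRingEnd ℂ) ρ) = (starRingEnd ℂ) (ee 1 ρ) := by
  rw [ee, ee, ← Complex.exp_conj]
  simp only [map_mul, map_pow, Complex.conj_I, conj_om]
  congr 1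
  ring

lemma charF_neg_conj (β : ℝ) (ρ : ℂ) :
    charF β (-(starRingEnd ℂ) ρ) = (starRingEnd ℂ) (charF β ρ) := by
  simp only [charF, ee_zero_neg_conj, ee_one_neg_conj, ee_two_neg_conj, map_add, map_mul, map_inv₀,
    map_pow, conj_om, Complex.conj_ofReal]
  linear_combination (-om * ((starRingEnd ℂ) (ee 2 ρ) + β * ((starRingEnd ℂ) (ee 2 ρ))⁻¹)) * om_cube

/-- The closed sector `|arg ρ| ≤ π/6`. -/
def InSector (ρ : ℂ) : Prop := Real.sqrt 3 * |ρ.im| ≤ ρ.re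

/-- The rotations by `ω` and the reflection `ρ ↦ -ρ̄` carry the sector `|arg ρ| ≤ π/6` over the
whole plane. -/
lemma sector_induction {P : ℂ → Prop} (hS : ∀ ρ, InSector ρ → P ρ)
    (hom : ∀ ρ, P ρ → P (om * ρ)) (hconj : ∀ ρ, P ρ → P (-(starRingEnd ℂ) ρ)) (ρ : ℂ) : P ρ := by
  have hs : Real.sqrt 3 * Real.sqrt 3 = 3 := Real.mul_self_sqrt (by norm_num)
  have hs0 : 0 < Real.sqrt 3 := Real.sqrt_pos.2 (by norm_num)
  have back1 : ∀ ρ, P (om * ρ) → P ρ := fun ρ h => by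
    have := hom _ (hom _ h)
    rwa [show om * (om * (om * ρ)) = ρ by linear_combination ρ * om_cube] at this
  have back2 : ∀ ρ, P (om ^ 2 * ρ) → P ρ := fun ρ h => by
    have := hom _ h
    rwa [show om * (om ^ 2 * ρ) = ρ by linear_combination ρ * om_cube] at this
  have hS' : ∀ ρ : ℂ, Real.sqrt 3 * |ρ.im| ≤ -ρ.re → P ρ := fun ρ h => by
    have := hconj _ (hS (-(starRingEnd ℂ) ρ) (by simpa [InSector] using h))
    simpa using this
  obtain ⟨x, y⟩ := ρ
  have e1 : om * ⟨x, y⟩ = ⟨-x / 2 - Real.sqrt 3 * y / 2, -y / 2 + Real.sqrt 3 * x / 2⟩ := by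
    apply Complex.ext <;> simp [om_re, om_im] <;> ring
  have e2 : om ^ 2 * ⟨x, y⟩ = ⟨-x / 2 + Real.sqrt 3 * y / 2, -y / 2 - Real.sqrt 3 * x / 2⟩ := by
    rw [om_sq]; apply Complex.ext <;> simp [om_re, om_im] <;> ring
  have habs : ∀ u v : ℝ, Real.sqrt 3 * v ≤ u → -(Real.sqrt 3 * v) ≤ u → Real.sqrt 3 * |v| ≤ u := by
    intro u v h1 h2
    rcases abs_cases v with h | h <;> rw [h.1] <;> linarith
  by_cases c1 : Real.sqrt 3 * |y| ≤ x
  · exact hS _ c1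
  by_cases c2 : Real.sqrt 3 * |y| ≤ -x
  · exact hS' _ c2
  rcases le_total 0 y with hy | hy <;> rcases le_total 0 x with hx | hx
  · rw [abs_of_nonneg hy] at c1 c2
    apply back1; rw [e1]; apply hS'
    apply habs <;> simp only <;> nlinarith
  · rw [abs_of_nonneg hy] at c1 c2
    apply back2; rw [e2]; apply hS
    apply habs <;> simp only <;> nlinarith
  · rw [abs_of_nonpos hy] at c1 c2
    apply back2; rw [e2]; apply hS'
    apply habs <;> simp only <;> nlinarith
  · rw [abs_of_nonpos hy] at c1 c2
    apply back1; rw [e1]; apply hS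
    apply habs <;> simp only <;> nlinarith

/-! ### Asymptotics of the characteristic determinant in a sector -/

lemma norm_ee_zero (ρ : ℂ) : ‖ee 0 ρ‖ = Real.exp (-ρ.im) := by
  simp [ee, Complex.norm_exp]

lemma norm_ee_one (ρ : ℂ) : ‖ee 1 ρ‖ = Real.exp (ρ.im / 2 - Real.sqrt 3 * ρ.re / 2) := by
  rw [ee, Complex.norm_exp]; congr 1; simp [om_re, om_im]; ring

lemma norm_ee_two (ρ : ℂ) : ‖ee 2 ρ‖ = Real.exp (ρ.im / 2 + Real.sqrt 3 * ρ.re / 2) := by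
  rw [ee, Complex.norm_exp, om_sq]; congr 1; simp [om_re, om_im]; ring

/-- The growth scale `∑_r (|e_r| + |e_r|⁻¹)`. -/
noncomputable def gr (ρ : ℂ) : ℝ :=
  (‖ee 0 ρ‖ + ‖(ee 0 ρ)⁻¹‖) + (‖ee 1 ρ‖ + ‖(ee 1 ρ)⁻¹‖) + (‖ee 2 ρ‖ + ‖(ee 2 ρ)⁻¹‖)

lemma gr_om (ρ : ℂ) : gr (om * ρ) = gr ρ := by
  have h3 : ee 3 ρ = ee 0 ρ := ee_mod 0 ρ
  simp only [gr, ee_om, zero_add, Nat.reduceAdd, h3]; ring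

lemma gr_neg_conj (ρ : ℂ) : gr (-(starRingEnd ℂ) ρ) = gr ρ := by
  simp only [gr, ee_zero_neg_conj, ee_one_neg_conj, ee_two_neg_conj, norm_inv, RCLike.norm_conj]
  ring

lemma one_le_gr (ρ : ℂ) : 1 ≤ gr ρ := by
  have h : (0 : ℝ) < ‖ee 0 ρ‖ := norm_pos_iff.2 (ee_ne_zero _ _)
  have h2 : 1 ≤ ‖ee 0 ρ‖ + ‖ee 0 ρ‖⁻¹ := by
    rcases le_total 1 ‖ee 0 ρ‖ with h' | h'
    · linarith [inv_pos.2 h]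
    · linarith [(one_le_inv₀ h).2 h']
  simp only [gr, norm_inv]
  have : ∀ r, 0 ≤ ‖ee r ρ‖ + ‖ee r ρ‖⁻¹ := fun r => by positivity
  linarith [this 1, this 2]

/-- The size of the dominant exponentials in the sector `|arg ρ| ≤ π/6`. -/
noncomputable def dom (ρ : ℂ) : ℝ := ‖ee 2 ρ‖ * max 1 ‖ee 0 ρ‖

lemma dom_eq (ρ : ℂ) : dom ρ = Real.exp (Real.sqrt 3 * ρ.re / 2 + |ρ.im| / 2) := by
  rw [dom, norm_ee_two, norm_ee_zero]
  rcases le_total 0 ρ.im with h | h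
  · rw [max_eq_left (by simpa using h), abs_of_nonneg h, mul_one]; ring_nf
  · rw [max_eq_right (by simpa using h), abs_of_nonpos h, ← Real.exp_add]; ring_nf

lemma dom_pos (ρ : ℂ) : 0 < dom ρ := by rw [dom_eq]; positivity

lemma sqrt_three_bounds : 17 / 10 < Real.sqrt 3 ∧ Real.sqrt 3 < 18 / 10 :=
  ⟨Real.lt_sqrt_of_sq_lt (by norm_num), (Real.sqrt_lt' (by norm_num)).2 (by norm_num)⟩

lemma InSector.three_mul_abs_le {ρ : ℂ} (h : InSector ρ) : 3 * |ρ.im| ≤ Real.sqrt 3 * ρ.re := by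
  have hs : Real.sqrt 3 * Real.sqrt 3 = 3 := Real.mul_self_sqrt (by norm_num)
  have h' := mul_le_mul_of_nonneg_left h (Real.sqrt_nonneg 3)
  rwa [← mul_assoc, hs] at h'

lemma InSector.re_nonneg {ρ : ℂ} (h : InSector ρ) : 0 ≤ ρ.re :=
  le_trans (by positivity) h

lemma InSector.exp_abs_im_le {ρ : ℂ} (h : InSector ρ) :
    Real.exp |ρ.im| ≤ Real.exp (-ρ.re / 2) * dom ρ := by
  rw [dom_eq, ← Real.exp_add, Real.exp_le_exp]
  nlinarith [h.three_mul_abs_le, h.re_nonneg, sqrt_three_bounds.1]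

lemma InSector.exp_abs_im_le_dom {ρ : ℂ} (h : InSector ρ) : Real.exp |ρ.im| ≤ dom ρ := by
  refine h.exp_abs_im_le.trans ?_
  have : Real.exp (-ρ.re / 2) ≤ 1 := Real.exp_le_one_iff.2 (by linarith [h.re_nonneg])
  nlinarith [dom_pos ρ]

lemma InSector.small_le {ρ : ℂ} (h : InSector ρ) :
    ‖ee 0 ρ‖ ≤ Real.exp |ρ.im| ∧ ‖(ee 0 ρ)⁻¹‖ ≤ Real.exp |ρ.im| ∧ ‖ee 1 ρ‖ ≤ Real.exp |ρ.im| ∧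
      ‖(ee 2 ρ)⁻¹‖ ≤ Real.exp |ρ.im| := by
  have h1 := h.three_mul_abs_le
  have h2 := le_abs_self ρ.im
  have h3 := neg_abs_le ρ.im
  simp only [norm_inv, norm_ee_zero, norm_ee_one, norm_ee_two, ← Real.exp_neg, Real.exp_le_exp]
  refine ⟨?_, ?_, ?_, ?_⟩ <;> linarith

lemma InSector.gr_le {ρ : ℂ} (h : InSector ρ) : gr ρ ≤ 6 * dom ρ := by
  obtain ⟨a1, a2, a3, a4⟩ := h.small_le
  have hd := h.exp_abs_im_le_dom
  have hm1 := le_max_left 1 ‖ee 0 ρ‖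
  have hm2 := le_max_right 1 ‖ee 0 ρ‖
  have h5 : ‖ee 2 ρ‖ ≤ dom ρ := le_mul_of_one_le_right (norm_nonneg _) hm1
  have h6 : ‖(ee 1 ρ)⁻¹‖ ≤ dom ρ := by
    rw [ee_inv_one, norm_mul, mul_comm]
    exact mul_le_mul_of_nonneg_left hm2 (norm_nonneg _)
  unfold gr
  linarith

/-- The factor `1 + βω² e^{iρ}` of the dominant part of `charF`. -/
noncomputable def pfac (β : ℝ) (ρ : ℂ) : ℂ := 1 + β * om ^ 2 * ee 0 ρ

lemma norm_sum_four_le {E : ℝ} {a b c d : ℂ} (ha : ‖a‖ ≤ E) (hb : ‖b‖ ≤ E) (hc : ‖c‖ ≤ E)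
    (hd : ‖d‖ ≤ E) : ‖a + b + c + d‖ ≤ 4 * E := by
  have h1 := norm_add_le (a + b + c) d
  have h2 := norm_add_le (a + b) c
  have h3 := norm_add_le a b
  linarith

lemma norm_mul_le_of_le_one {E : ℝ} {a b : ℂ} (ha : ‖a‖ ≤ 1) (hb : ‖b‖ ≤ E) : ‖a * b‖ ≤ E := by
  rw [norm_mul]
  nlinarith [norm_nonneg a, norm_nonneg b]

lemma norm_beta_le {β : ℝ} (hβ : β ∈ Set.Ioo (0 : ℝ) 1) : ‖(β : ℂ)‖ ≤ 1 := by
  rw [Complex.norm_real, Real.norm_of_nonneg hβ.1.le]; exact hβ.2.le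

/-- In the sector `|arg ρ| ≤ π/6` the exponentials `e_2` and `e_0 e_2 = e_1⁻¹` dominate, all the
others being at most `e^{|Im ρ|}`. -/
lemma InSector.charF_approx {β : ℝ} (hβ : β ∈ Set.Ioo (0 : ℝ) 1) {ρ : ℂ} (h : InSector ρ) :
    ‖charF β ρ - om ^ 2 * ee 2 ρ * pfac β ρ‖ ≤ 4 * (Real.exp (-ρ.re / 2) * dom ρ) := by
  obtain ⟨a1, a2, a3, a4⟩ := h.small_le
  have hb := norm_beta_le hβ
  refine le_trans ?_ (mul_le_mul_of_nonneg_left h.exp_abs_im_le (by norm_num))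
  have e : charF β ρ - om ^ 2 * ee 2 ρ * pfac β ρ
      = ee 0 ρ + β * (ee 0 ρ)⁻¹ + om * ee 1 ρ + (β * om ^ 2) * (ee 2 ρ)⁻¹ := by
    rw [charF, pfac, ee_inv_one]
    linear_combination (-om * ee 2 ρ * β * ee 0 ρ) * om_cube
  rw [e]
  refine norm_sum_four_le a1 (norm_mul_le_of_le_one hb a2)
    (norm_mul_le_of_le_one norm_om.le a3) (norm_mul_le_of_le_one ?_ a4)
  rw [norm_mul, norm_pow, norm_om]; simpa using hb

/-- The derivative of `charF`. -/
noncomputable def charF' (β : ℝ) (ρ : ℂ) : ℂ :=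
  Complex.I * ((ee 0 ρ - β * (ee 0 ρ)⁻¹) + om ^ 2 * (ee 1 ρ - β * (ee 1 ρ)⁻¹)
    + om * (ee 2 ρ - β * (ee 2 ρ)⁻¹))

lemma hasDerivAt_ee (r : ℕ) (ρ : ℂ) : HasDerivAt (ee r) (Complex.I * om ^ r * ee r ρ) ρ := by
  have h := (((hasDerivAt_id ρ).const_mul (om ^ r)).const_mul Complex.I).cexp
  refine h.congr_deriv ?_
  simp [ee]; ring

lemma hasDerivAt_ee_inv (r : ℕ) (ρ : ℂ) :
    HasDerivAt (fun ρ => (ee r ρ)⁻¹) (-(Complex.I * om ^ r * (ee r ρ)⁻¹)) ρ := by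
  refine ((hasDerivAt_ee r ρ).fun_inv (ee_ne_zero r ρ)).congr_deriv ?_
  field_simp [ee_ne_zero r ρ]

lemma hasDerivAt_charF (β : ℝ) (ρ : ℂ) : HasDerivAt (charF β) (charF' β ρ) ρ := by
  have key : ∀ r, HasDerivAt (fun ρ => ee r ρ + β * (ee r ρ)⁻¹)
      (Complex.I * om ^ r * (ee r ρ - β * (ee r ρ)⁻¹)) ρ := fun r =>
    ((hasDerivAt_ee r ρ).add ((hasDerivAt_ee_inv r ρ).const_mul (β : ℂ))).congr_deriv (by ring)
  refine (((key 0).add ((key 1).const_mul om)).add ((key 2).const_mul (om ^ 2))).congr_deriv ?_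
  rw [charF']
  linear_combination (Complex.I * om * (ee 2 ρ - β * (ee 2 ρ)⁻¹)) * om_cube

lemma differentiable_charF (β : ℝ) : Differentiable ℂ (charF β) := fun ρ =>
  (hasDerivAt_charF β ρ).differentiableAt

lemma norm_charF'_om (β : ℝ) (ρ : ℂ) : ‖charF' β (om * ρ)‖ = ‖charF' β ρ‖ := by
  have h3 : ee 3 ρ = ee 0 ρ := ee_mod 0 ρ
  have : charF' β (om * ρ) = om * charF' β ρ := by
    simp only [charF', ee_om, zero_add, Nat.reduceAdd, h3]
    linear_combination (-Complex.I * (ee 1 ρ - β * (ee 1 ρ)⁻¹)) * om_cube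
  rw [this, norm_mul, norm_om, one_mul]

lemma norm_charF'_neg_conj (β : ℝ) (ρ : ℂ) : ‖charF' β (-(starRingEnd ℂ) ρ)‖ = ‖charF' β ρ‖ := by
  have : charF' β (-(starRingEnd ℂ) ρ) = -(starRingEnd ℂ) (charF' β ρ) := by
    simp only [charF', ee_zero_neg_conj, ee_one_neg_conj, ee_two_neg_conj, map_add, map_sub,
      map_mul, map_inv₀, map_pow, conj_om, Complex.conj_ofReal, Complex.conj_I]
    linear_combination (-Complex.I * om * ((starRingEnd ℂ) (ee 1 ρ)
      - β * ((starRingEnd ℂ) (ee 1 ρ))⁻¹)) * om_cube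
  rw [this, norm_neg, RCLike.norm_conj]

/-- Differentiating the dominant part `ω² e_2 + βω e_0 e_2` of `charF β` gives
`-i e_2 (ω² + (1 + βω² e_0))` up to the same error. -/
lemma InSector.charF'_approx {β : ℝ} (hβ : β ∈ Set.Ioo (0 : ℝ) 1) {ρ : ℂ} (h : InSector ρ) :
    ‖charF' β ρ + Complex.I * ee 2 ρ * (om ^ 2 + pfac β ρ)‖
      ≤ 4 * (Real.exp (-ρ.re / 2) * dom ρ) := by
  obtain ⟨a1, a2, a3, a4⟩ := h.small_le
  have hb := norm_beta_le hβ
  refine le_trans ?_ (mul_le_mul_of_nonneg_left h.exp_abs_im_le (by norm_num))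
  have e : charF' β ρ + Complex.I * ee 2 ρ * (om ^ 2 + pfac β ρ)
      = Complex.I * ee 0 ρ + (-(Complex.I * β)) * (ee 0 ρ)⁻¹ + Complex.I * om ^ 2 * ee 1 ρ
        + (-(Complex.I * β * om)) * (ee 2 ρ)⁻¹ := by
    rw [charF', pfac, ee_inv_one]
    linear_combination (Complex.I * ee 2 ρ) * om_sq
  rw [e]
  have hI : ‖Complex.I‖ = 1 := Complex.norm_I
  refine norm_sum_four_le (norm_mul_le_of_le_one hI.le a1) (norm_mul_le_of_le_one ?_ a2)
    (norm_mul_le_of_le_one ?_ a3) (norm_mul_le_of_le_one ?_ a4)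
  · simpa using hb
  · simp [norm_om]
  · simpa [norm_om] using hb

/-! ### Localisation of the zeros in a sector -/

/-- Quantitative form of the fact that `1 - e^{iζ}` vanishes only on `2πℤ`. -/
lemma exists_int_near_of_norm_one_sub_exp_le {ζ : ℂ} {δ : ℝ} (hδ : δ ≤ 1 / 4)
    (h : ‖1 - Complex.exp (Complex.I * ζ)‖ ≤ δ * max 1 ‖Complex.exp (Complex.I * ζ)‖) :
    ∃ n : ℤ, ‖ζ - 2 * Real.pi * n‖ ≤ 3 * δ := by
  set w := Complex.exp (Complex.I * ζ) with hw
  have hδ0 : 0 ≤ δ := by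
    by_contra! hneg
    have : δ * max 1 ‖w‖ < 0 := mul_neg_of_neg_of_pos hneg (by positivity)
    linarith [norm_nonneg (1 - w)]
  have h1 : ‖w‖ ≤ 4 / 3 := by
    by_contra! hgt
    rw [max_eq_right (by linarith)] at h
    have h2 : ‖w‖ ≤ ‖(1 : ℂ)‖ + ‖1 - w‖ := by
      have := norm_sub_le (1 : ℂ) (1 - w); simpa using this
    rw [norm_one] at h2
    nlinarith
  have h3 : ‖1 - w‖ ≤ 4 / 3 * δ := by
    have : max 1 ‖w‖ ≤ 4 / 3 := max_le (by norm_num) h1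
    nlinarith
  have h4 : ‖w - 1‖ ≤ 4 / 3 * δ := by rwa [norm_sub_rev]
  have h5 := Complex.norm_log_one_add_half_le_self (z := w - 1) (by linarith)
  have h6 : Complex.exp (Complex.log (1 + (w - 1))) = Complex.exp (Complex.I * ζ) := by
    rw [Complex.exp_log, add_sub_cancel]
    rw [add_sub_cancel]; exact Complex.exp_ne_zero _
  obtain ⟨n, hn⟩ := Complex.exp_eq_exp_iff_exists_int.1 h6
  refine ⟨-n, ?_⟩
  have h7 : Complex.I * (ζ - 2 * Real.pi * (-n : ℤ)) = Complex.log (1 + (w - 1)) := by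
    rw [hn]; push_cast; ring
  have h8 : ‖ζ - 2 * Real.pi * (-n : ℤ)‖ = ‖Complex.log (1 + (w - 1))‖ := by
    rw [← h7, norm_mul, Complex.norm_I, one_mul]
  rw [h8]
  linarith

/-- The base point of the lattice `nu β + 2πℤ` near which the zeros in the sector lie. -/
noncomputable def nu (β : ℝ) : ℂ := ((-(Real.pi / 3) : ℝ) : ℂ) + Complex.I * Real.log β

lemma exp_pi_div_three : Complex.exp (((Real.pi / 3 : ℝ) : ℂ) * Complex.I) = -om ^ 2 := by
  rw [Complex.exp_mul_I, ← Complex.ofReal_cos, ← Complex.ofReal_sin, Real.cos_pi_div_three,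
    Real.sin_pi_div_three, om_sq, om_eq]
  push_cast; ring

lemma exp_sub_nu {β : ℝ} (hβ : 0 < β) (ρ : ℂ) :
    Complex.exp (Complex.I * (ρ - nu β)) = -(β * om ^ 2 * ee 0 ρ) := by
  have e : Complex.I * (ρ - nu β) = Complex.I * ρ + (Real.log β : ℂ)
      + ((Real.pi / 3 : ℝ) : ℂ) * Complex.I := by
    rw [nu]; push_cast
    linear_combination (-(Real.log β : ℂ)) * Complex.I_sq
  rw [e, Complex.exp_add, Complex.exp_add, exp_pi_div_three, exp_eq_ee_zero, ← Complex.ofReal_exp,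
    Real.exp_log hβ]
  ring

lemma pfac_eq {β : ℝ} (hβ : 0 < β) (ρ : ℂ) :
    pfac β ρ = 1 - Complex.exp (Complex.I * (ρ - nu β)) := by
  rw [exp_sub_nu hβ, pfac]; ring

lemma max_le_inv_mul {β : ℝ} (hβ : β ∈ Set.Ioo (0 : ℝ) 1) (ρ : ℂ) :
    β * max 1 ‖ee 0 ρ‖ ≤ max 1 ‖Complex.exp (Complex.I * (ρ - nu β))‖ := by
  rw [exp_sub_nu hβ.1, norm_neg, norm_mul, norm_mul, norm_pow, norm_om, Complex.norm_real,
    Real.norm_of_nonneg hβ.1.le, mul_max_of_nonneg _ _ hβ.1.le]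
  refine max_le_max ?_ ?_
  · linarith [hβ.2]
  · simp

/-- If `charF` is small compared with the dominant exponentials at a point of the sector, then
that point is close to the lattice. -/
lemma InSector.exists_int_near {β : ℝ} (hβ : β ∈ Set.Ioo (0 : ℝ) 1) {ρ : ℂ} (h : InSector ρ)
    {δ : ℝ} (hδ : δ ≤ 1 / 4)
    (hF : ‖charF β ρ‖ + 4 * (Real.exp (-ρ.re / 2) * dom ρ) ≤ δ * β * dom ρ) :
    ∃ n : ℤ, ‖ρ - nu β - 2 * Real.pi * n‖ ≤ 3 * δ := by
  apply exists_int_near_of_norm_one_sub_exp_le hδ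
  rw [← pfac_eq hβ.1]
  have h1 := h.charF_approx hβ
  have h2 : ‖om ^ 2 * ee 2 ρ * pfac β ρ‖ ≤ δ * β * dom ρ := by
    have := norm_sub_le (charF β ρ) (charF β ρ - om ^ 2 * ee 2 ρ * pfac β ρ)
    rw [sub_sub_cancel] at this
    linarith
  rw [norm_mul, norm_mul, norm_pow, norm_om, one_pow, one_mul, dom] at h2
  have hδ0 : 0 ≤ δ := by
    by_contra! hneg
    have h3 : δ * β * dom ρ < 0 :=
      mul_neg_of_neg_of_pos (mul_neg_of_neg_of_pos hneg hβ.1) (dom_pos ρ)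
    have : 0 ≤ Real.exp (-ρ.re / 2) * dom ρ := by have := dom_pos ρ; positivity
    linarith [norm_nonneg (charF β ρ)]
  have h4 : ‖ee 2 ρ‖ * ‖pfac β ρ‖ ≤ ‖ee 2 ρ‖ * (δ * (β * max 1 ‖ee 0 ρ‖)) := by
    linarith
  have h5 := le_of_mul_le_mul_left h4 (norm_pos_iff.2 (ee_ne_zero 2 ρ))
  exact h5.trans (mul_le_mul_of_nonneg_left (max_le_inv_mul hβ ρ) hδ0)

lemma InSector.norm_le {ρ : ℂ} (h : InSector ρ) : ‖ρ‖ ≤ 2 * ρ.re := by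
  have h1 := Complex.norm_le_abs_re_add_abs_im ρ
  rw [abs_of_nonneg h.re_nonneg] at h1
  unfold InSector at h
  nlinarith [sqrt_three_bounds.1, abs_nonneg ρ.im]

/-- In the sector the relative error `e^{-Re ρ / 2}` tends to zero as `ρ → ∞`. -/
lemma tendsto_exp_neg_half_re : ∀ c > (0 : ℝ), ∃ R : ℝ, ∀ ρ : ℂ, InSector ρ → R ≤ ‖ρ‖ →
    Real.exp (-ρ.re / 2) ≤ c := by
  intro c hc
  refine ⟨4 * (-Real.log c), fun ρ h hR => ?_⟩
  rw [← Real.le_log_iff_exp_le hc]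
  linarith [h.norm_le]

/-- At the zeros of large modulus the derivative of `charF` is of the order of the growth scale. -/
lemma exists_norm_charF'_ge {β : ℝ} (hβ : β ∈ Set.Ioo (0 : ℝ) 1) : ∃ c > (0 : ℝ), ∃ R : ℝ,
    ∀ ρ : ℂ, R ≤ ‖ρ‖ → charF β ρ = 0 → c * gr ρ ≤ ‖charF' β ρ‖ := by
  obtain ⟨R, hR⟩ := tendsto_exp_neg_half_re (β / 32) (by linarith [hβ.1])
  refine ⟨β / 24, by linarith [hβ.1], R, fun ρ => ?_⟩
  induction ρ using sector_induction with
  | hom ρ ih =>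
    rw [norm_mul, norm_om, one_mul, gr_om, norm_charF'_om, charF_om]
    intro h h0
    exact ih h (by simpa [om_ne_zero] using h0)
  | hconj ρ ih =>
    rw [norm_neg, RCLike.norm_conj, gr_neg_conj, norm_charF'_neg_conj, charF_neg_conj]
    intro h h0
    exact ih h (by simpa using h0)
  | hS ρ h =>
    intro hρ h0
    have hx := hR ρ h hρ
    have a1 := h.charF_approx hβ
    have a2 := h.charF'_approx hβ
    rw [h0, zero_sub, norm_neg, norm_mul, norm_mul, norm_pow, norm_om, one_pow, one_mul] at a1
    have hg := h.gr_le
    have hd := dom_pos ρ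
    have e2 := norm_pos_iff.2 (ee_ne_zero 2 ρ)
    set m := max 1 ‖ee 0 ρ‖ with hm
    have hdm : dom ρ = ‖ee 2 ρ‖ * m := rfl
    have hxd : Real.exp (-ρ.re / 2) * dom ρ ≤ β / 32 * dom ρ :=
      mul_le_mul_of_nonneg_right hx hd.le
    -- At a zero the factor `1 + βω² e_0` is small, hence `β |e_0|` is close to `1` and the dominant
    -- part of the derivative, `-i e_2 (ω² + small)`, has modulus about `|e_2|`.
    have hp : ‖pfac β ρ‖ ≤ β / 8 * m := by
      refine le_of_mul_le_mul_left ?_ e2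
      rw [hdm] at a1 hxd
      linarith
    have hm2 : β * m ≤ 2 := by
      have h1 : β * ‖ee 0 ρ‖ ≤ 1 + ‖pfac β ρ‖ := by
        have := norm_sub_le (pfac β ρ) 1
        rw [pfac, add_sub_cancel_left, norm_mul, norm_mul, norm_pow, norm_om, Complex.norm_real,
          Real.norm_of_nonneg hβ.1.le, norm_one] at this
        rw [pfac]; linarith
      rcases max_cases 1 ‖ee 0 ρ‖ with hc | hc
      · rw [hm, hc.1]; linarith [hβ.2]
      · have hc1 : m = ‖ee 0 ρ‖ := hc.1
        rw [hc1] at hp ⊢; nlinarith [hβ.1, norm_nonneg (ee 0 ρ)]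
    have h6 : ‖ee 2 ρ‖ * (1 - ‖pfac β ρ‖) ≤ ‖Complex.I * ee 2 ρ * (om ^ 2 + pfac β ρ)‖ := by
      rw [norm_mul, norm_mul, Complex.norm_I, one_mul]
      refine mul_le_mul_of_nonneg_left ?_ e2.le
      have := norm_sub_le (om ^ 2 + pfac β ρ) (pfac β ρ)
      rw [add_sub_cancel_right, norm_pow, norm_om] at this
      linarith
    have h7 : ‖Complex.I * ee 2 ρ * (om ^ 2 + pfac β ρ)‖ ≤ ‖charF' β ρ‖
        + 4 * (Real.exp (-ρ.re / 2) * dom ρ) := by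
      have := norm_sub_le (charF' β ρ + Complex.I * ee 2 ρ * (om ^ 2 + pfac β ρ)) (charF' β ρ)
      rw [add_sub_cancel_left] at this
      linarith
    have h8 : β / 8 * dom ρ ≤ ‖ee 2 ρ‖ / 4 := by rw [hdm]; nlinarith
    have h9 : ‖pfac β ρ‖ ≤ 1 / 4 := by linarith
    have h10 : ‖ee 2 ρ‖ * ‖pfac β ρ‖ ≤ ‖ee 2 ρ‖ * (1 / 4) := mul_le_mul_of_nonneg_left h9 e2.le
    nlinarith [hβ.1]

lemma nu_add (β : ℝ) (k : ℕ) :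
    nu β + 2 * Real.pi * k = (asymRe k : ℂ) + Complex.I * Real.log β := by
  rw [nu, asymRe]; push_cast; ring

/-! ### Counting zeros of entire functions in discs -/

/-- An entire function that does not vanish identically has finite order at every point. -/
lemma analyticOrderAt_ne_top_of_entire {f : ℂ → ℂ} (hf : Differentiable ℂ f) {w : ℂ} (hw : f w ≠ 0)
    (z : ℂ) : analyticOrderAt f z ≠ ⊤ := by
  have h : AnalyticOnNhd ℂ f Set.univ := fun x _ => hf.analyticAt x
  refine h.analyticOrderAt_ne_top_of_isPreconnected (x := w) isPreconnected_univ
    (Set.mem_univ _) (Set.mem_univ _) ?_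
  rw [analyticOrderAt_eq_zero.2 (Or.inr hw)]; simp

/-- An entire function divided by the power of `z - s` that it contains is again entire. -/
lemma exists_entire_factor {f : ℂ → ℂ} (hf : Differentiable ℂ f) {s : ℂ}
    (hs : analyticOrderAt f s ≠ ⊤) : ∃ g : ℂ → ℂ, Differentiable ℂ g ∧ g s ≠ 0 ∧
      ∀ z, f z = (z - s) ^ analyticOrderNatAt f s * g z := by
  obtain ⟨g₀, hg₀, hg₀s, hev⟩ := ((hf.analyticAt s).analyticOrderAt_ne_top).1 hs
  set n := analyticOrderNatAt f s
  classical
  set g : ℂ → ℂ := fun z => if z = s then g₀ s else f z / (z - s) ^ n with hg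
  have hgs : g s = g₀ s := by simp [hg]
  have hgz : ∀ z, z ≠ s → g z = f z / (z - s) ^ n := fun z hz => by simp [hg, hz]
  have hnear : g =ᶠ[𝓝 s] g₀ := by
    filter_upwards [hev] with z hz
    by_cases h : z = s
    · rw [h, hgs]
    · rw [hgz z h, hz, smul_eq_mul, mul_div_cancel_left₀]
      exact pow_ne_zero _ (sub_ne_zero.2 h)
  refine ⟨g, fun z => ?_, by rwa [hgs], fun z => ?_⟩
  · by_cases h : z = s
    · rw [h]; exact hg₀.differentiableAt.congr_of_eventuallyEq hnear
    · have : g =ᶠ[𝓝 z] fun z => f z / (z - s) ^ n := by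
        filter_upwards [isOpen_ne.mem_nhds h] with w hw using hgz w hw
      refine DifferentiableAt.congr_of_eventuallyEq ?_ this
      exact (hf z).div (by fun_prop) (pow_ne_zero _ (sub_ne_zero.2 h))
  · by_cases h : z = s
    · have := hev.self_of_nhds
      rw [h, hgs]; exact this
    · rw [hgz z h, mul_div_cancel₀]
      exact pow_ne_zero _ (sub_ne_zero.2 h)

/-- Dividing out the zeros at a finite set of points, with their multiplicities. -/
lemma exists_entire_prod_factor {f : ℂ → ℂ} (hf : Differentiable ℂ f) {w : ℂ} (hw : f w ≠ 0)
    (S : Finset ℂ) : ∃ g : ℂ → ℂ, Differentiable ℂ g ∧ (∀ s ∈ S, g s ≠ 0) ∧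
      ∀ z, f z = (∏ s ∈ S, (z - s) ^ analyticOrderNatAt f s) * g z := by
  classical
  induction S using Finset.induction_on with
  | empty => exact ⟨f, hf, by simp, by simp⟩
  | insert s S hs ih =>
    obtain ⟨g, hg, hgS, hfg⟩ := ih
    have hPs : (∏ t ∈ S, (s - t) ^ analyticOrderNatAt f t) ≠ 0 :=
      Finset.prod_ne_zero_iff.2 fun t ht => pow_ne_zero _ (sub_ne_zero.2 fun h => hs (h ▸ ht))
    have hgw : g w ≠ 0 := fun h => hw (by rw [hfg, h, mul_zero])
    have hPd : Differentiable ℂ fun z => ∏ t ∈ S, (z - t) ^ analyticOrderNatAt f t := by fun_prop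
    have hP0 : analyticOrderAt (fun z => ∏ t ∈ S, (z - t) ^ analyticOrderNatAt f t) s = 0 :=
      analyticOrderAt_eq_zero.2 (Or.inr hPs)
    have hord : analyticOrderNatAt f s = analyticOrderNatAt g s := by
      have : f = (fun z => ∏ t ∈ S, (z - t) ^ analyticOrderNatAt f t) * g := funext hfg
      rw [analyticOrderNatAt, this, analyticOrderAt_mul (hPd.analyticAt s) (hg.analyticAt s),
        hP0, zero_add, analyticOrderNatAt]
    obtain ⟨k, hk, hks, hgk⟩ := exists_entire_factor hg (analyticOrderAt_ne_top_of_entire hg hgw s)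
    refine ⟨k, hk, fun t ht => ?_, fun z => ?_⟩
    · rcases Finset.mem_insert.1 ht with rfl | ht
      · exact hks
      · intro h
        exact hgS t ht (by rw [hgk, h, mul_zero])
    · rw [Finset.prod_insert hs, hord, hfg z, hgk z]; ring

lemma finite_zeros {f : ℂ → ℂ} (hf : Differentiable ℂ f) {w : ℂ} (hw : f w ≠ 0) (R : ℝ) :
    {z | ‖z‖ < R ∧ f z = 0}.Finite := by
  by_contra hinf
  obtain ⟨x, -, hx⟩ := Set.Infinite.exists_accPt_of_subset_isCompact hinf
    (isCompact_closedBall (0 : ℂ) R) fun z hz => by simpa using hz.1.le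
  have hfr : ∃ᶠ z in 𝓝[≠] x, f z = 0 :=
    (accPt_iff_frequently_nhdsNE.1 hx).mono fun z hz => hz.2
  have h : AnalyticOnNhd ℂ f Set.univ := fun x _ => hf.analyticAt x
  exact hw (h.eqOn_zero_of_preconnected_of_frequently_eq_zero isPreconnected_univ
    (Set.mem_univ x) hfr (Set.mem_univ w))

/-- The number of zeros in the open disc of radius `R`, counted with multiplicity. -/
noncomputable def zeroCount (f : ℂ → ℂ) (R : ℝ) : ℕ :=
  ∑ᶠ z ∈ {z | ‖z‖ < R ∧ f z = 0}, analyticOrderNatAt f z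

/-- The argument principle for an entire function on a circle. -/
lemma circleIntegral_logDeriv {f : ℂ → ℂ} (hf : Differentiable ℂ f) {R : ℝ} (hR : 0 < R)
    (h0 : ∀ z, ‖z‖ = R → f z ≠ 0) :
    (∮ z in C(0, R), logDeriv f z) = 2 * Real.pi * Complex.I * zeroCount f R := by
  have hw : f (R : ℂ) ≠ 0 := h0 _ (by simp [abs_of_pos hR])
  have hfin := finite_zeros hf hw R
  set S := hfin.toFinset with hS
  have hmem : ∀ s, s ∈ S ↔ ‖s‖ < R ∧ f s = 0 := fun s => by simp [hS]
  obtain ⟨g, hg, hgS, hfg⟩ := exists_entire_prod_factor hf hw S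
  have hgne : ∀ z ∈ Metric.closedBall (0 : ℂ) R, g z ≠ 0 := by
    intro z hz h
    have hfz : f z = 0 := by rw [hfg, h, mul_zero]
    have hz' : ‖z‖ ≤ R := by simpa using hz
    rcases hz'.lt_or_eq with h1 | h1
    · exact hgS z ((hmem z).2 ⟨h1, hfz⟩) h
    · exact h0 z h1 hfz
  have hlg : DifferentiableOn ℂ (logDeriv g) {z | g z ≠ 0} := by
    intro z hz
    exact (((hg.deriv z).div (hg z) hz)).differentiableWithinAt
  have hint : (∮ z in C(0, R), logDeriv g z) = 0 := by
    apply DiffContOnCl.circleIntegral_eq_zero hR.le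
    exact hlg.diffContOnCl_ball fun z hz => hgne z hz
  have heq : Set.EqOn (logDeriv f)
      (fun z => (∑ s ∈ S, (analyticOrderNatAt f s : ℂ) * (z - s)⁻¹) + logDeriv g z)
      (Metric.sphere 0 R) := by
    intro z hz
    have hz' : ‖z‖ = R := by simpa using hz
    have hne : ∀ s ∈ S, z - s ≠ 0 := fun s hs h => by
      have := ((hmem s).1 hs).1
      rw [← sub_eq_zero.1 h] at this; linarith
    have hfun : f = fun z => (∏ s ∈ S, (z - s) ^ analyticOrderNatAt f s) * g z := funext hfg
    conv_lhs => rw [hfun]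
    rw [logDeriv_mul z (Finset.prod_ne_zero_iff.2 fun s hs => pow_ne_zero _ (hne s hs))
      (hgne z (by simp [hz'])) (by fun_prop) (hg z)]
    congr 1
    have hp := logDeriv_prod (s := S) (f := fun s (z : ℂ) => (z - s) ^ analyticOrderNatAt f s)
      (x := z) (fun s hs => pow_ne_zero _ (hne s hs)) (fun s _ => by fun_prop)
    rw [hp]
    refine Finset.sum_congr rfl fun s _ => ?_
    rw [logDeriv_fun_pow (by fun_prop), logDeriv_apply]
    simp [div_eq_mul_inv]
  have hball : ∀ s ∈ S, s ∈ Metric.ball (0 : ℂ) R := fun s hs => by simpa using ((hmem s).1 hs).1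
  have hci : ∀ s ∈ S, CircleIntegrable (fun z => (analyticOrderNatAt f s : ℂ) * (z - s)⁻¹) 0 R := by
    intro s hs
    apply ContinuousOn.circleIntegrable hR.le
    refine ContinuousOn.mul continuousOn_const (ContinuousOn.inv₀ (by fun_prop) ?_)
    intro z hz h
    have h1 := hball s hs
    rw [← sub_eq_zero.1 h] at h1
    simp at h1 hz; linarith
  have hcg : CircleIntegrable (logDeriv g) 0 R := by
    apply ContinuousOn.circleIntegrable hR.le
    exact hlg.continuousOn.mono fun z hz => hgne z (Metric.sphere_subset_closedBall hz)
  rw [circleIntegral.integral_congr hR.le heq, circleIntegral.integral_add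
    (CircleIntegrable.fun_sum S hci) hcg, hint, add_zero, circleIntegral.integral_fun_sum hci,
    zeroCount, finsum_mem_eq_finite_toFinset_sum _ hfin, Nat.cast_sum, Finset.mul_sum]
  refine Finset.sum_congr rfl fun s hs => ?_
  rw [circleIntegral.integral_const_mul, circleIntegral.integral_sub_inv_of_mem_ball (hball s hs)]
  ring

lemma circleIntegrable_logDeriv {k : ℂ → ℂ} {R : ℝ} (hk : Differentiable ℂ k) (hR : 0 < R)
    (hk0 : ∀ z, ‖z‖ = R → k z ≠ 0) : CircleIntegrable (logDeriv k) 0 R := by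
  apply ContinuousOn.circleIntegrable hR.le
  intro z hz
  exact ((hk.deriv z).div (hk z) (hk0 z (by simpa using hz))).continuousAt.continuousWithinAt

/-- Rouché's theorem: if `f/g` avoids the closed negative real axis on a circle, then `f` and `g`
have equally many zeros inside, since `log (f/g)` is a primitive of the difference of the
logarithmic derivatives. -/
lemma zeroCount_eq_of_div_mem_slitPlane {f g : ℂ → ℂ} (hf : Differentiable ℂ f)
    (hg : Differentiable ℂ g) {R : ℝ} (hR : 0 < R)
    (h : ∀ z, ‖z‖ = R → g z ≠ 0 ∧ f z / g z ∈ Complex.slitPlane) :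
    zeroCount f R = zeroCount g R := by
  have hf0 : ∀ z, ‖z‖ = R → f z ≠ 0 := fun z hz h0 => by
    have := (h z hz).2; rw [h0, zero_div] at this; simp at this
  have h1 := circleIntegral_logDeriv hf hR hf0
  have h2 := circleIntegral_logDeriv hg hR fun z hz => (h z hz).1
  have h3 : (∮ z in C(0, R), (logDeriv f z - logDeriv g z)) = 0 := by
    apply circleIntegral.integral_eq_zero_of_hasDerivWithinAt
      (f := fun z => Complex.log (f z / g z)) hR.le
    intro z hz
    have hz' : ‖z‖ = R := by simpa using hz
    obtain ⟨hgz, hs⟩ := h z hz'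
    have hd := ((hf z).hasDerivAt.div (hg z).hasDerivAt hgz).clog hs
    refine (hd.congr_deriv ?_).hasDerivWithinAt
    have := hf0 z hz'
    rw [logDeriv_apply, logDeriv_apply]
    simp only [Pi.div_apply]
    field_simp
  rw [circleIntegral.integral_sub (circleIntegrable_logDeriv hf hR hf0)
    (circleIntegrable_logDeriv hg hR fun z hz => (h z hz).1), h1, h2, ← mul_sub] at h3
  have h4 : (zeroCount f R : ℂ) = zeroCount g R := by
    have : (2 * Real.pi * Complex.I : ℂ) ≠ 0 := Complex.two_pi_I_ne_zero
    exact sub_eq_zero.1 ((mul_eq_zero.1 h3).resolve_left this)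
  exact_mod_cast h4

lemma zeroCount_mul {f g : ℂ → ℂ} (hf : Differentiable ℂ f) (hg : Differentiable ℂ g) {R : ℝ}
    (hR : 0 < R) (hf0 : ∀ z, ‖z‖ = R → f z ≠ 0) (hg0 : ∀ z, ‖z‖ = R → g z ≠ 0) :
    zeroCount (fun z => f z * g z) R = zeroCount f R + zeroCount g R := by
  have h1 := circleIntegral_logDeriv hf hR hf0
  have h2 := circleIntegral_logDeriv hg hR hg0
  have h3 := circleIntegral_logDeriv (hf.mul hg) hR fun z hz => mul_ne_zero (hf0 z hz) (hg0 z hz)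
  have heq : Set.EqOn (logDeriv (f * g)) (fun z => logDeriv f z + logDeriv g z)
      (Metric.sphere 0 R) := by
    intro z hz
    have hz' : ‖z‖ = R := by simpa using hz
    exact logDeriv_mul z (hf0 z hz') (hg0 z hz') (hf z) (hg z)
  rw [circleIntegral.integral_congr hR.le heq,
    circleIntegral.integral_add (circleIntegrable_logDeriv hf hR hf0)
      (circleIntegrable_logDeriv hg hR hg0), h1, h2, ← mul_add] at h3
  have h4 := mul_left_cancel₀ Complex.two_pi_I_ne_zero h3
  exact_mod_cast h4.symm

/-! ### Comparison with a product of sines -/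

/-- The function `-i ∑_r (e_r - e_r⁻¹) = -8 ∏_r sin (ω^r ρ / 2)` with which `ρ ↦ ρ * charF β ρ` is
compared on large circles. -/
noncomputable def sineCmp (ρ : ℂ) : ℂ :=
  -Complex.I * ((ee 0 ρ - (ee 0 ρ)⁻¹) + (ee 1 ρ - (ee 1 ρ)⁻¹) + (ee 2 ρ - (ee 2 ρ)⁻¹))

/-- The product formula holds because the arguments `ω^r ρ / 2` add up to zero; it makes the zeros
of the comparison function explicit. -/
lemma sineCmp_eq (ρ : ℂ) : sineCmp ρ = -8 * (Complex.sin (1 * (ρ / 2)) *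
    (Complex.sin (om * (ρ / 2)) * Complex.sin (om ^ 2 * (ρ / 2)))) := by
  have key : ∀ c : ℂ,
      Complex.exp (Complex.I * (c * ρ)) = Complex.exp (c * (ρ / 2) * Complex.I) ^ 2 := by
    intro c; rw [← Complex.exp_nat_mul]; congr 1; push_cast; ring
  have hneg : ∀ c : ℂ, Complex.exp (-(c * (ρ / 2)) * Complex.I)
      = (Complex.exp (c * (ρ / 2) * Complex.I))⁻¹ := by
    intro c; rw [← Complex.exp_neg]; congr 1; ring
  have hprod : Complex.exp (1 * (ρ / 2) * Complex.I) * Complex.exp (om * (ρ / 2) * Complex.I)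
      * Complex.exp (om ^ 2 * (ρ / 2) * Complex.I) = 1 := by
    rw [← Complex.exp_add, ← Complex.exp_add, om_sq]; ring_nf; simp
  simp only [sineCmp, ee, pow_zero, pow_one, Complex.sin, hneg, key]
  have n0 := Complex.exp_ne_zero (1 * (ρ / 2) * Complex.I)
  have n1 := Complex.exp_ne_zero (om * (ρ / 2) * Complex.I)
  generalize Complex.exp (1 * (ρ / 2) * Complex.I) = u at *
  generalize Complex.exp (om * (ρ / 2) * Complex.I) = v at *
  have hw : Complex.exp (om ^ 2 * (ρ / 2) * Complex.I) = (u * v)⁻¹ :=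
    (eq_inv_of_mul_eq_one_right hprod)
  rw [hw]
  field_simp
  linear_combination (-8 * (u ^ 2 - 1) * (v ^ 2 - 1) * (1 - u ^ 2 * v ^ 2)) * Complex.I_sq

lemma sineCmp_om (ρ : ℂ) : sineCmp (om * ρ) = sineCmp ρ := by
  have h3 : ee 3 ρ = ee 0 ρ := ee_mod 0 ρ
  simp only [sineCmp, ee_om, zero_add, Nat.reduceAdd, h3]; ring

lemma sineCmp_neg_conj (ρ : ℂ) :
    sineCmp (-(starRingEnd ℂ) ρ) = -(starRingEnd ℂ) (sineCmp ρ) := by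
  simp only [sineCmp, ee_zero_neg_conj, ee_one_neg_conj, ee_two_neg_conj, map_add, map_sub,
    map_mul, map_neg, map_inv₀, Complex.conj_I]
  ring

/-- The comparison function is dominated by the same two exponentials as `charF β`. -/
lemma InSector.sineCmp_approx {ρ : ℂ} (h : InSector ρ) :
    ‖sineCmp ρ - -Complex.I * ee 2 ρ * (1 - ee 0 ρ)‖
      ≤ 4 * (Real.exp (-ρ.re / 2) * dom ρ) := by
  obtain ⟨a1, a2, a3, a4⟩ := h.small_le
  refine le_trans ?_ (mul_le_mul_of_nonneg_left h.exp_abs_im_le (by norm_num))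
  have e : sineCmp ρ - -Complex.I * ee 2 ρ * (1 - ee 0 ρ)
      = (-Complex.I) * ee 0 ρ + Complex.I * (ee 0 ρ)⁻¹ + (-Complex.I) * ee 1 ρ
        + Complex.I * (ee 2 ρ)⁻¹ := by
    rw [sineCmp, ee_inv_one]; ring
  rw [e]
  refine norm_sum_four_le (norm_mul_le_of_le_one ?_ a1) (norm_mul_le_of_le_one ?_ a2)
    (norm_mul_le_of_le_one ?_ a3) (norm_mul_le_of_le_one ?_ a4) <;> simp

/-- The radii `(2K + 2/3)π` of circles passing halfway between consecutive zeros. -/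
noncomputable def rad (K : ℕ) : ℝ := 2 * Real.pi * K + 2 * Real.pi / 3

lemma rad_pos (K : ℕ) : 0 < rad K := by have := Real.pi_pos; unfold rad; positivity

/-- On the positive real axis the circle of radius `rad K` passes through a point where
`e^{iρ} = ω`. -/
lemma exp_rad (K : ℕ) : Complex.exp (Complex.I * rad K) = om := by
  have : Complex.I * rad K = 2 * Real.pi * Complex.I / 3 + K * (2 * Real.pi * Complex.I) := by
    rw [rad]; push_cast; ring
  rw [this, Complex.exp_add, Complex.exp_nat_mul_two_pi_mul_I, mul_one, om]

lemma norm_ee_zero_mul_sq_le (ρ : ℂ) : ‖ee 0 ρ‖ * ρ.im ^ 2 ≤ 2 * max 1 ‖ee 0 ρ‖ ^ 2 := by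
  rw [norm_ee_zero]
  have h1 := Real.quadratic_le_exp_of_nonneg (abs_nonneg ρ.im)
  have h2 : ρ.im ^ 2 ≤ 2 * Real.exp |ρ.im| := by
    rw [← sq_abs]; linarith [abs_nonneg ρ.im]
  have h3 : Real.exp (-ρ.im) * Real.exp |ρ.im| ≤ max 1 (Real.exp (-ρ.im)) ^ 2 := by
    rcases le_total 0 ρ.im with h | h
    · rw [abs_of_nonneg h, ← Real.exp_add, neg_add_cancel, Real.exp_zero]
      exact one_le_pow₀ (le_max_left (1 : ℝ) _)
    · rw [abs_of_nonpos h, ← pow_two]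
      exact pow_le_pow_left₀ (by positivity) (le_max_right _ _) 2
  nlinarith [Real.exp_pos (-ρ.im)]

/-- The real part of the dominant contribution to `ρ F(ρ) conj(sineCmp ρ)` on a circle of radius
`rad K`. There `e^{iρ}` is close to `ω e^{-Im ρ}`, up to an error which is at most of the order
`(Im ρ)² / rad K`. -/
lemma InSector.main_re_ge {β : ℝ} (hβ : β ∈ Set.Ioo (0 : ℝ) 1) {ρ : ℂ} (h : InSector ρ) {K : ℕ}
    (hK : ‖ρ‖ = rad K) :
    (4 / 5 * β * ρ.re - 4) * max 1 ‖ee 0 ρ‖ ^ 2 ≤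
      (ρ * (Complex.I * om ^ 2) * pfac β ρ * (1 - (starRingEnd ℂ) (ee 0 ρ))).re := by
  set x := ρ.re with hx
  set y := ρ.im with hy
  set s : ℝ := ‖ee 0 ρ‖ with hs
  have hsy : s = Real.exp (-y) := norm_ee_zero ρ
  have hs0 : 0 < s := by rw [hsy]; positivity
  set d : ℂ := Complex.exp (Complex.I * x) - om with hd
  have hz : ee 0 ρ = s * (om + d) := by
    rw [hd, add_sub_cancel, hsy, Complex.ofReal_exp, ← Complex.exp_add, ← exp_eq_ee_zero]
    congr 1
    conv_lhs => rw [← Complex.re_add_im ρ, ← hx, ← hy]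
    push_cast
    linear_combination (y : ℂ) * Complex.I_sq
  have hR := rad_pos K
  have hxR : x ≤ rad K := by
    rw [← hK]; exact (le_abs_self _).trans (Complex.abs_re_le_norm ρ)
  have hsq : rad K ^ 2 = x ^ 2 + y ^ 2 := by
    rw [← hK, Complex.sq_norm, Complex.normSq_apply]; ring
  -- Since `e^{i rad K} = ω`, the deviation of `e^{ix}` from `ω` is at most `rad K - x`, which on
  -- the circle is at most `y² / rad K`.
  have hdn : ‖d‖ ≤ rad K - x := by
    have e : d = om * (Complex.exp (Complex.I * ((x - rad K : ℝ) : ℂ)) - 1) := by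
      rw [hd, mul_sub, mul_one, ← exp_rad K, ← Complex.exp_add]
      rw [show Complex.I * (rad K : ℂ) + Complex.I * ((x - rad K : ℝ) : ℂ) = Complex.I * x by
        push_cast; ring, exp_rad]
    rw [e, norm_mul, norm_om, one_mul]
    refine Real.norm_exp_I_mul_ofReal_sub_one_le.trans ?_
    rw [Real.norm_eq_abs, abs_sub_comm, abs_of_nonneg (by linarith)]
  have hx0 := h.re_nonneg
  have hRd : rad K * ‖d‖ ≤ y ^ 2 := by nlinarith
  have hs3 := sqrt_three_bounds.1
  have main : ρ * (Complex.I * om ^ 2) * pfac β ρ * (1 - (starRingEnd ℂ) (ee 0 ρ))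
      = ((1 + β * s : ℝ) : ℂ) * (ρ * (((Real.sqrt 3 / 2 * (1 + s) : ℝ) : ℂ)
          - ((1 - s) / 2 : ℝ) * Complex.I))
        + ρ * (Complex.I * om ^ 2) * (s * (β * om ^ 2 * d - (starRingEnd ℂ) d)) := by
    have hzz : ee 0 ρ * (starRingEnd ℂ) (ee 0 ρ) = s ^ 2 := by
      rw [Complex.mul_conj, Complex.normSq_eq_norm_sq]; push_cast; rfl
    have hc : (starRingEnd ℂ) (ee 0 ρ) = s * (om ^ 2 + (starRingEnd ℂ) d) := by
      rw [hz]; simp [conj_om]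
    have e1 : Complex.I * om ^ 2 * (1 - s * om ^ 2)
        = ((Real.sqrt 3 / 2 * (1 + s) : ℝ) : ℂ) - ((1 - s) / 2 : ℝ) * Complex.I := by
      have : Complex.I * om ^ 2 * (1 - s * om ^ 2) = Complex.I * om ^ 2 - Complex.I * s * om := by
        linear_combination (-Complex.I * s * om) * om_cube
      rw [this, om_sq, om_eq]; push_cast
      linear_combination (-(Real.sqrt 3 / 2 : ℂ) * (1 + s)) * Complex.I_sq
    have e2 : pfac β ρ * (1 - (starRingEnd ℂ) (ee 0 ρ)) = (1 + β * s) * (1 - s * om ^ 2)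
        + s * (β * om ^ 2 * d - (starRingEnd ℂ) d) := by
      have e3 : pfac β ρ * (1 - (starRingEnd ℂ) (ee 0 ρ))
          = 1 + β * om ^ 2 * ee 0 ρ - (starRingEnd ℂ) (ee 0 ρ) - β * om ^ 2 * s ^ 2 := by
        rw [pfac, ← hzz]; ring
      rw [e3, hc, hz]
      linear_combination (β * s : ℂ) * om_cube
    rw [mul_assoc, e2, ← e1]
    push_cast
    ring
  have herr : ‖ρ * (Complex.I * om ^ 2) * (s * (β * om ^ 2 * d - (starRingEnd ℂ) d))‖
      ≤ 4 * max 1 s ^ 2 := by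
    have e1 : ‖β * om ^ 2 * d - (starRingEnd ℂ) d‖ ≤ 2 * ‖d‖ := by
      refine (norm_sub_le _ _).trans ?_
      rw [RCLike.norm_conj]
      have : ‖β * om ^ 2 * d‖ ≤ ‖d‖ := norm_mul_le_of_le_one (by
        rw [norm_mul, norm_pow, norm_om]; simpa using norm_beta_le hβ) le_rfl
      linarith
    rw [norm_mul, norm_mul, norm_mul, norm_mul, norm_pow, norm_om, Complex.norm_I, hK,
      Complex.norm_real, Real.norm_of_nonneg hs0.le]
    have e2 := norm_ee_zero_mul_sq_le ρ
    calc rad K * (1 * 1 ^ 2) * (s * ‖β * om ^ 2 * d - (starRingEnd ℂ) d‖)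
        ≤ rad K * (1 * 1 ^ 2) * (s * (2 * ‖d‖)) := by gcongr
      _ = 2 * (s * (rad K * ‖d‖)) := by ring
      _ ≤ 2 * (s * y ^ 2) := by gcongr
      _ ≤ 4 * max 1 s ^ 2 := by linarith
  have hre : (((1 + β * s : ℝ) : ℂ) * (ρ * (((Real.sqrt 3 / 2 * (1 + s) : ℝ) : ℂ)
      - ((1 - s) / 2 : ℝ) * Complex.I))).re
      = (1 + β * s) * (Real.sqrt 3 / 2 * (1 + s) * x + (1 - s) / 2 * y) := by
    rw [Complex.re_ofReal_mul, Complex.mul_re]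
    simp [← hx, ← hy]; left; ring
  -- The factors `1 - e^{-y}` and `y` have the same sign.
  have hys : 0 ≤ (1 - s) / 2 * y := by
    rcases le_total 0 y with h' | h'
    · have : s ≤ 1 := by rw [hsy]; exact Real.exp_le_one_iff.2 (by linarith)
      exact mul_nonneg (by linarith) h'
    · have : 1 ≤ s := by rw [hsy]; exact Real.one_le_exp (by linarith)
      exact mul_nonneg_of_nonpos_of_nonpos (by linarith) h'
  have hm : β * max 1 s ^ 2 ≤ (1 + β * s) * (1 + s) := by
    obtain ⟨b0, b1⟩ := hβ
    rcases max_cases 1 s with h' | h' <;> rw [h'.1] <;> nlinarith [mul_pos b0 hs0]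
  rw [main, Complex.add_re, hre]
  have h1 := (neg_le_abs _).trans (Complex.abs_re_le_norm
    (ρ * (Complex.I * om ^ 2) * (s * (β * om ^ 2 * d - (starRingEnd ℂ) d))))
  have h2 : 4 / 5 * x * (β * max 1 s ^ 2) ≤ Real.sqrt 3 / 2 * x * ((1 + β * s) * (1 + s)) := by
    apply mul_le_mul _ hm (by have := hβ.1; positivity) (by positivity)
    nlinarith
  have h3 : 0 ≤ (1 + β * s) * ((1 - s) / 2 * y) :=
    mul_nonneg (by have := mul_pos hβ.1 hs0; linarith) hys
  nlinarith

lemma mul_exp_neg_half_le (x : ℝ) : x * Real.exp (-x / 2) ≤ 1 := by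
  have h1 := Real.add_one_le_exp (x / 2 - 1)
  have h2 : Real.exp (x / 2 - 1) * Real.exp (-x / 2) = Real.exp (-1) := by
    rw [← Real.exp_add]; ring_nf
  have h3 : Real.exp (-1) ≤ 1 / 2 := by
    have := Real.add_one_le_exp 1
    rw [Real.exp_neg, one_div]
    exact inv_anti₀ (by norm_num) (by linarith)
  nlinarith [Real.exp_pos (-x / 2)]

/-- On large circles of radius `rad K` the quotient of `ρ * charF β ρ` by `sineCmp ρ` lies in the
right half plane. -/
lemma exists_re_mul_conj_pos {β : ℝ} (hβ : β ∈ Set.Ioo (0 : ℝ) 1) : ∃ R : ℝ, ∀ K : ℕ, ∀ ρ : ℂ,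
    ‖ρ‖ = rad K → R ≤ ‖ρ‖ → 0 < (ρ * charF β ρ * (starRingEnd ℂ) (sineCmp ρ)).re := by
  refine ⟨200 / β, fun K ρ => ?_⟩
  induction ρ using sector_induction with
  | hom ρ ih =>
    rw [norm_mul, norm_om, one_mul, sineCmp_om, charF_om]
    rwa [show om * ρ * (om ^ 2 * charF β ρ) = ρ * charF β ρ by
      linear_combination (ρ * charF β ρ) * om_cube]
  | hconj ρ ih =>
    rw [norm_neg, RCLike.norm_conj, sineCmp_neg_conj, charF_neg_conj]
    intro h1 h2
    have := ih h1 h2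
    rw [← Complex.conj_re] at this
    simpa using this
  | hS ρ h =>
    intro hK hR
    have a1 := h.charF_approx hβ
    have a2 := h.sineCmp_approx
    have a3 := h.main_re_ge hβ hK
    set r₁ := charF β ρ - om ^ 2 * ee 2 ρ * pfac β ρ with hr₁
    set r₂ := sineCmp ρ - -Complex.I * ee 2 ρ * (1 - ee 0 ρ) with hr₂
    set ε := Real.exp (-ρ.re / 2) with hε
    set A := om ^ 2 * ee 2 ρ * pfac β ρ with hA
    set B := -Complex.I * ee 2 ρ * (1 - ee 0 ρ) with hB
    have hd := dom_pos ρ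
    have e2 := norm_nonneg (ee 2 ρ)
    have hdm : dom ρ = ‖ee 2 ρ‖ * max 1 ‖ee 0 ρ‖ := rfl
    have hm1 := le_max_left 1 ‖ee 0 ρ‖
    have hm2 := le_max_right 1 ‖ee 0 ρ‖
    have hA' : ‖A‖ ≤ 2 * dom ρ := by
      have : ‖pfac β ρ‖ ≤ 2 * max 1 ‖ee 0 ρ‖ := by
        refine (norm_add_le _ _).trans ?_
        have : ‖β * om ^ 2 * ee 0 ρ‖ ≤ ‖ee 0 ρ‖ := norm_mul_le_of_le_one (by
          rw [norm_mul, norm_pow, norm_om]; simpa using norm_beta_le hβ) le_rfl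
        rw [norm_one]; linarith
      rw [hA, norm_mul, norm_mul, norm_pow, norm_om, hdm]
      nlinarith
    have hB' : ‖B‖ ≤ 2 * dom ρ := by
      have : ‖1 - ee 0 ρ‖ ≤ 2 * max 1 ‖ee 0 ρ‖ := by
        refine (norm_sub_le _ _).trans ?_
        rw [norm_one]; linarith
      rw [hB, norm_mul, norm_mul, norm_neg, Complex.norm_I, hdm]
      nlinarith
    have hF : charF β ρ = A + r₁ := by rw [hr₁]; ring
    have hG : sineCmp ρ = B + r₂ := by rw [hr₂]; ring
    have hsplit : ρ * charF β ρ * (starRingEnd ℂ) (sineCmp ρ) =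
        ((‖ee 2 ρ‖ ^ 2 : ℝ) : ℂ) * (ρ * (Complex.I * om ^ 2) * pfac β ρ *
          (1 - (starRingEnd ℂ) (ee 0 ρ)))
        + ρ * (A * (starRingEnd ℂ) r₂ + r₁ * (starRingEnd ℂ) (B + r₂)) := by
      have : ((‖ee 2 ρ‖ ^ 2 : ℝ) : ℂ) = ee 2 ρ * (starRingEnd ℂ) (ee 2 ρ) := by
        rw [Complex.mul_conj, Complex.normSq_eq_norm_sq]
      rw [hF, hG, this, hA, hB]
      simp only [map_add, map_sub, map_mul, map_neg, Complex.conj_I, map_one]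
      ring
    have hx0 := h.re_nonneg
    have hε1 : ε ≤ 1 := Real.exp_le_one_iff.2 (by linarith)
    have hε0 : 0 < ε := Real.exp_pos _
    have herr : ‖ρ * (A * (starRingEnd ℂ) r₂ + r₁ * (starRingEnd ℂ) (B + r₂))‖
        ≤ 64 * dom ρ ^ 2 := by
      have hb : ‖A * (starRingEnd ℂ) r₂ + r₁ * (starRingEnd ℂ) (B + r₂)‖
          ≤ 32 * (ε * dom ρ ^ 2) := by
        refine (norm_add_le _ _).trans ?_
        rw [norm_mul A, norm_mul r₁, RCLike.norm_conj, RCLike.norm_conj]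
        have h1 : ‖B + r₂‖ ≤ 6 * dom ρ := by
          refine (norm_add_le _ _).trans ?_
          nlinarith
        have h2 : ‖A‖ * ‖r₂‖ ≤ 2 * dom ρ * (4 * (ε * dom ρ)) := by gcongr
        have h3 : ‖r₁‖ * ‖B + r₂‖ ≤ 4 * (ε * dom ρ) * (6 * dom ρ) := by gcongr
        linarith
      rw [norm_mul]
      calc ‖ρ‖ * _ ≤ (2 * ρ.re) * (32 * (ε * dom ρ ^ 2)) := by
            gcongr; exact h.norm_le
        _ = 64 * (ρ.re * ε) * dom ρ ^ 2 := by ring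
        _ ≤ 64 * 1 * dom ρ ^ 2 := by gcongr; exact mul_exp_neg_half_le _
        _ = 64 * dom ρ ^ 2 := by ring
    rw [hsplit, Complex.add_re, Complex.re_ofReal_mul]
    have h1 := (neg_le_abs _).trans (Complex.abs_re_le_norm
      (ρ * (A * (starRingEnd ℂ) r₂ + r₁ * (starRingEnd ℂ) (B + r₂))))
    have h2 := mul_le_mul_of_nonneg_left a3 (sq_nonneg ‖ee 2 ρ‖)
    have h3 : 200 ≤ 2 * (β * ρ.re) := by
      have := hR.trans h.norm_le
      rw [div_le_iff₀ hβ.1] at this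
      linarith
    have h4 : 68 * dom ρ ^ 2 < ‖ee 2 ρ‖ ^ 2 * ((4 / 5 * β * ρ.re) * max 1 ‖ee 0 ρ‖ ^ 2) := by
      rw [show ‖ee 2 ρ‖ ^ 2 * ((4 / 5 * β * ρ.re) * max 1 ‖ee 0 ρ‖ ^ 2)
        = (4 / 5 * (β * ρ.re)) * dom ρ ^ 2 by rw [hdm]; ring]
      have : 0 < dom ρ ^ 2 := by positivity
      nlinarith
    have h5 : dom ρ ^ 2 = ‖ee 2 ρ‖ ^ 2 * max 1 ‖ee 0 ρ‖ ^ 2 := by rw [hdm]; ring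
    nlinarith

/-! ### The number of zeros of the characteristic determinant in large discs -/

lemma zeroCount_const {c : ℂ} (hc : c ≠ 0) (R : ℝ) : zeroCount (fun _ => c) R = 0 := by
  have : {z : ℂ | ‖z‖ < R ∧ c = 0} = ∅ := by ext z; simp [hc]
  rw [zeroCount, this, finsum_mem_empty]

lemma sin_mul_half_eq_zero_iff {c : ℂ} (hc : c ≠ 0) (z : ℂ) :
    Complex.sin (c * (z / 2)) = 0 ↔ ∃ n : ℤ, z = 2 * Real.pi * n * c⁻¹ := by
  rw [Complex.sin_eq_zero_iff]
  refine exists_congr fun n => ⟨fun h => ?_, fun h => ?_⟩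
  · field_simp; linear_combination 2 * h
  · rw [h]; field_simp

lemma norm_two_pi_int_mul {c : ℂ} (hc : ‖c‖ = 1) (n : ℤ) :
    ‖(2 * Real.pi * n * c⁻¹ : ℂ)‖ = 2 * Real.pi * |(n : ℝ)| := by
  rw [norm_mul, norm_inv, hc, norm_mul, norm_mul, Complex.norm_real, Complex.norm_intCast]
  simp [abs_of_pos Real.pi_pos]

/-- No zero of the sine factors lies on a circle of radius `rad K`. -/
lemma two_pi_mul_ne_rad (n : ℤ) (K : ℕ) : 2 * Real.pi * |(n : ℝ)| ≠ rad K := by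
  intro h
  have h1 : (3 * |n| : ℤ) = 3 * K + 1 := by
    have : 2 * Real.pi * (3 * |(n : ℝ)|) = 2 * Real.pi * (3 * K + 1) := by
      rw [rad] at h; linarith
    have := mul_left_cancel₀ (by have := Real.pi_pos; positivity) this
    exact_mod_cast this
  omega

lemma two_pi_mul_lt_rad_iff (n : ℤ) (K : ℕ) :
    2 * Real.pi * |(n : ℝ)| < rad K ↔ n ∈ Finset.Icc (-(K : ℤ)) K := by
  have h1 : 2 * Real.pi * |(n : ℝ)| < rad K ↔ (3 * |n| : ℤ) < 3 * K + 1 := by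
    have : rad K = 2 * Real.pi * (3 * K + 1) / 3 := by rw [rad]; ring
    rw [this, lt_div_iff₀ (by norm_num), mul_assoc, mul_lt_mul_iff_right₀ (by positivity)]
    rw [mul_comm |(n : ℝ)| 3]
    exact_mod_cast Iff.rfl
  rw [h1, Finset.mem_Icc, ← abs_le]
  omega

lemma sin_mul_half_ne_zero {c : ℂ} (hc : ‖c‖ = 1) (K : ℕ) (z : ℂ) (hz : ‖z‖ = rad K) :
    Complex.sin (c * (z / 2)) ≠ 0 := by
  have hc0 : c ≠ 0 := fun h => by simp [h] at hc
  rw [Ne, sin_mul_half_eq_zero_iff hc0]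
  rintro ⟨n, rfl⟩
  rw [norm_two_pi_int_mul hc] at hz
  exact two_pi_mul_ne_rad n K hz

/-- The zeros of `sin (c z / 2)` in the disc are simple and indexed by `-K, …, K`. -/
lemma zeroCount_sin {c : ℂ} (hc : ‖c‖ = 1) (K : ℕ) :
    zeroCount (fun z => Complex.sin (c * (z / 2))) (rad K) = 2 * K + 1 := by
  have hc0 : c ≠ 0 := fun h => by simp [h] at hc
  have hord : ∀ z, Complex.sin (c * (z / 2)) = 0 →
      analyticOrderNatAt (fun z => Complex.sin (c * (z / 2))) z = 1 := by
    intro z hz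
    have hd : HasDerivAt (fun z => Complex.sin (c * (z / 2)))
        (Complex.cos (c * (z / 2)) * (c / 2)) z := by
      have := (((hasDerivAt_id z).div_const 2).const_mul c).csin
      refine this.congr_deriv ?_
      simp; left; ring
    have han : AnalyticAt ℂ (fun z => Complex.sin (c * (z / 2))) z :=
      Differentiable.analyticAt (by fun_prop) z
    rw [analyticOrderNatAt, han.analyticOrderAt_eq_one_of_zero_deriv_ne_zero hz]
    · rfl
    · rw [hd.deriv]
      refine mul_ne_zero ?_ (div_ne_zero hc0 two_ne_zero)
      intro h
      have := Complex.sin_sq_add_cos_sq (c * (z / 2))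
      rw [hz, h] at this; norm_num at this
  have hset : {z | ‖z‖ < rad K ∧ Complex.sin (c * (z / 2)) = 0}
      = (fun n : ℤ => (2 * Real.pi * n * c⁻¹ : ℂ)) '' (Finset.Icc (-(K : ℤ)) K : Finset ℤ) := by
    ext z
    simp only [Set.mem_ofPred_eq, sin_mul_half_eq_zero_iff hc0, Set.mem_image, Finset.mem_coe]
    constructor
    · rintro ⟨h, n, rfl⟩
      rw [norm_two_pi_int_mul hc, two_pi_mul_lt_rad_iff] at h
      exact ⟨n, h, rfl⟩
    · rintro ⟨n, hn, rfl⟩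
      rw [norm_two_pi_int_mul hc, two_pi_mul_lt_rad_iff]
      exact ⟨hn, n, rfl⟩
  rw [zeroCount, finsum_mem_congr rfl (fun z hz => hord z hz.2), hset, finsum_mem_image,
    finsum_mem_coe_finset]
  · simp; omega
  · intro n _ m _ h
    have hpi : (2 * Real.pi : ℂ) ≠ 0 := by simp [Real.pi_ne_zero]
    have := mul_left_cancel₀ hpi (mul_right_cancel₀ (inv_ne_zero hc0) h)
    exact_mod_cast this

lemma zeroCount_sineCmp (K : ℕ) : zeroCount sineCmp (rad K) = 6 * K + 3 := by
  have h1 : ‖(1 : ℂ)‖ = 1 := norm_one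
  have h2 : ‖om ^ 2‖ = 1 := by rw [norm_pow, norm_om, one_pow]
  have hfun : sineCmp = fun ρ => -8 * (Complex.sin (1 * (ρ / 2)) *
    (Complex.sin (om * (ρ / 2)) * Complex.sin (om ^ 2 * (ρ / 2)))) := funext sineCmp_eq
  have n0 := sin_mul_half_ne_zero h1 K
  have n1 := sin_mul_half_ne_zero norm_om K
  have n2 := sin_mul_half_ne_zero h2 K
  rw [hfun, zeroCount_mul (f := fun _ => (-8 : ℂ)) (by fun_prop) (by fun_prop) (rad_pos K)
    (fun _ _ => by norm_num)
    (fun z hz => mul_ne_zero (n0 z hz) (mul_ne_zero (n1 z hz) (n2 z hz))),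
    zeroCount_mul (f := fun ρ => Complex.sin (1 * (ρ / 2))) (by fun_prop) (by fun_prop) (rad_pos K)
    n0 (fun z hz => (mul_ne_zero (n1 z hz) (n2 z hz))),
    zeroCount_mul (f := fun ρ => Complex.sin (om * (ρ / 2))) (by fun_prop) (by fun_prop) (rad_pos K)
    n1 n2, zeroCount_const (by norm_num), zeroCount_sin h1, zeroCount_sin norm_om, zeroCount_sin h2]
  ring

/-- By comparison with the product of sines, `ρ F(ρ)` has `6K + 3` zeros in the disc of radius
`rad K`, for large `K`. -/
lemma exists_zeroCount_eq {β : ℝ} (hβ : β ∈ Set.Ioo (0 : ℝ) 1) : ∃ K₀ : ℕ, ∀ K ≥ K₀,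
    (∀ z, ‖z‖ = rad K → charF β z ≠ 0) ∧
      zeroCount (fun z => z * charF β z) (rad K) = 6 * K + 3 := by
  obtain ⟨R, hR⟩ := exists_re_mul_conj_pos hβ
  obtain ⟨K₀, hK₀⟩ := exists_nat_ge R
  refine ⟨K₀, fun K hK => ?_⟩
  have hRK : R ≤ rad K := by
    have h1 : (K₀ : ℝ) ≤ K := by exact_mod_cast hK
    have h2 : (0 : ℝ) ≤ K := by positivity
    have := Real.pi_gt_three
    rw [rad]; nlinarith
  have hpos := fun z (hz : ‖z‖ = rad K) => hR K z hz (hz ▸ hRK)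
  have hdsine : Differentiable ℂ sineCmp := by
    rw [show sineCmp = _ from funext sineCmp_eq]; fun_prop
  refine ⟨fun z hz h0 => ?_, ?_⟩
  · have := hpos z hz
    simp [h0] at this
  rw [← zeroCount_sineCmp K]
  refine zeroCount_eq_of_div_mem_slitPlane (differentiable_id.mul (differentiable_charF β)) hdsine
    (rad_pos K) fun z hz => ?_
  have hp := hpos z hz
  have hg : sineCmp z ≠ 0 := fun h => by simp [h] at hp
  refine ⟨hg, Or.inl ?_⟩
  rw [div_eq_mul_inv, Complex.inv_def, ← mul_assoc, Complex.re_mul_ofReal]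
  exact mul_pos hp (inv_pos.2 (Complex.normSq_pos.2 hg))

lemma charF_zero (β : ℝ) : charF β 0 = 0 := by
  simp [charF, ee, om_sq]; ring

/-- The values at `0` of `charF β` and of its first derivative contain the factor `1 + ω + ω²`;
the second derivative there is `-3 (1 + β)`. -/
lemma analyticOrderAt_charF_zero {β : ℝ} (hβ : β ∈ Set.Ioo (0 : ℝ) 1) :
    analyticOrderAt (charF β) 0 = 2 := by
  have key : ∀ r, HasDerivAt (fun ρ => ee r ρ - β * (ee r ρ)⁻¹)
      (Complex.I * om ^ r * (ee r 0 + β * (ee r 0)⁻¹)) 0 := fun r =>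
    ((hasDerivAt_ee r 0).sub ((hasDerivAt_ee_inv r 0).const_mul (β : ℂ))).congr_deriv (by ring)
  have h2 : HasDerivAt (charF' β) (-3 * (1 + β)) 0 := by
    refine ((((key 0).add ((key 1).const_mul (om ^ 2))).add ((key 2).const_mul om)).const_mul
      Complex.I).congr_deriv ?_
    simp only [ee, mul_zero, Complex.exp_zero, inv_one]
    linear_combination (2 * Complex.I ^ 2 * (1 + β)) * om_cube + 3 * (1 + β) * Complex.I_sq
  have hd : deriv (charF β) = charF' β := funext fun ρ => (hasDerivAt_charF β ρ).deriv
  have han : AnalyticAt ℂ (charF β) 0 := (differentiable_charF β).analyticAt 0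
  have han' : AnalyticAt ℂ (charF' β) 0 := hd ▸ han.deriv
  have h0 : charF' β 0 = 0 := by
    simp only [charF', ee, mul_zero, Complex.exp_zero, inv_one]
    linear_combination (Complex.I * (1 - β)) * om_sq
  have h1 : analyticOrderAt (charF' β) 0 = 1 := by
    refine han'.analyticOrderAt_eq_one_of_zero_deriv_ne_zero h0 ?_
    rw [h2.deriv]
    have : (1 + β : ℂ) ≠ 0 := by
      have : ((1 + β : ℝ) : ℂ) ≠ 0 := by
        rw [Complex.ofReal_ne_zero]; linarith [hβ.1]
      simpa using this
    exact mul_ne_zero (by norm_num) this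
  have h3 := han.analyticOrderAt_deriv_add_one
  rw [hd, h1, charF_zero] at h3
  simp only [sub_zero] at h3
  rw [← h3]; norm_num

/-! ### Orbits of zeros and their enumeration -/

lemma cube_eq_cube_iff {z w : ℂ} : z ^ 3 = w ^ 3 ↔ z = w ∨ z = om * w ∨ z = om ^ 2 * w := by
  constructor
  · intro h
    have : (z - w) * ((z - om * w) * (z - om ^ 2 * w)) = 0 := by
      linear_combination h - w ^ 3 * om_cube + (-z ^ 2 * w + z * w ^ 2) * om_sq
        + z * w ^ 2 * om_cube
    rcases mul_eq_zero.1 this with h | h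
    · exact Or.inl (sub_eq_zero.1 h)
    rcases mul_eq_zero.1 h with h | h
    · exact Or.inr (Or.inl (sub_eq_zero.1 h))
    · exact Or.inr (Or.inr (sub_eq_zero.1 h))
  · rintro (rfl | rfl | rfl)
    · rfl
    · linear_combination w ^ 3 * om_cube
    · linear_combination w ^ 3 * (om ^ 3 + 1) * om_cube

lemma om_pow_ne_one : om ≠ 1 ∧ om ^ 2 ≠ 1 ∧ om ^ 2 ≠ om := by
  have h3 := sqrt_three_bounds.1
  refine ⟨fun h => ?_, fun h => ?_, fun h => ?_⟩
  · have := congrArg Complex.im h; rw [om_im] at this; simp at this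
  · have := congrArg Complex.im h; rw [om_sq] at this; simp [om_im] at this
  · have := congrArg Complex.im h; rw [om_sq] at this; simp [om_im] at this; linarith

/-- The orbit of a point under the rotations by `ω`. -/
noncomputable def orb (w : ℂ) : Finset ℂ := {w, om * w, om ^ 2 * w}

lemma mem_orb {z w : ℂ} : z ∈ orb w ↔ z ^ 3 = w ^ 3 := by
  rw [cube_eq_cube_iff]; simp [orb]

lemma card_orb {w : ℂ} (hw : w ≠ 0) : (orb w).card = 3 := by
  obtain ⟨h1, h2, h3⟩ := om_pow_ne_one
  rw [orb, Finset.card_eq_three]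
  refine ⟨_, _, _, fun h => h1 ?_, fun h => h2 ?_, fun h => h3 ?_, rfl⟩
  · exact mul_right_cancel₀ hw (by rw [one_mul]; exact h.symm)
  · exact mul_right_cancel₀ hw (by rw [one_mul]; exact h.symm)
  · exact mul_right_cancel₀ hw h.symm

lemma charF_eq_zero_of_cube_eq {β : ℝ} {z w : ℂ} (h : z ^ 3 = w ^ 3) (hw : charF β w = 0) :
    charF β z = 0 := by
  rcases cube_eq_cube_iff.1 h with rfl | rfl | rfl
  · exact hw
  · rw [charF_om, hw, mul_zero]
  · rw [pow_two, mul_assoc, charF_om, charF_om, hw, mul_zero, mul_zero]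

lemma norm_eq_of_cube_eq {z w : ℂ} (h : z ^ 3 = w ^ 3) : ‖z‖ = ‖w‖ := by
  have := congrArg norm h
  rw [norm_pow, norm_pow] at this
  exact (pow_left_inj₀ (norm_nonneg _) (norm_nonneg _) (by norm_num)).1 this

lemma analyticOrderAt_charF_om (β : ℝ) (z : ℂ) :
    analyticOrderAt (charF β) (om * z) = analyticOrderAt (charF β) z := by
  have h1 : analyticOrderAt (charF β ∘ fun z => om * z) z
      = analyticOrderAt (charF β) (om * z) := by
    apply analyticOrderAt_comp_of_deriv_ne_zero
    · exact Differentiable.analyticAt (by fun_prop) z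
    · have hd : HasDerivAt (fun z => om * z) om z := by simpa using (hasDerivAt_id z).const_mul om
      rw [hd.deriv]; exact om_ne_zero
  have h2 : (charF β ∘ fun z => om * z) = (fun _ => om ^ 2) * charF β := by
    funext z; simp [charF_om]
  rw [← h1, h2, analyticOrderAt_mul analyticAt_const ((differentiable_charF β).analyticAt z)]
  have : analyticOrderAt (fun _ : ℂ => om ^ 2) z = 0 :=
    analyticOrderAt_eq_zero.2 (Or.inr (pow_ne_zero 2 om_ne_zero))
  rw [this, zero_add]

lemma analyticOrderAt_charF_of_cube_eq (β : ℝ) {z w : ℂ} (h : z ^ 3 = w ^ 3) :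
    analyticOrderAt (charF β) z = analyticOrderAt (charF β) w := by
  rcases cube_eq_cube_iff.1 h with rfl | rfl | rfl
  · rfl
  · rw [analyticOrderAt_charF_om]
  · rw [pow_two, mul_assoc, analyticOrderAt_charF_om, analyticOrderAt_charF_om]

lemma exists_charF_ne_zero {β : ℝ} (hβ : β ∈ Set.Ioo (0 : ℝ) 1) : ∃ w, charF β w ≠ 0 := by
  obtain ⟨K, hK⟩ := exists_zeroCount_eq hβ
  exact ⟨rad K, (hK K le_rfl).1 _ (by simp [abs_of_pos (rad_pos K)])⟩

lemma analyticOrderAt_charF_ne_top {β : ℝ} (hβ : β ∈ Set.Ioo (0 : ℝ) 1) (z : ℂ) :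
    analyticOrderAt (charF β) z ≠ ⊤ := by
  obtain ⟨w, hw⟩ := exists_charF_ne_zero hβ
  exact analyticOrderAt_ne_top_of_entire (differentiable_charF β) hw z

lemma one_le_order {β : ℝ} (hβ : β ∈ Set.Ioo (0 : ℝ) 1) {z : ℂ} (hz : charF β z = 0) :
    1 ≤ analyticOrderNatAt (charF β) z := by
  have h1 : analyticOrderAt (charF β) z ≠ 0 :=
    analyticOrderAt_ne_zero.2 ⟨(differentiable_charF β).analyticAt z, hz⟩
  have h2 := Nat.cast_analyticOrderNatAt (analyticOrderAt_charF_ne_top hβ z)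
  rw [← h2] at h1
  exact Nat.one_le_iff_ne_zero.2 (by exact_mod_cast h1)

open Classical in
/-- The nonzero zeros of `charF β` in the disc of radius `rad K`. -/
noncomputable def nzz (β : ℝ) (K : ℕ) : Finset ℂ :=
  if h : {z | ‖z‖ < rad K ∧ charF β z = 0}.Finite then h.toFinset.erase 0 else ∅

lemma mem_nzz {β : ℝ} (hβ : β ∈ Set.Ioo (0 : ℝ) 1) {K : ℕ} {z : ℂ} :
    z ∈ nzz β K ↔ z ≠ 0 ∧ ‖z‖ < rad K ∧ charF β z = 0 := by
  obtain ⟨w, hw⟩ := exists_charF_ne_zero hβ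
  rw [nzz, dif_pos (finite_zeros (differentiable_charF β) hw (rad K))]
  simp

/-- Since `ρ F(ρ)` vanishes to order `3` at the origin, `6K` of its zeros in a large disc are
different from `0`. -/
lemma exists_sum_order_eq {β : ℝ} (hβ : β ∈ Set.Ioo (0 : ℝ) 1) : ∃ K₀ : ℕ, ∀ K ≥ K₀,
    (∀ z, ‖z‖ = rad K → charF β z ≠ 0) ∧
      ∑ z ∈ nzz β K, analyticOrderNatAt (charF β) z = 6 * K := by
  obtain ⟨K₀, h⟩ := exists_zeroCount_eq hβ
  refine ⟨K₀, fun K hK => ⟨(h K hK).1, ?_⟩⟩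
  have h1 := (h K hK).2
  have hset : {z | ‖z‖ < rad K ∧ z * charF β z = 0}
      = ((insert 0 (nzz β K) : Finset ℂ) : Set ℂ) := by
    ext z
    simp only [Set.mem_ofPred_eq, Finset.coe_insert, Set.mem_insert_iff, Finset.mem_coe, mem_nzz hβ,
      mul_eq_zero]
    constructor
    · rintro ⟨h1, h2⟩
      by_cases hz : z = 0
      · exact Or.inl hz
      · exact Or.inr ⟨hz, h1, h2.resolve_left hz⟩
    · rintro (rfl | ⟨-, h1, h2⟩)
      · exact ⟨by simpa using rad_pos K, Or.inl rfl⟩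
      · exact ⟨h1, Or.inr h2⟩
  have hmul : ∀ z, analyticOrderAt (fun z => z * charF β z) z
      = analyticOrderAt (fun z : ℂ => z) z + analyticOrderAt (charF β) z := fun z =>
    analyticOrderAt_mul analyticAt_id ((differentiable_charF β).analyticAt z)
  have h0 : analyticOrderNatAt (fun z => z * charF β z) 0 = 3 := by
    have : analyticOrderAt (fun z : ℂ => z) 0 = 1 :=
      analyticAt_id.analyticOrderAt_eq_one_of_zero_deriv_ne_zero rfl (by simp)
    rw [analyticOrderNatAt, hmul, this, analyticOrderAt_charF_zero hβ]
    rfl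
  have hz : ∀ z ∈ nzz β K, analyticOrderNatAt (fun z => z * charF β z) z
      = analyticOrderNatAt (charF β) z := by
    intro z hz
    have : analyticOrderAt (fun z : ℂ => z) z = 0 :=
      analyticOrderAt_eq_zero.2 (Or.inr ((mem_nzz hβ).1 hz).1)
    rw [analyticOrderNatAt, hmul, this, zero_add, analyticOrderNatAt]
  have hnot : (0 : ℂ) ∉ nzz β K := fun h => ((mem_nzz hβ).1 h).1 rfl
  have hsum := Finset.sum_congr rfl hz
  rw [zeroCount, hset, finsum_mem_coe_finset, Finset.sum_insert hnot, h0, hsum] at h1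
  exact Nat.add_left_cancel (h1.trans (Nat.add_comm _ _))

/-- Every zero can be moved by the symmetries to a zero in the sector of the same modulus. -/
lemma exists_sector_rep {β : ℝ} (ρ : ℂ) :
    charF β ρ = 0 → ∃ l, InSector l ∧ charF β l = 0 ∧ ‖l‖ = ‖ρ‖ := by
  induction ρ using sector_induction with
  | hS ρ h => exact fun h0 => ⟨ρ, h, h0, rfl⟩
  | hom ρ ih =>
    rw [charF_om, norm_mul, norm_om, one_mul]
    exact fun h0 => ih (by simpa [om_ne_zero] using h0)
  | hconj ρ ih =>
    rw [charF_neg_conj, norm_neg, RCLike.norm_conj]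
    exact fun h0 => ih (by simpa using h0)

lemma rad_succ (K : ℕ) : rad (K + 1) = rad K + 2 * Real.pi := by
  rw [rad, rad]; push_cast; ring

lemma rad_strictMono : StrictMono rad := by
  refine strictMono_nat_of_lt_succ fun K => ?_
  rw [rad_succ]; linarith [Real.pi_pos]

/-- A zero in the sector with large modulus between `rad K` and `rad (K + 1)` lies near the lattice
point of index `K + 1`. -/
lemma exists_near_asym {β : ℝ} (hβ : β ∈ Set.Ioo (0 : ℝ) 1) : ∃ R : ℝ, ∀ (K : ℕ) (l : ℂ),
    R ≤ rad K → InSector l → charF β l = 0 → rad K ≤ ‖l‖ → ‖l‖ < rad (K + 1) →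
    ‖l - ((asymRe (K + 1) : ℂ) + Complex.I * Real.log β)‖ ≤ 1 / 10 ∧
    ‖l - ((asymRe (K + 1) : ℂ) + Complex.I * Real.log β)‖
      ≤ 36 / β * Real.exp (-(Real.sqrt 3 * (K + 1 : ℕ) * Real.pi / 2)) ∧
    0 < (l ^ 3).re := by
  obtain ⟨R, hR⟩ := tendsto_exp_neg_half_re (β / 120) (by linarith [hβ.1])
  refine ⟨max R (20 * (|Real.log β| + 1) ^ 2), fun K l hRK hl h0 h1 h2 => ?_⟩
  have hε := hR l hl (((le_max_left _ _).trans hRK).trans h1)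
  have hβ0 := hβ.1
  have hpi := Real.pi_gt_three
  set ε := Real.exp (-l.re / 2) with hεd
  have hδ : 4 * ε / β ≤ 1 / 30 := by
    rw [div_le_iff₀ hβ0]; linarith
  obtain ⟨n, hn⟩ := hl.exists_int_near hβ (δ := 4 * ε / β) (by linarith) (by
    rw [h0, norm_zero, div_mul_cancel₀ _ hβ0.ne', ← hεd]; linarith)
  have hn10 : ‖l - nu β - 2 * Real.pi * n‖ ≤ 1 / 10 := by linarith
  have hre : |l.re - (2 * Real.pi * n - Real.pi / 3)| ≤ 1 / 10 := by
    have := (Complex.abs_re_le_norm _).trans hn10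
    rw [show (l - nu β - 2 * Real.pi * n).re = l.re - (2 * Real.pi * n - Real.pi / 3) by
      simp [nu]; ring] at this
    exact this
  have him : |l.im - Real.log β| ≤ 1 / 10 := by
    have := (Complex.abs_im_le_norm _).trans hn10
    rw [show (l - nu β - 2 * Real.pi * n).im = l.im - Real.log β by
      simp [nu]] at this
    exact this
  have hre' := abs_le.1 hre
  have hx0 := hl.re_nonneg
  have hxl : l.re ≤ ‖l‖ := (le_abs_self _).trans (Complex.abs_re_le_norm l)
  have hy : |l.im| ≤ |Real.log β| + 1 := by
    have := abs_sub_abs_le_abs_sub l.im (Real.log β); linarith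
  have hx : 10 * (|Real.log β| + 1) ^ 2 ≤ l.re := by
    have := hl.norm_le
    have := (le_max_right R (20 * (|Real.log β| + 1) ^ 2)).trans hRK
    linarith
  have hlx : ‖l‖ ≤ l.re + 1 / 10 := by
    have hy2 : l.im ^ 2 ≤ (|Real.log β| + 1) ^ 2 := sq_le_sq' (by linarith [neg_abs_le l.im])
      (by linarith [le_abs_self l.im])
    have hsq : ‖l‖ ^ 2 = l.re ^ 2 + l.im ^ 2 := by
      rw [Complex.sq_norm, Complex.normSq_apply]; ring
    refine abs_le_of_sq_le_sq' (by nlinarith) (by linarith) |>.2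
  have hcube : 0 < (l ^ 3).re := by
    have e : (l ^ 3).re = l.re * (l.re ^ 2 - 3 * |l.im| ^ 2) := by
      rw [sq_abs]; simp [pow_succ]; ring
    have h2 : 2 * |l.im| < l.re := by nlinarith [abs_nonneg (Real.log β)]
    rw [e]
    apply mul_pos (by linarith [abs_nonneg l.im])
    nlinarith [abs_nonneg l.im]
  have hnK : n = (K : ℤ) + 1 := by
    have e1 : 2 * Real.pi * n < 2 * Real.pi * ((K : ℝ) + 2) := by
      rw [rad_succ, rad] at h2; linarith
    have e2 : 2 * Real.pi * (K : ℝ) < 2 * Real.pi * n := by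
      rw [rad] at h1; linarith
    have e1' := lt_of_mul_lt_mul_left e1 (by positivity)
    have e2' := lt_of_mul_lt_mul_left e2 (by positivity)
    have e1'' : n < (K : ℤ) + 2 := by exact_mod_cast e1'
    have e2'' : (K : ℤ) < n := by exact_mod_cast e2'
    omega
  have heq : l - ((asymRe (K + 1) : ℂ) + Complex.I * Real.log β) = l - nu β - 2 * Real.pi * n := by
    rw [← nu_add, hnK]; push_cast; ring
  rw [heq]
  refine ⟨hn10, hn.trans ?_, hcube⟩
  have hexp : ε ≤ 3 * Real.exp (-(Real.sqrt 3 * (K + 1 : ℕ) * Real.pi / 2)) := by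
    have hlog : Real.exp 1 ≤ 3 := by have := Real.exp_one_lt_d9; linarith
    refine le_trans ?_ (mul_le_mul_of_nonneg_right hlog (by positivity))
    rw [← Real.exp_add, hεd, Real.exp_le_exp]
    have h4 := Real.pi_lt_d2
    have h5 := sqrt_three_bounds.2
    rw [hnK] at hre'
    push_cast at hre' ⊢
    have : 0 ≤ ((K : ℝ) + 1) * Real.pi := by positivity
    nlinarith
  calc 3 * (4 * ε / β) = 12 / β * ε := by ring
    _ ≤ 12 / β * (3 * Real.exp (-(Real.sqrt 3 * (K + 1 : ℕ) * Real.pi / 2))) := by gcongr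
    _ = _ := by ring

/-- If the multiplicities of the points of `S` add up to no more than the number of points of a
subset, then the subset is everything and all multiplicities are `1`. -/
lemma order_sum_eq_of_card_le {S T : Finset ℂ} {o : ℂ → ℕ} (ho : ∀ z ∈ S, 1 ≤ o z) (hT : T ⊆ S)
    (hc : ∑ z ∈ S, o z ≤ T.card) : S = T ∧ ∀ z ∈ S, o z = 1 := by
  have h1 : S.card ≤ ∑ z ∈ S, o z := by
    simpa using Finset.card_nsmul_le_sum S o 1 ho
  have h2 := Finset.eq_of_subset_of_card_le hT (h1.trans hc)
  refine ⟨h2.symm, fun z hz => ?_⟩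
  by_contra hne
  have h3 : ∑ z ∈ S, 1 < ∑ z ∈ S, o z :=
    Finset.sum_lt_sum (fun z hz => ho z hz) ⟨z, hz, lt_of_le_of_ne (ho z hz) (Ne.symm hne)⟩
  simp at h3
  rw [h2] at hc
  omega

/-- Between consecutive circles of large radius, the zeros are exactly the two orbits of a zero
near `(2k - 1/3)π + i log β` and of its mirror image, and all of them are simple. -/
lemma exists_zero_in_annulus {β : ℝ} (hβ : β ∈ Set.Ioo (0 : ℝ) 1) : ∃ N : ℕ,
    (∑ z ∈ nzz β N, analyticOrderNatAt (charF β) z = 6 * N) ∧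
    ∀ K ≥ N, ∃ l : ℂ, charF β l = 0 ∧ rad K < ‖l‖ ∧ ‖l‖ < rad (K + 1) ∧ InSector l ∧
      0 < (l ^ 3).re ∧
      ‖l - ((asymRe (K + 1) : ℂ) + Complex.I * Real.log β)‖ ≤ 1 / 10 ∧
      ‖l - ((asymRe (K + 1) : ℂ) + Complex.I * Real.log β)‖
        ≤ 36 / β * Real.exp (-(Real.sqrt 3 * (K + 1 : ℕ) * Real.pi / 2)) ∧
      ∀ z, charF β z = 0 → rad K ≤ ‖z‖ → ‖z‖ < rad (K + 1) →
        analyticOrderNatAt (charF β) z = 1 ∧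
          (z ^ 3 = l ^ 3 ∨ z ^ 3 = (-(starRingEnd ℂ) l) ^ 3) := by
  classical
  obtain ⟨N₁, hN₁⟩ := exists_sum_order_eq hβ
  obtain ⟨R, hR⟩ := exists_near_asym hβ
  obtain ⟨N₂, hN₂⟩ := exists_nat_ge R
  refine ⟨max N₁ N₂, (hN₁ _ (le_max_left _ _)).2, fun K hK => ?_⟩
  have hK1 := hN₁ K ((le_max_left _ _).trans hK)
  have hK2 := hN₁ (K + 1) (((le_max_left _ _).trans hK).trans (Nat.le_succ K))
  have hRK : R ≤ rad K := by
    have h1 : (N₂ : ℝ) ≤ K := by exact_mod_cast (le_max_right _ _).trans hK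
    have h2 : (0 : ℝ) ≤ K := by positivity
    have := Real.pi_gt_three
    rw [rad]; nlinarith
  have hlt : rad K < rad (K + 1) := rad_strictMono (Nat.lt_succ_self K)
  set T := nzz β (K + 1) \ nzz β K with hT
  have hmem : ∀ z, z ∈ T ↔ rad K ≤ ‖z‖ ∧ ‖z‖ < rad (K + 1) ∧ charF β z = 0 := by
    intro z
    rw [hT, Finset.mem_sdiff, mem_nzz hβ, mem_nzz hβ]
    constructor
    · rintro ⟨⟨h1, h2, h3⟩, h4⟩
      refine ⟨?_, h2, h3⟩
      by_contra! h
      exact h4 ⟨h1, h, h3⟩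
    · rintro ⟨h1, h2, h3⟩
      refine ⟨⟨?_, h2, h3⟩, fun h => absurd h.2.1 (not_lt.2 h1)⟩
      rintro rfl
      rw [norm_zero] at h1
      linarith [rad_pos K]
  have hsub : nzz β K ⊆ nzz β (K + 1) := fun z hz => by
    rw [mem_nzz hβ] at hz ⊢
    exact ⟨hz.1, hz.2.1.trans hlt, hz.2.2⟩
  -- The annulus contains `6(K + 1) - 6K` zeros.
  have hsum : ∑ z ∈ T, analyticOrderNatAt (charF β) z = 6 := by
    have := Finset.sum_sdiff (f := analyticOrderNatAt (charF β)) hsub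
    rw [hK1.2, hK2.2] at this
    rw [hT]; omega
  have hne : T.Nonempty := by
    rw [Finset.nonempty_iff_ne_empty]
    intro h; rw [h] at hsum; simp at hsum
  obtain ⟨z₀, hz₀⟩ := hne
  rw [hmem] at hz₀
  obtain ⟨l, hl, hl0, hln⟩ := exists_sector_rep z₀ hz₀.2.2
  rw [← hln] at hz₀
  obtain ⟨hn1, hn2, hcube⟩ := hR K l hRK hl hl0 hz₀.1 hz₀.2.1
  have hlK : rad K < ‖l‖ := lt_of_le_of_ne hz₀.1 fun h => hK1.1 l h.symm hl0
  have hlne : l ≠ 0 := by rintro rfl; simp at hcube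
  set m := -(starRingEnd ℂ) l with hm
  have hmne : m ≠ 0 := by simpa [hm] using hlne
  have hm0 : charF β m = 0 := by rw [hm, charF_neg_conj, hl0, map_zero]
  have hmn : ‖m‖ = ‖l‖ := by rw [hm, norm_neg, RCLike.norm_conj]
  -- The cubes have real parts of opposite sign, so the two orbits are disjoint; with three points
  -- each they exhaust the six zeros in the annulus.
  have hlm : l ^ 3 ≠ m ^ 3 := by
    intro h
    have h1 := congrArg Complex.re h
    have h2 : (m ^ 3).re = -(l ^ 3).re := by
      rw [hm, Odd.neg_pow (by decide), ← map_pow, Complex.neg_re, Complex.conj_re]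
    linarith
  have hdisj : Disjoint (orb l) (orb m) := by
    rw [Finset.disjoint_left]
    intro z h1 h2
    rw [mem_orb] at h1 h2
    exact hlm (h1.symm.trans h2)
  have hTsub : orb l ∪ orb m ⊆ T := by
    intro z hz
    rw [hmem]
    rcases Finset.mem_union.1 hz with h | h <;> rw [mem_orb] at h
    · rw [norm_eq_of_cube_eq h]
      exact ⟨hz₀.1, hz₀.2.1, charF_eq_zero_of_cube_eq h hl0⟩
    · rw [norm_eq_of_cube_eq h, hmn]
      exact ⟨hz₀.1, hz₀.2.1, charF_eq_zero_of_cube_eq h hm0⟩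
  obtain ⟨h1, h2⟩ := order_sum_eq_of_card_le
    (fun z hz => one_le_order hβ ((hmem z).1 hz).2.2) hTsub (by
      rw [hsum, Finset.card_union_of_disjoint hdisj, card_orb hlne, card_orb hmne])
  refine ⟨l, hl0, hlK, hz₀.2.1, hl, hcube, hn1, hn2, fun z hz hz1 hz2 => ?_⟩
  have hzT : z ∈ T := (hmem z).2 ⟨hz1, hz2, hz⟩
  refine ⟨h2 z hzT, ?_⟩
  rw [h1, Finset.mem_union, mem_orb, mem_orb] at hzT
  exact hzT

/-- The zeros in a disc containing `6N` nonzero ones can be listed, one from each orbit, as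
two lists of length `N`. -/
lemma exists_small_enum {β : ℝ} (hβ : β ∈ Set.Ioo (0 : ℝ) 1) {N : ℕ}
    (hN : ∑ z ∈ nzz β N, analyticOrderNatAt (charF β) z = 6 * N) :
    ∃ u : Fin N ⊕ Fin N → ℂ, (∀ i, u i ∈ nzz β N) ∧ ∀ z ∈ nzz β N,
      analyticOrderNatAt (charF β) z = (Finset.univ.filter fun i => u i ^ 3 = z ^ 3).card := by
  classical
  set o := analyticOrderNatAt (charF β) with ho
  set C := (nzz β N).image (· ^ 3) with hC
  have hr : ∀ c : C, ∃ z ∈ nzz β N, z ^ 3 = c := fun c => Finset.mem_image.1 c.2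
  choose r hr1 hr2 using hr
  have hord : ∀ {z w : ℂ}, z ^ 3 = w ^ 3 → o z = o w := fun h => by
    simp only [ho, analyticOrderNatAt, analyticOrderAt_charF_of_cube_eq β h]
  have hfib : ∀ c : C, ∑ z ∈ nzz β N with z ^ 3 = (c : ℂ), o z = 3 * o (r c) := by
    intro c
    have : (nzz β N).filter (fun z => z ^ 3 = (c : ℂ)) = orb (r c) := by
      ext z
      rw [Finset.mem_filter, mem_orb, hr2]
      refine ⟨fun h => h.2, fun h => ⟨?_, h⟩⟩
      rw [← hr2] at h
      have h1 := (mem_nzz hβ).1 (hr1 c)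
      rw [mem_nzz hβ, norm_eq_of_cube_eq h]
      refine ⟨?_, h1.2.1, charF_eq_zero_of_cube_eq h h1.2.2⟩
      rintro rfl
      have := norm_eq_of_cube_eq h
      rw [norm_zero] at this
      exact h1.1 (norm_eq_zero.1 this.symm)
    rw [this, Finset.sum_congr rfl fun z hz => hord (mem_orb.1 hz), Finset.sum_const,
      card_orb ((mem_nzz hβ).1 (hr1 c)).1, smul_eq_mul]
  -- Each orbit has three points of the same multiplicity, so that the multiplicities of one
  -- representative of each orbit add up to `2N`.
  have hcard : Fintype.card (Σ c : C, Fin (o (r c))) = Fintype.card (Fin N ⊕ Fin N) := by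
    have h1 : ∑ c : C, ∑ z ∈ nzz β N with z ^ 3 = (c : ℂ), o z = 6 * N := by
      rw [← hN, Finset.sum_coe_sort C (fun c : ℂ => ∑ z ∈ nzz β N with z ^ 3 = c, o z)]
      exact Finset.sum_fiberwise_of_maps_to (fun z hz => Finset.mem_image_of_mem _ hz) _
    rw [Finset.sum_congr rfl fun c _ => hfib c, ← Finset.mul_sum] at h1
    simp only [Fintype.card_sigma, Fintype.card_fin, Fintype.card_sum]
    omega
  obtain e := Fintype.equivOfCardEq hcard
  refine ⟨fun i => r (e.symm i).1, fun i => hr1 _, fun z hz => ?_⟩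
  set c₀ : C := ⟨z ^ 3, Finset.mem_image_of_mem _ hz⟩ with hc₀
  have h1 : (Finset.univ.filter fun i => r (e.symm i).1 ^ 3 = z ^ 3)
      = ((Finset.univ : Finset (Fin (o (r c₀)))).map
        ⟨fun j => e ⟨c₀, j⟩, fun j j' h => by simpa using e.injective h⟩) := by
    ext i
    simp only [Finset.mem_filter, Finset.mem_univ, true_and, Finset.mem_map]
    constructor
    · intro h
      rw [hr2] at h
      obtain ⟨⟨c, j⟩, rfl⟩ := e.surjective i
      rw [Equiv.symm_apply_apply] at h
      have : c = c₀ := Subtype.ext h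
      subst this
      exact ⟨j, rfl⟩
    · rintro ⟨j, rfl⟩
      change r (e.symm (e ⟨c₀, j⟩)).1 ^ 3 = z ^ 3
      rw [Equiv.symm_apply_apply, hr2]
  rw [h1, Finset.card_map, Finset.card_univ, Fintype.card_fin]
  exact hord (by rw [hr2])

/-- For a nonvanishing sequence, counting the pairs `(j, k)` with `ω^j s_k = ρ` amounts to counting
the indices `k` with `s_k³ = ρ³`, since `j` is determined by `k`. -/
lemma occurrences_eq {s : ℕ → ℂ} (hs : ∀ k, 1 ≤ k → s k ≠ 0) (ρ : ℂ) :
    occurrences s ρ = Set.encard {k | 1 ≤ k ∧ s k ^ 3 = ρ ^ 3} := by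
  obtain ⟨h1, h2, h3⟩ := om_pow_ne_one
  have hne : ∀ i j : ℕ, i < j → j < 3 → om ^ i ≠ om ^ j := by
    intro i j hij hj
    interval_cases j <;> interval_cases i
    · rw [pow_zero, pow_one]; exact h1.symm
    · rw [pow_zero]; exact h2.symm
    · rw [pow_one]; exact h3.symm
  have hinj : Set.InjOn Prod.snd {p : Fin 3 × ℕ | 1 ≤ p.2 ∧ om ^ (p.1 : ℕ) * s p.2 = ρ} := by
    rintro ⟨i, k⟩ ⟨hk, hi⟩ ⟨j, k'⟩ ⟨-, hj⟩ hkk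
    simp only at hkk hk hi hj
    subst hkk
    have : om ^ (i : ℕ) = om ^ (j : ℕ) := mul_right_cancel₀ (hs k hk) (hi.trans hj.symm)
    have hij : i = j := by
      rcases lt_trichotomy (i : ℕ) j with h | h | h
      · exact absurd this (hne i j h j.2)
      · exact Fin.ext h
      · exact absurd this.symm (hne j i h i.2)
    rw [hij]
  rw [occurrences, ← hinj.encard_image]
  congr 1
  ext k
  simp only [Set.mem_image, Set.mem_ofPred_eq, Prod.exists, exists_eq_right]
  constructor
  · rintro ⟨i, hk, rfl⟩
    refine ⟨hk, ?_⟩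
    rw [mul_pow, ← pow_mul, mul_comm (i : ℕ), pow_mul, om_cube, one_pow, one_mul]
  · rintro ⟨hk, h⟩
    rcases cube_eq_cube_iff.1 h.symm with h | h | h
    · exact ⟨0, hk, by simp [h]⟩
    · exact ⟨1, hk, by simp [h]⟩
    · exact ⟨2, hk, by simp [h]⟩

/-! ### The two sequences of zeros -/

/-- The circles of radius `rad K` separate the plane outside the first of them into annuli. -/
lemma exists_rad_le_lt {N : ℕ} {x : ℝ} (h : rad N ≤ x) : ∃ K ≥ N, rad K ≤ x ∧ x < rad (K + 1) := by
  have hex : ∃ K, x < rad (K + 1) := by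
    obtain ⟨K, hK⟩ := exists_nat_ge x
    refine ⟨K, hK.trans_lt ?_⟩
    have := Real.pi_gt_three
    have h0 : (0 : ℝ) ≤ K := by positivity
    rw [rad]; push_cast; nlinarith
  classical
  have h1 := Nat.find_spec hex
  have h3 : N ≤ Nat.find hex := by
    by_contra! hlt
    have : rad (Nat.find hex + 1) ≤ rad N := rad_strictMono.monotone hlt
    linarith
  refine ⟨Nat.find hex, h3, ?_, h1⟩
  rcases Nat.eq_zero_or_pos (Nat.find hex) with h0 | h0
  · rw [h0]
    have : N = 0 := by omega
    rwa [this] at h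
  · have h2 := Nat.find_min hex (Nat.sub_lt h0 one_pos)
    rw [show Nat.find hex - 1 + 1 = Nat.find hex by omega] at h2
    exact not_lt.1 h2

/-- If the members of `s` of index `k > N` have cubes different from `w`, the indices with cube `w`
are counted by the initial segment of `s`, numbered here from `0`. -/
lemma encard_small {N : ℕ} {u : Fin N → ℂ} {s : ℕ → ℂ} (hs : ∀ i : Fin N, s (i + 1) = u i) {w : ℂ}
    (hbig : ∀ k, N < k → s k ^ 3 ≠ w) : Set.encard {k | 1 ≤ k ∧ s k ^ 3 = w}
      = ((Finset.univ.filter fun i => u i ^ 3 = w).card : ℕ∞) := by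
  have : {k | 1 ≤ k ∧ s k ^ 3 = w}
      = (fun i : Fin N => (i : ℕ) + 1) '' ((Finset.univ.filter fun i => u i ^ 3 = w : Finset _) :
        Set (Fin N)) := by
    ext k
    simp only [Set.mem_ofPred_eq, Set.mem_image, Finset.coe_filter, Finset.mem_univ, true_and]
    constructor
    · rintro ⟨h1, h2⟩
      have hk : k ≤ N := by
        by_contra! h
        exact hbig k h h2
      refine ⟨⟨k - 1, by omega⟩, ?_, by simp; omega⟩
      rw [← hs]
      simpa [Nat.sub_add_cancel h1] using h2
    · rintro ⟨i, h1, rfl⟩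
      exact ⟨by omega, by rw [hs]; exact h1⟩
  rw [this, Function.Injective.encard_image, Set.encard_coe_eq_coe_finsetCard]
  intro i j h
  exact Fin.ext (by simpa using h)

/-- The zeros of `charF β`: two sequences, one zero from each orbit, with the asymptotics of the
members of large index. -/
lemma exists_zero_sequences {β : ℝ} (hβ : β ∈ Set.Ioo (0 : ℝ) 1) :
    ∃ (N : ℕ) (lam mu : ℕ → ℂ),
      (∀ ρ, ρ ≠ 0 → analyticOrderAt (charF β) ρ = occurrences lam ρ + occurrences mu ρ) ∧
      (∀ k, 1 ≤ k → lam k ≠ 0 ∧ mu k ≠ 0 ∧ charF β (lam k) = 0 ∧ charF β (mu k) = 0) ∧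
      ∀ k, N < k → InSector (lam k) ∧ mu k = -(starRingEnd ℂ) (lam k) ∧
        rad (k - 1) < ‖lam k‖ ∧ ‖lam k‖ < rad k ∧ 0 < (lam k ^ 3).re ∧
        ‖lam k - ((asymRe k : ℂ) + Complex.I * Real.log β)‖ ≤ 1 / 10 ∧
        ‖lam k - ((asymRe k : ℂ) + Complex.I * Real.log β)‖
          ≤ 36 / β * Real.exp (-(Real.sqrt 3 * k * Real.pi / 2)) := by
  classical
  obtain ⟨N, hN, hbig⟩ := exists_zero_in_annulus hβ
  obtain ⟨u, hu, hcount⟩ := exists_small_enum hβ hN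
  choose! b hb0 hb1 hb2 hbS hbc hbn hbe hbz using hbig
  set lam : ℕ → ℂ := fun k => if h : k - 1 < N then u (Sum.inl ⟨k - 1, h⟩) else b (k - 1) with hlam
  set mu : ℕ → ℂ := fun k => if h : k - 1 < N then u (Sum.inr ⟨k - 1, h⟩)
    else -(starRingEnd ℂ) (b (k - 1)) with hmu
  have lam_small : ∀ i : Fin N, lam (i + 1) = u (Sum.inl i) := fun i => by simp [hlam]
  have mu_small : ∀ i : Fin N, mu (i + 1) = u (Sum.inr i) := fun i => by simp [hmu]
  have lam_big : ∀ k, N < k → lam k = b (k - 1) := fun k hk => dif_neg (by omega)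
  have mu_big : ∀ k, N < k → mu k = -(starRingEnd ℂ) (b (k - 1)) := fun k hk => dif_neg (by omega)
  have hbne : ∀ K ≥ N, b K ≠ 0 := fun K hK h => by
    have := hbc K hK; rw [h] at this; simp at this
  have prop : ∀ k, 1 ≤ k → lam k ≠ 0 ∧ mu k ≠ 0 ∧ charF β (lam k) = 0 ∧ charF β (mu k) = 0 := by
    intro k hk
    by_cases h : k - 1 < N
    · have e1 : lam k = u (Sum.inl ⟨k - 1, h⟩) := dif_pos h
      have e2 : mu k = u (Sum.inr ⟨k - 1, h⟩) := dif_pos h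
      have h1 := (mem_nzz hβ).1 (hu (Sum.inl ⟨k - 1, h⟩))
      have h2 := (mem_nzz hβ).1 (hu (Sum.inr ⟨k - 1, h⟩))
      rw [e1, e2]
      exact ⟨h1.1, h2.1, h1.2.2, h2.2.2⟩
    · have hk' : N ≤ k - 1 := not_lt.1 h
      rw [lam_big k (by omega), mu_big k (by omega)]
      refine ⟨hbne _ hk', by simpa using hbne _ hk', hb0 _ hk', ?_⟩
      rw [charF_neg_conj, hb0 _ hk', map_zero]
  have norm_mu_big : ∀ k, N < k → ‖mu k‖ = ‖b (k - 1)‖ := fun k hk => by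
    rw [mu_big k hk, norm_neg, RCLike.norm_conj]
  refine ⟨N, lam, mu, fun ρ hρ => ?_, prop, fun k hk => ?_⟩
  · rw [occurrences_eq (fun k hk => (prop k hk).1), occurrences_eq (fun k hk => (prop k hk).2.1)]
    by_cases h0 : charF β ρ = 0
    swap
    · have e1 : {k | 1 ≤ k ∧ lam k ^ 3 = ρ ^ 3} = ∅ := by
        ext k
        simp only [Set.mem_ofPred_eq, Set.mem_empty_iff_false, iff_false]
        rintro ⟨hk, h⟩
        exact h0 (charF_eq_zero_of_cube_eq h.symm (prop k hk).2.2.1)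
      have e2 : {k | 1 ≤ k ∧ mu k ^ 3 = ρ ^ 3} = ∅ := by
        ext k
        simp only [Set.mem_ofPred_eq, Set.mem_empty_iff_false, iff_false]
        rintro ⟨hk, h⟩
        exact h0 (charF_eq_zero_of_cube_eq h.symm (prop k hk).2.2.2)
      rw [e1, e2, analyticOrderAt_eq_zero.2 (Or.inr h0)]
      simp
    rw [← Nat.cast_analyticOrderNatAt (analyticOrderAt_charF_ne_top hβ ρ)]
    rcases lt_or_ge ‖ρ‖ (rad N) with hρN | hρN
    · rw [hcount ρ ((mem_nzz hβ).2 ⟨hρ, hρN, h0⟩)]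
      have far : ∀ k, N < k → ∀ w : ℂ, ‖w‖ = ‖b (k - 1)‖ → w ^ 3 ≠ ρ ^ 3 := by
        intro k hk w hw h
        have h1 := hb1 (k - 1) (by omega)
        have h2 := rad_strictMono.monotone (show N ≤ k - 1 by omega)
        have h3 := norm_eq_of_cube_eq h
        linarith
      rw [encard_small lam_small fun k hk => far k hk _ (by rw [lam_big k hk]),
        encard_small mu_small fun k hk => far k hk _ (norm_mu_big k hk), ← Nat.cast_add]
      congr 1
      simp only [Finset.card_filter, Fintype.sum_sum_type]
    · obtain ⟨K, hK, hK1, hK2⟩ := exists_rad_le_lt hρN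
      obtain ⟨h1, h2⟩ := hbz K hK ρ h0 hK1 hK2
      have hne : (b K) ^ 3 ≠ (-(starRingEnd ℂ) (b K)) ^ 3 := by
        intro h
        have h3 := congrArg Complex.re h
        rw [Odd.neg_pow (by decide), ← map_pow, Complex.neg_re, Complex.conj_re] at h3
        have := hbc K hK
        linarith
      have idx : ∀ k, 1 ≤ k → ‖lam k‖ = ‖ρ‖ ∨ ‖mu k‖ = ‖ρ‖ → k = K + 1 := by
        intro k hk hn
        by_cases hkN : N < k
        · have hn' : ‖b (k - 1)‖ = ‖ρ‖ := by
            rw [norm_mu_big k hkN, lam_big k hkN, or_self] at hn; exact hn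
          have h3 := hb1 (k - 1) (by omega)
          have h4 := hb2 (k - 1) (by omega)
          rw [hn'] at h3 h4
          have h5 := rad_strictMono.lt_iff_lt.1 (h3.trans hK2)
          have h6 := rad_strictMono.lt_iff_lt.1 (hK1.trans_lt h4)
          omega
        · exfalso
          have h : k - 1 < N := by omega
          have e1 : lam k = u (Sum.inl ⟨k - 1, h⟩) := dif_pos h
          have e2 : mu k = u (Sum.inr ⟨k - 1, h⟩) := dif_pos h
          have h3 := ((mem_nzz hβ).1 (hu (Sum.inl ⟨k - 1, h⟩))).2.1
          have h4 := ((mem_nzz hβ).1 (hu (Sum.inr ⟨k - 1, h⟩))).2.1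
          rw [e1, e2] at hn
          rcases hn with hn | hn <;> linarith
      have single : ∀ s : ℕ → ℂ, (∀ k, 1 ≤ k → ‖s k‖ = ‖ρ‖ → k = K + 1) → s (K + 1) ^ 3 = ρ ^ 3 →
          {k | 1 ≤ k ∧ s k ^ 3 = ρ ^ 3} = {K + 1} := by
        intro s hs h
        ext k
        simp only [Set.mem_ofPred_eq, Set.mem_singleton_iff]
        refine ⟨fun hk => hs k hk.1 (norm_eq_of_cube_eq hk.2), ?_⟩
        rintro rfl
        exact ⟨by omega, h⟩
      have none : ∀ s : ℕ → ℂ, (∀ k, 1 ≤ k → ‖s k‖ = ‖ρ‖ → k = K + 1) → s (K + 1) ^ 3 ≠ ρ ^ 3 →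
          {k | 1 ≤ k ∧ s k ^ 3 = ρ ^ 3} = ∅ := by
        intro s hs h
        ext k
        simp only [Set.mem_ofPred_eq, Set.mem_empty_iff_false, iff_false]
        rintro ⟨hk, hk'⟩
        have := hs k hk (norm_eq_of_cube_eq hk')
        subst this
        exact h hk'
      have eL : lam (K + 1) = b K := lam_big (K + 1) (by omega)
      have eM : mu (K + 1) = -(starRingEnd ℂ) (b K) := mu_big (K + 1) (by omega)
      have iL := fun k hk h => idx k hk (Or.inl h)
      have iM := fun k hk h => idx k hk (Or.inr h)
      rw [h1]
      rcases h2 with h2 | h2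
      · rw [single lam iL (by rw [eL, h2]), none mu iM (by rw [eM, h2]; exact hne.symm)]
        simp
      · rw [none lam iL (by rw [eL, h2]; exact hne), single mu iM (by rw [eM, h2])]
        simp
  · have hk' : N ≤ k - 1 := by omega
    have e : k - 1 + 1 = k := by omega
    have h1 := hb2 _ hk'
    have h2 := hbn _ hk'
    have h3 := hbe _ hk'
    rw [e] at h1 h2 h3
    rw [mu_big k hk, lam_big k hk]
    exact ⟨hbS _ hk', rfl, hb1 _ hk', h1, hbc _ hk', h2, h3⟩

/-! ### Dissipativity: the sign of the exponents -/

/-- The two sums `∑_r ω^r e_r` and `∑_r ω^r e_r⁻¹` have no common zero but the origin: their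
vanishing forces `e_0 = e_1 = e_2`, as `e_0 e_1 e_2 = 1`. -/
lemma eq_zero_of_sums_eq_zero {ρ : ℂ} (h1 : ee 0 ρ + om * ee 1 ρ + om ^ 2 * ee 2 ρ = 0)
    (h2 : (ee 0 ρ)⁻¹ + om * (ee 1 ρ)⁻¹ + om ^ 2 * (ee 2 ρ)⁻¹ = 0) : ρ = 0 := by
  rw [ee_inv_zero, ee_inv_one, ee_inv_two] at h2
  -- Eliminating `e_0` between the two sums leaves a perfect square.
  have hsq : (ee 1 ρ - ee 2 ρ) ^ 2 = 0 := by
    linear_combination (om * ee 2 ρ + om ^ 2 * ee 1 ρ) * h1 - h2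
      + (-ee 1 ρ ^ 2 - ee 2 ρ ^ 2 - om * ee 1 ρ * ee 2 ρ) * om_cube - ee 1 ρ * ee 2 ρ * om_sq
  have h12 : ee 1 ρ = ee 2 ρ := sub_eq_zero.1 (pow_eq_zero_iff (by norm_num) |>.1 hsq)
  have h01 : ee 0 ρ = ee 1 ρ := by
    rw [← h12] at h1
    linear_combination h1 - ee 1 ρ * om_sq
  have n1 := congrArg norm h12
  have n2 := congrArg norm h01
  rw [norm_ee_one, norm_ee_two, Real.exp_eq_exp] at n1
  rw [norm_ee_zero, norm_ee_one, Real.exp_eq_exp] at n2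
  have hx : ρ.re = 0 := by
    have : Real.sqrt 3 * ρ.re = 0 := by linarith
    exact (mul_eq_zero.1 this).resolve_left (by have := sqrt_three_bounds.1; linarith)
  rw [hx] at n2
  exact Complex.ext hx (by simp; linarith)

/-- The adjoint eigenfunction has nonzero slope at `0`, which makes the dissipation below strict. -/
lemma efun_neg_one_left_ne_zero {β : ℝ} {σ : ℂ} (hσ : σ ≠ 0) (h0 : charF β σ = 0) :
    efun (-σ) 1 0 ≠ 0 := by
  intro h
  rw [efun_one_left] at h
  simp only [ee_neg] at h
  have hI : Complex.I * -σ * (om - om ^ 2) ≠ 0 := by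
    rw [om_sub_sq]
    have := sqrt_three_bounds.1
    have h3 : ((Real.sqrt 3 : ℝ) : ℂ) ≠ 0 := Complex.ofReal_ne_zero.2 (by linarith)
    exact mul_ne_zero (mul_ne_zero Complex.I_ne_zero (neg_ne_zero.2 hσ))
      (mul_ne_zero Complex.I_ne_zero h3)
  have h2 := (mul_eq_zero.1 h).resolve_left hI
  refine hσ (eq_zero_of_sums_eq_zero ?_ h2)
  rw [charF] at h0
  linear_combination h0 - β * h2

lemma hasDerivAt_efun_real (ρ : ℂ) (n : ℕ) (x : ℝ) :
    HasDerivAt (fun x : ℝ => efun ρ n x) (efun ρ (n + 1) x) x :=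
  (hasDerivAt_efun ρ n x).comp_ofReal

/-- The coupling condition of the adjoint eigenfunction. -/
lemma efun_neg_one_right {β : ℝ} {σ : ℂ} (h0 : charF β σ = 0) :
    efun (-σ) 1 1 = β * efun (-σ) 1 0 := by
  have := efun_neg_coupled β σ
  rw [h0, mul_zero, neg_zero] at this
  exact (sub_eq_zero.1 this).symm

/-- Every nonzero zero `σ` of `charF β` satisfies `Re (iσ³) > 0`. The function
`Re (ψ'' ψ̄) - |ψ'|² / 2` formed with the adjoint eigenfunction `ψ` has derivative
`Re (iσ³) |ψ|²`, and it increases from `0` to `1` because `ψ'(1) = β ψ'(0)` with `β < 1`. -/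
lemma re_I_mul_cube_pos {β : ℝ} (hβ : β ∈ Set.Ioo (0 : ℝ) 1) {σ : ℂ} (hσ : σ ≠ 0)
    (h0 : charF β σ = 0) : 0 < (Complex.I * σ ^ 3).re := by
  by_contra! hle
  set E : ℝ → ℂ := fun x => efun (-σ) 2 x * star (efun (-σ) 0 x)
    - (1 / 2) * (efun (-σ) 1 x * star (efun (-σ) 1 x)) with hE
  have hd : ∀ x : ℝ, HasDerivAt (fun x => (E x).re)
      ((Complex.I * σ ^ 3).re * Complex.normSq (efun (-σ) 0 x)) x := by
    intro x
    have d0 := hasDerivAt_efun_real (-σ) 0 x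
    have d1 := hasDerivAt_efun_real (-σ) 1 x
    have d2 := hasDerivAt_efun_real (-σ) 2 x
    have hE' := (d2.mul d0.star).sub ((d1.mul d1.star).const_mul (1 / 2 : ℂ))
    have hre := Complex.reCLM.hasFDerivAt.comp_hasDerivAt x hE'
    refine HasDerivAt.congr_deriv hre ?_
    have h3 : efun (-σ) (2 + 1) x = Complex.I * σ ^ 3 * efun (-σ) 0 x := by
      rw [show 2 + 1 = 0 + 3 from rfl, efun_add_three]
      linear_combination (-Complex.I * σ ^ 3 * efun (-σ) 0 x) * Complex.I_sq
    rw [h3]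
    change Complex.reCLM (Complex.I * σ ^ 3 * efun (-σ) 0 x * star (efun (-σ) 0 x)
      + efun (-σ) 2 x * star (efun (-σ) 1 x) - 1 / 2 * (efun (-σ) 2 x * star (efun (-σ) 1 x)
      + efun (-σ) 1 x * star (efun (-σ) 2 x))) = _
    generalize efun (-σ) 0 x = p0
    generalize efun (-σ) 1 x = p1
    generalize efun (-σ) 2 x = p2
    generalize Complex.I * σ ^ 3 = c
    simp [Complex.normSq_apply]
    ring
  have hanti : Antitone fun x => (E x).re := by
    refine antitone_of_deriv_nonpos (fun x => (hd x).differentiableAt) fun x => ?_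
    rw [(hd x).deriv]
    exact mul_nonpos_of_nonpos_of_nonneg hle (Complex.normSq_nonneg _)
  have h01 := hanti zero_le_one
  have hr := efun_neg_one_right h0
  have e0 : (E 0).re = -(1 / 2) * Complex.normSq (efun (-σ) 1 0) := by
    simp [hE, efun_left, Complex.normSq_apply]
  have e1 : (E 1).re = -(1 / 2) * (β ^ 2 * Complex.normSq (efun (-σ) 1 0)) := by
    simp [hE, efun_right, hr, Complex.normSq_apply]; ring
  simp only [e0, e1] at h01
  have hpos := Complex.normSq_pos.2 (efun_neg_one_left_ne_zero hσ h0)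
  have hb : β ^ 2 < 1 := by have := hβ.1; have := hβ.2; nlinarith
  nlinarith

/-! ### The Fourier transform on the unit interval -/

lemma norm_exp_neg_I_mul (ρ : ℂ) (x : ℝ) :
    ‖Complex.exp (-Complex.I * ρ * x)‖ = Real.exp (ρ.im * x) := by
  rw [Complex.norm_exp]; simp

lemma norm_exp_le_max (ρ : ℂ) {x : ℝ} (hx : x ∈ Set.Icc (0 : ℝ) 1) :
    ‖Complex.exp (-Complex.I * ρ * x)‖ ≤ max 1 ‖Complex.exp (-Complex.I * ρ)‖ := by
  rw [norm_exp_neg_I_mul]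
  have h1 : ‖Complex.exp (-Complex.I * ρ)‖ = Real.exp ρ.im := by
    have := norm_exp_neg_I_mul ρ 1; simpa using this
  rw [h1]
  rcases le_total 0 ρ.im with h | h
  · exact (Real.exp_le_exp.2 (by nlinarith [hx.1, hx.2])).trans (le_max_right _ _)
  · exact (Real.exp_le_one_iff.2 (by nlinarith [hx.1])).trans (le_max_left _ _)

lemma exists_bound_of_continuousOn {f : ℝ → ℂ} (hf : ContinuousOn f (Set.Icc 0 1)) :
    ∃ C ≥ (0 : ℝ), ∀ x ∈ Set.Icc (0 : ℝ) 1, ‖f x‖ ≤ C := by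
  obtain ⟨C, hC⟩ := isCompact_Icc.exists_bound_of_continuousOn hf
  exact ⟨C, (norm_nonneg _).trans (hC 0 (by simp)), hC⟩

lemma norm_fourier_le {f : ℝ → ℂ} {C : ℝ} (hC : ∀ x ∈ Set.Icc (0 : ℝ) 1, ‖f x‖ ≤ C) (ρ : ℂ) :
    ‖fourier f ρ‖ ≤ C * max 1 ‖Complex.exp (-Complex.I * ρ)‖ := by
  have h := intervalIntegral.norm_integral_le_of_norm_le_const (a := (0 : ℝ)) (b := 1)
    (f := fun x : ℝ => Complex.exp (-Complex.I * ρ * x) * f x)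
    (C := C * max 1 ‖Complex.exp (-Complex.I * ρ)‖) (by
      intro x hx
      rw [Set.uIoc_of_le zero_le_one] at hx
      have hx' : x ∈ Set.Icc (0 : ℝ) 1 := ⟨hx.1.le, hx.2⟩
      rw [norm_mul, mul_comm]
      exact mul_le_mul (hC x hx') (norm_exp_le_max ρ hx') (norm_nonneg _)
        ((norm_nonneg _).trans (hC x hx')))
  simpa [fourier] using h

lemma intervalIntegrable_exp_mul {f : ℝ → ℂ} (hf : ContinuousOn f (Set.Icc 0 1)) {k : ℝ → ℂ}
    (hk : Continuous k) : IntervalIntegrable (fun x => k x * f x) MeasureTheory.volume 0 1 := by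
  apply ContinuousOn.intervalIntegrable
  rw [Set.uIcc_of_le zero_le_one]
  exact hk.continuousOn.mul hf

lemma differentiable_fourier {f : ℝ → ℂ} (hf : ContinuousOn f (Set.Icc 0 1)) :
    Differentiable ℂ (fourier f) := by
  intro ρ₀
  obtain ⟨C, hC0, hC⟩ := exists_bound_of_continuousOn hf
  have h := intervalIntegral.hasDerivAt_integral_of_dominated_loc_of_deriv_le
    (μ := MeasureTheory.volume) (a := (0 : ℝ)) (b := 1) (x₀ := ρ₀) (s := Metric.ball ρ₀ 1)
    (F := fun (ρ : ℂ) (x : ℝ) => Complex.exp (-Complex.I * ρ * x) * f x)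
    (F' := fun (ρ : ℂ) (x : ℝ) => -Complex.I * x * Complex.exp (-Complex.I * ρ * x) * f x)
    (bound := fun _ => Real.exp (‖ρ₀‖ + 1) * C) (Metric.ball_mem_nhds ρ₀ one_pos)
    (Filter.Eventually.of_forall fun ρ => (intervalIntegrable_iff.1 (intervalIntegrable_exp_mul hf
      (k := fun x : ℝ => Complex.exp (-Complex.I * ρ * x)) (by fun_prop))).aestronglyMeasurable)
    (intervalIntegrable_exp_mul hf (by fun_prop))
    (intervalIntegrable_iff.1 (intervalIntegrable_exp_mul hf
      (k := fun x : ℝ => -Complex.I * x * Complex.exp (-Complex.I * ρ₀ * x))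
      (by fun_prop))).aestronglyMeasurable
    (MeasureTheory.ae_of_all _ fun x hx ρ hρ => ?_)
    (by simp) (MeasureTheory.ae_of_all _ fun x hx ρ hρ => ?_)
  · exact h.2.differentiableAt
  · rw [Set.uIoc_of_le zero_le_one] at hx
    have hx' : x ∈ Set.Icc (0 : ℝ) 1 := ⟨hx.1.le, hx.2⟩
    rw [norm_mul, norm_mul, norm_mul, norm_neg, Complex.norm_I, Complex.norm_real, one_mul,
      norm_exp_neg_I_mul, Real.norm_of_nonneg hx.1.le]
    have h1 : ‖ρ‖ ≤ ‖ρ₀‖ + 1 := by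
      have := norm_sub_norm_le ρ ρ₀
      rw [Metric.mem_ball, dist_eq_norm] at hρ; linarith
    have h2 : ρ.im * x ≤ ‖ρ₀‖ + 1 := by
      have h3 := (le_abs_self _).trans (Complex.abs_im_le_norm ρ)
      have := norm_nonneg ρ
      nlinarith [hx.1, hx.2]
    have h3 := Real.exp_le_exp.2 h2
    calc x * Real.exp (ρ.im * x) * ‖f x‖ ≤ 1 * Real.exp (‖ρ₀‖ + 1) * C := by
          gcongr
          · exact hx.2
          · exact hC x hx'
      _ = _ := by ring
  · have h1 := (((hasDerivAt_id ρ).const_mul (-Complex.I)).mul_const (x : ℂ)).cexp.mul_const (f x)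
    refine h1.congr_deriv ?_
    simp; left; ring

lemma contDiffOn_derivWithin {f : ℝ → ℂ} (hf : ContDiffOn ℝ ∞ f (Set.Icc 0 1)) :
    ContDiffOn ℝ ∞ (derivWithin f (Set.Icc 0 1)) (Set.Icc 0 1) :=
  hf.derivWithin (uniqueDiffOn_Icc zero_lt_one) (by simp)

/-- Integration by parts in the Fourier transform. -/
lemma mul_fourier_eq {f : ℝ → ℂ} (hf : ContDiffOn ℝ ∞ f (Set.Icc 0 1)) (ρ : ℂ) :
    Complex.I * ρ * fourier f ρ = f 0 - Complex.exp (-Complex.I * ρ) * f 1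
      + fourier (derivWithin f (Set.Icc 0 1)) ρ := by
  have hd : ∀ x ∈ Set.Ioo (min (0 : ℝ) 1) (max 0 1),
      HasDerivAt f (derivWithin f (Set.Icc 0 1) x) x := by
    intro x hx
    rw [min_eq_left zero_le_one, max_eq_right zero_le_one] at hx
    have hn : Set.Icc (0 : ℝ) 1 ∈ 𝓝 x := Icc_mem_nhds hx.1 hx.2
    have h1 := (hf.differentiableOn (by simp)) x ⟨hx.1.le, hx.2.le⟩
    exact h1.hasDerivWithinAt.hasDerivAt hn
  have hc : ContinuousOn (derivWithin f (Set.Icc 0 1)) (Set.Icc 0 1) :=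
    (contDiffOn_derivWithin hf).continuousOn
  have hu : ∀ x : ℝ, HasDerivAt (fun x : ℝ => Complex.exp (-Complex.I * ρ * x))
      (-Complex.I * ρ * Complex.exp (-Complex.I * ρ * x)) x := by
    intro x
    have := ((hasDerivAt_id (x : ℂ)).const_mul (-Complex.I * ρ)).cexp.comp_ofReal
    refine this.congr_deriv ?_
    simp; ring
  have hcu : Continuous fun x : ℝ => Complex.exp (-Complex.I * ρ * x) := by fun_prop
  have h := intervalIntegral.integral_mul_deriv_eq_deriv_mul_of_hasDerivAt (a := (0 : ℝ)) (b := 1)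
    (u := fun x : ℝ => Complex.exp (-Complex.I * ρ * x)) (v := f) hcu.continuousOn
    (by rw [Set.uIcc_of_le zero_le_one]; exact hf.continuousOn) (fun x _ => hu x) hd
    (Continuous.intervalIntegrable (by fun_prop) _ _)
    (by
      apply ContinuousOn.intervalIntegrable
      rw [Set.uIcc_of_le zero_le_one]; exact hc)
  have h2 : (∫ x in (0 : ℝ)..1, -Complex.I * ρ * Complex.exp (-Complex.I * ρ * x) * f x)
      = -Complex.I * ρ * fourier f ρ := by
    rw [fourier, ← intervalIntegral.integral_const_mul]
    refine intervalIntegral.integral_congr fun x _ => ?_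
    ring
  rw [h2] at h
  simp only [Complex.ofReal_one, Complex.ofReal_zero, mul_one, mul_zero, Complex.exp_zero,
    one_mul] at h
  have h3 : fourier (derivWithin f (Set.Icc 0 1)) ρ = Complex.exp (-Complex.I * ρ) * f 1 - f 0
      - -Complex.I * ρ * fourier f ρ := h
  rw [h3]
  ring

/-- The transform of a smooth function decays like `1/ρ`, relative to the exponential at the
larger end point. -/
lemma exists_fourier_decay {f : ℝ → ℂ} (hf : ContDiffOn ℝ ∞ f (Set.Icc 0 1)) :
    ∃ C ≥ (0 : ℝ), ∀ ρ : ℂ, ‖ρ‖ * ‖fourier f ρ‖ ≤ C * max 1 ‖Complex.exp (-Complex.I * ρ)‖ := by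
  obtain ⟨C₀, hC₀, h₀⟩ := exists_bound_of_continuousOn hf.continuousOn
  obtain ⟨C₁, hC₁, h₁⟩ := exists_bound_of_continuousOn (contDiffOn_derivWithin hf).continuousOn
  refine ⟨C₀ + C₀ + C₁, by positivity, fun ρ => ?_⟩
  have h := congrArg norm (mul_fourier_eq hf ρ)
  rw [norm_mul, norm_mul, Complex.norm_I, one_mul] at h
  rw [h]
  set m := max 1 ‖Complex.exp (-Complex.I * ρ)‖ with hm
  have h1 : (1 : ℝ) ≤ m := le_max_left _ _
  have h2 : ‖Complex.exp (-Complex.I * ρ)‖ ≤ m := le_max_right _ _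
  have a1 : ‖f 0‖ ≤ C₀ * m := (h₀ 0 (by simp)).trans (le_mul_of_one_le_right hC₀ h1)
  have a2 : ‖Complex.exp (-Complex.I * ρ) * f 1‖ ≤ C₀ * m := by
    rw [norm_mul, mul_comm]
    exact mul_le_mul (h₀ 1 (by simp)) h2 (norm_nonneg _) hC₀
  have a3 := norm_fourier_le h₁ ρ
  have a4 := norm_add_le (f 0 - Complex.exp (-Complex.I * ρ) * f 1)
    (fourier (derivWithin f (Set.Icc 0 1)) ρ)
  have a5 := norm_sub_le (f 0) (Complex.exp (-Complex.I * ρ) * f 1)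
  rw [← hm] at a3
  linarith

/-- If the function vanishes at both end points, its transform decays like `1/ρ²`. -/
lemma exists_fourier_decay_two {f : ℝ → ℂ} (hf : ContDiffOn ℝ ∞ f (Set.Icc 0 1)) (hf0 : f 0 = 0)
    (hf1 : f 1 = 0) : ∃ C ≥ (0 : ℝ), ∀ ρ : ℂ,
      ‖ρ‖ ^ 2 * ‖fourier f ρ‖ ≤ C * max 1 ‖Complex.exp (-Complex.I * ρ)‖ := by
  obtain ⟨C, hC, h⟩ := exists_fourier_decay (contDiffOn_derivWithin hf)
  refine ⟨C, hC, fun ρ => ?_⟩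
  have h1 := congrArg norm (mul_fourier_eq hf ρ)
  rw [hf0, hf1, mul_zero, sub_zero, zero_add, norm_mul, norm_mul, Complex.norm_I, one_mul] at h1
  rw [pow_two, mul_assoc, h1]
  exact h ρ

/-! ### Well-conditioning -/

/-- Every point `(2k - 1/3)π + i log β` of large index has a zero in a prescribed neighbourhood. -/
lemma exists_zero_near_lattice {β : ℝ} (hβ : β ∈ Set.Ioo (0 : ℝ) 1) {ε : ℝ} (hε : 0 < ε) :
    ∃ K : ℕ, ∀ k ≥ K, ∃ σ, charF β σ = 0 ∧
      ‖σ - ((asymRe k : ℂ) + Complex.I * Real.log β)‖ ≤ ε := by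
  obtain ⟨N, lam, mu, -, hz, hN⟩ := exists_zero_sequences hβ
  have ht : Tendsto (fun k : ℕ => 36 / β * Real.exp (-(Real.sqrt 3 * k * Real.pi / 2))) atTop
      (𝓝 (36 / β * 0)) := by
    refine Tendsto.const_mul _ (Real.tendsto_exp_neg_atTop_nhds_zero.comp ?_)
    have : (fun k : ℕ => Real.sqrt 3 * k * Real.pi / 2)
        = fun k : ℕ => (k : ℝ) * (Real.sqrt 3 * Real.pi / 2) := by ext; ring
    rw [this]
    exact tendsto_natCast_atTop_atTop.atTop_mul_const (by have := Real.pi_pos; positivity)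
  rw [mul_zero] at ht
  obtain ⟨K, hK⟩ := (ht.eventually (gt_mem_nhds hε)).exists_forall_of_atTop
  refine ⟨max K (N + 1), fun k hk => ⟨lam k, ?_, ?_⟩⟩
  · exact (hz k (by have := le_trans (le_max_right _ _) hk; omega)).2.2.1
  · have h := hN k (by have := le_trans (le_max_right _ _) hk; omega)
    exact h.2.2.2.2.2.2.trans (hK k (le_trans (le_max_left _ _) hk)).le

/-- Away from its zeros, `charF β` is as large as its growth scale. -/
lemma exists_norm_charF_ge {β : ℝ} (hβ : β ∈ Set.Ioo (0 : ℝ) 1) {ε : ℝ} (hε : 0 < ε) :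
    ∃ c > (0 : ℝ), ∃ R : ℝ, ∀ ρ : ℂ, R ≤ ‖ρ‖ → (∀ σ, charF β σ = 0 → ε ≤ dist ρ σ) →
      c * gr ρ ≤ ‖charF β ρ‖ := by
  have hβ0 := hβ.1
  set δ : ℝ := min (1 / 4) (ε / 8) with hδ
  have hδ0 : 0 < δ := by positivity
  have hδ1 : δ ≤ 1 / 4 := min_le_left _ _
  have hδ2 : δ ≤ ε / 8 := min_le_right _ _
  obtain ⟨R, hR⟩ := tendsto_exp_neg_half_re (δ * β / 8) (by positivity)
  obtain ⟨K, hK⟩ := exists_zero_near_lattice hβ (half_pos hε)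
  refine ⟨δ * β / 12, by positivity, max R (2 * (2 * Real.pi * K + 3)), fun ρ => ?_⟩
  induction ρ using sector_induction with
  | hS ρ h =>
    intro hρ hσ
    have h1 := hR ρ h ((le_max_left _ _).trans hρ)
    have h2 : 2 * Real.pi * K + 3 ≤ ρ.re := by
      linarith [(le_max_right _ _).trans hρ, h.norm_le]
    have hd := dom_pos ρ
    by_contra! hlt
    -- If `charF β ρ` is small, then `ρ` is close to a lattice point, and that one to a zero.
    obtain ⟨n, hn⟩ := h.exists_int_near hβ hδ1 (by
      have h3 := h.gr_le
      have h4 : δ * β / 12 * gr ρ ≤ δ * β / 12 * (6 * dom ρ) := by gcongr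
      have h5 : Real.exp (-ρ.re / 2) * dom ρ ≤ δ * β / 8 * dom ρ := by gcongr
      linarith)
    have hre : |(ρ - nu β - 2 * Real.pi * n).re| ≤ 3 / 4 :=
      (Complex.abs_re_le_norm _).trans (by linarith)
    have hre' : (ρ - nu β - 2 * Real.pi * n).re = ρ.re + Real.pi / 3 - 2 * Real.pi * n := by
      simp [nu]
    rw [hre', abs_le] at hre
    have hKn : (K : ℝ) ≤ n := by
      have hp := Real.pi_pos
      by_contra! hlt
      nlinarith [hre.2]
    have hKn' : (K : ℤ) ≤ n := by exact_mod_cast hKn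
    obtain ⟨k, rfl⟩ := Int.eq_ofNat_of_zero_le (le_trans (Int.natCast_nonneg K) hKn')
    obtain ⟨σ, hσ0, hσ1⟩ := hK k (by exact_mod_cast hKn')
    have h6 := hσ σ hσ0
    rw [dist_eq_norm] at h6
    rw [← nu_add] at hσ1
    have h7 : ‖ρ - σ‖ ≤ ‖ρ - nu β - 2 * Real.pi * (k : ℤ)‖ + ‖σ - (nu β + 2 * Real.pi * k)‖ := by
      have : ρ - σ = (ρ - nu β - 2 * Real.pi * (k : ℤ)) - (σ - (nu β + 2 * Real.pi * k)) := by
        push_cast; ring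
      rw [this]; exact norm_sub_le _ _
    linarith
  | hom ρ ih =>
    intro hρ hσ
    rw [norm_mul, norm_om, one_mul] at hρ
    rw [gr_om, charF_om, norm_mul, norm_pow, norm_om, one_pow, one_mul]
    refine ih hρ fun σ h0 => ?_
    have h1 := hσ (om * σ) (by rw [charF_om, h0, mul_zero])
    rwa [dist_eq_norm, ← mul_sub, norm_mul, norm_om, one_mul, ← dist_eq_norm] at h1
  | hconj ρ ih =>
    intro hρ hσ
    rw [norm_neg, RCLike.norm_conj] at hρ
    rw [gr_neg_conj, charF_neg_conj, RCLike.norm_conj]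
    refine ih hρ fun σ h0 => ?_
    have h1 := hσ (-(starRingEnd ℂ) σ) (by rw [charF_neg_conj, h0, map_zero])
    rwa [dist_eq_norm, ← neg_sub_neg, neg_neg, neg_neg, ← map_sub, RCLike.norm_conj, norm_sub_rev,
      ← dist_eq_norm] at h1

lemma norm_ΔP {a : ℂ} (ha : ‖a‖ = 1) (β : ℝ) (ρ : ℂ) :
    ‖ΔP a β ρ‖ = Real.sqrt 3 * ‖ρ‖ * ‖charF β ρ‖ := by
  rw [ΔP_eq, om_sub_sq]
  simp [ha, abs_of_nonneg]

lemma ΔP_eq_zero_iff {a : ℂ} (ha : ‖a‖ = 1) {β : ℝ} {ρ : ℂ} :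
    ΔP a β ρ = 0 ↔ charF β ρ = 0 := by
  rw [← norm_eq_zero, norm_ΔP ha]
  constructor
  · intro h
    rcases mul_eq_zero.1 h with h | h
    · rcases mul_eq_zero.1 h with h | h
      · exact absurd h (by have := sqrt_three_bounds.1; linarith)
      · rw [norm_eq_zero.1 h, charF_zero]
    · exact norm_eq_zero.1 h
  · intro h; rw [h, norm_zero, mul_zero]

section NumeratorBounds

variable {a : ℂ} {β : ℝ} {f : ℝ → ℂ} {ρ : ℂ} {δ : ℝ}

/-- The products of the exponentials occurring in the Cramer determinants are bounded by the
growth scale, because `e_0 e_1 e_2 = 1`. -/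
lemma max_mul_le_gr (ρ : ℂ) {u : ℂ} {r : ℕ} (h1 : ‖u‖ ≤ gr ρ) (h2 : ‖(ee r ρ)⁻¹ * u‖ ≤ gr ρ) :
    max 1 ‖(ee r ρ)⁻¹‖ * ‖u‖ ≤ gr ρ := by
  rw [max_mul_of_nonneg _ _ (norm_nonneg _), one_mul, ← norm_mul]
  exact max_le h1 h2

lemma norm_le_gr (ρ : ℂ) : (‖ee 0 ρ‖ ≤ gr ρ ∧ ‖ee 1 ρ‖ ≤ gr ρ ∧ ‖ee 2 ρ‖ ≤ gr ρ) ∧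
    ‖(ee 0 ρ)⁻¹‖ ≤ gr ρ ∧ ‖(ee 1 ρ)⁻¹‖ ≤ gr ρ ∧ ‖(ee 2 ρ)⁻¹‖ ≤ gr ρ := by
  have := norm_nonneg (ee 0 ρ)
  have := norm_nonneg (ee 1 ρ)
  have := norm_nonneg (ee 2 ρ)
  have := norm_nonneg (ee 0 ρ)⁻¹
  have := norm_nonneg (ee 1 ρ)⁻¹
  have := norm_nonneg (ee 2 ρ)⁻¹
  unfold gr
  refine ⟨⟨?_, ?_, ?_⟩, ?_, ?_, ?_⟩ <;> linarith

lemma inv_mul_inv (ρ : ℂ) : (ee 0 ρ)⁻¹ * (ee 1 ρ)⁻¹ = ee 2 ρ ∧ (ee 0 ρ)⁻¹ * (ee 2 ρ)⁻¹ = ee 1 ρ ∧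
    (ee 1 ρ)⁻¹ * (ee 2 ρ)⁻¹ = ee 0 ρ := by
  have h := ee_prod ρ
  have h0 := ee_ne_zero 0 ρ
  have h1 := ee_ne_zero 1 ρ
  have h2 := ee_ne_zero 2 ρ
  refine ⟨?_, ?_, ?_⟩ <;> field_simp <;> rw [← h] <;> ring

lemma max_inv_mul_inv_le (ρ : ℂ) :
    (max 1 ‖(ee 0 ρ)⁻¹‖ * ‖(ee 1 ρ)⁻¹‖ ≤ gr ρ ∧ max 1 ‖(ee 0 ρ)⁻¹‖ * ‖(ee 2 ρ)⁻¹‖ ≤ gr ρ) ∧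
    (max 1 ‖(ee 1 ρ)⁻¹‖ * ‖(ee 0 ρ)⁻¹‖ ≤ gr ρ ∧ max 1 ‖(ee 1 ρ)⁻¹‖ * ‖(ee 2 ρ)⁻¹‖ ≤ gr ρ) ∧
    (max 1 ‖(ee 2 ρ)⁻¹‖ * ‖(ee 0 ρ)⁻¹‖ ≤ gr ρ ∧ max 1 ‖(ee 2 ρ)⁻¹‖ * ‖(ee 1 ρ)⁻¹‖ ≤ gr ρ) := by
  obtain ⟨⟨a0, a1, a2⟩, b0, b1, b2⟩ := norm_le_gr ρ
  obtain ⟨p1, p2, p3⟩ := inv_mul_inv ρ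
  refine ⟨⟨?_, ?_⟩, ⟨?_, ?_⟩, ?_, ?_⟩
  · exact max_mul_le_gr ρ b1 (by rwa [p1])
  · exact max_mul_le_gr ρ b2 (by rwa [p2])
  · exact max_mul_le_gr ρ b0 (by rwa [mul_comm, p1])
  · exact max_mul_le_gr ρ b2 (by rwa [p3])
  · exact max_mul_le_gr ρ b0 (by rwa [mul_comm, p2])
  · exact max_mul_le_gr ρ b1 (by rwa [mul_comm, p3])

lemma max_inv_mul_self_le (ρ : ℂ) :
    max 1 ‖(ee 0 ρ)⁻¹‖ * ‖ee 0 ρ‖ ≤ gr ρ ∧ max 1 ‖(ee 1 ρ)⁻¹‖ * ‖ee 1 ρ‖ ≤ gr ρ ∧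
      max 1 ‖(ee 2 ρ)⁻¹‖ * ‖ee 2 ρ‖ ≤ gr ρ := by
  obtain ⟨⟨a0, a1, a2⟩, b0, b1, b2⟩ := norm_le_gr ρ
  have h1 := one_le_gr ρ
  refine ⟨max_mul_le_gr ρ a0 ?_, max_mul_le_gr ρ a1 ?_, max_mul_le_gr ρ a2 ?_⟩ <;>
  · rw [inv_mul_cancel₀ (ee_ne_zero _ _), norm_one]; exact h1

lemma max_inv_le (ρ : ℂ) : max 1 ‖(ee 0 ρ)⁻¹‖ ≤ gr ρ ∧ max 1 ‖(ee 1 ρ)⁻¹‖ ≤ gr ρ ∧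
    max 1 ‖(ee 2 ρ)⁻¹‖ ≤ gr ρ := by
  obtain ⟨-, b0, b1, b2⟩ := norm_le_gr ρ
  have h1 := one_le_gr ρ
  exact ⟨max_le h1 b0, max_le h1 b1, max_le h1 b2⟩

/-- A product `f̂ · v` is small if `v` is a sum of four terms, each compensated by the
exponential that bounds `f̂`. -/
lemma norm_mul_le_four {F v : ℂ} {m δ G v₁ v₂ v₃ v₄ : ℝ} (hF : ‖F‖ ≤ δ * m) (hδ : 0 ≤ δ)
    (hv : ‖v‖ ≤ v₁ + v₂ + v₃ + v₄) (h1 : m * v₁ ≤ G) (h2 : m * v₂ ≤ G) (h3 : m * v₃ ≤ G)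
    (h4 : m * v₄ ≤ G) : ‖F * v‖ ≤ 4 * δ * G := by
  rw [norm_mul]
  have hm : 0 ≤ δ * m := (norm_nonneg _).trans hF
  calc ‖F‖ * ‖v‖ ≤ δ * m * (v₁ + v₂ + v₃ + v₄) := by gcongr
    _ = δ * (m * v₁ + m * v₂ + m * v₃ + m * v₄) := by ring
    _ ≤ δ * (G + G + G + G) := by gcongr
    _ = _ := by ring

lemma norm_mul_le_one {x u : ℂ} (hx : ‖x‖ ≤ 1) : ‖x * u‖ ≤ ‖u‖ := norm_mul_le_of_le_one hx le_rfl

lemma norm_sum_three_le {G : ℝ} {u v w : ℂ} (hu : ‖u‖ ≤ G) (hv : ‖v‖ ≤ G) (hw : ‖w‖ ≤ G) :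
    ‖u + v + w‖ ≤ 3 * G := by
  have h1 := norm_add_le (u + v) w
  have h2 := norm_add_le u v
  linarith

lemma norm_sub_sub_le {x y p q r s : ℂ} (hx : ‖x‖ ≤ 1) (hy : ‖y‖ ≤ 1) :
    ‖x * (p - q) - y * (r - s)‖ ≤ ‖p‖ + ‖q‖ + ‖r‖ + ‖s‖ := by
  have h1 := norm_sub_le (x * (p - q)) (y * (r - s))
  have h2 := norm_mul_le_one (u := p - q) hx
  have h3 := norm_mul_le_one (u := r - s) hy
  have h4 := norm_sub_le p q
  have h5 := norm_sub_le r s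
  linarith

variable (ha : ‖a‖ = 1) (hβ : β ∈ Set.Ioo (0 : ℝ) 1) (hδ : 0 ≤ δ)
  (h0 : ‖fourier f ρ‖ ≤ δ * max 1 ‖(ee 0 ρ)⁻¹‖)
  (h1 : ‖fourier f (om * ρ)‖ ≤ δ * max 1 ‖(ee 1 ρ)⁻¹‖)
  (h2 : ‖fourier f (om ^ 2 * ρ)‖ ≤ δ * max 1 ‖(ee 2 ρ)⁻¹‖)

include ha hδ h0 h1 h2 in
/-- The bounds on the Cramer determinants: `f̂(ω^r ρ)` is at most `δ max(1, |e_r⁻¹|)`, and it is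
multiplied by exponentials which together with this maximum stay below the growth scale. -/
lemma norm_cramerDet_two_le : ‖cramerDet a β f ρ 2‖ ≤ 12 * δ * gr ρ := by
  obtain ⟨⟨m01, m02⟩, ⟨m10, m12⟩, m20, m21⟩ := max_inv_mul_inv_le ρ
  have hg : 0 ≤ gr ρ := zero_le_one.trans (one_le_gr ρ)
  rw [cramerDet_two, norm_mul, norm_pow, ha, one_pow, one_mul]
  have key : ∀ u v : ℂ, ‖u - v‖ ≤ ‖u‖ + ‖v‖ + 0 + 0 := fun u v => by
    simpa using norm_sub_le u v
  refine (norm_sum_three_le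
    (norm_mul_le_four h0 hδ (key _ _) m02 m01 (by simpa) (by simpa))
    (norm_mul_le_four h1 hδ (key _ _) m10 m12 (by simpa) (by simpa))
    (norm_mul_le_four h2 hδ (key _ _) m21 m20 (by simpa) (by simpa))).trans_eq (by ring)

include ha hβ hδ h0 h1 h2 in
lemma norm_cramerDet_zero_le : ‖cramerDet a β f ρ 0‖ ≤ 12 * δ * ‖ρ‖ * gr ρ := by
  obtain ⟨⟨m01, m02⟩, ⟨m10, m12⟩, m20, m21⟩ := max_inv_mul_inv_le ρ
  obtain ⟨s0, s1, s2⟩ := max_inv_mul_self_le ρ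
  have hb := norm_beta_le hβ
  have hw : ‖om‖ ≤ 1 := norm_om.le
  have hw2 : ‖om ^ 2‖ ≤ 1 := by rw [norm_pow, norm_om, one_pow]
  have hone : ‖(1 : ℂ)‖ ≤ 1 := by simp
  have key : ∀ x y p q r : ℂ, ‖x‖ ≤ 1 → ‖y‖ ≤ 1 →
      ‖x * (p * β - q) - y * (r * β - q)‖ ≤ ‖p‖ + ‖q‖ + ‖r‖ + ‖q‖ := by
    intro x y p q r hx hy
    refine (norm_sub_sub_le hx hy).trans ?_
    rw [mul_comm p, mul_comm r]
    gcongr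
    · exact norm_mul_le_one hb
    · exact norm_mul_le_one hb
  have k1 := norm_mul_le_four h0 hδ (key (om ^ 2) om _ (ee 0 ρ) _ hw2 hw) m01 s0 m02 s0
  have k2 := norm_mul_le_four h1 hδ (key 1 (om ^ 2) _ (ee 1 ρ) _ hone hw2) m12 s1 m10 s1
  have k3 := norm_mul_le_four h2 hδ (key om 1 _ (ee 2 ρ) _ hw hone) m20 s2 m21 s2
  rw [one_mul] at k2 k3
  have h := norm_sum_three_le k1 k2 k3
  rw [cramerDet_zero, norm_mul, norm_mul, norm_mul, norm_pow, ha, Complex.norm_I, one_pow, one_mul,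
    one_mul]
  calc _ ≤ ‖ρ‖ * (3 * (4 * δ * gr ρ)) := by gcongr
    _ = _ := by ring

include ha hβ hδ h0 h1 h2 in
lemma norm_cramerDet_one_le : ‖cramerDet a β f ρ 1‖ ≤ 12 * δ * ‖ρ‖ * gr ρ := by
  obtain ⟨⟨m01, m02⟩, ⟨m10, m12⟩, m20, m21⟩ := max_inv_mul_inv_le ρ
  obtain ⟨s0, s1, s2⟩ := max_inv_le ρ
  rw [← mul_one (max _ _)] at s0 s1 s2
  have hb := norm_beta_le hβ
  have hw : ‖om‖ ≤ 1 := norm_om.le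
  have hw2 : ‖om ^ 2‖ ≤ 1 := by rw [norm_pow, norm_om, one_pow]
  have hone : ‖(1 : ℂ)‖ ≤ 1 := by simp
  have key : ∀ x y p q : ℂ, ‖x‖ ≤ 1 → ‖y‖ ≤ 1 →
      ‖x * (β - p) - y * (β - q)‖ ≤ 1 + ‖p‖ + 1 + ‖q‖ := by
    intro x y p q hx hy
    refine (norm_sub_sub_le hx hy).trans ?_
    gcongr
  have k1 := norm_mul_le_four h0 hδ (key om (om ^ 2) _ _ hw hw2) s0 m01 s0 m02
  have k2 := norm_mul_le_four h1 hδ (key (om ^ 2) 1 _ _ hw2 hone) s1 m12 s1 m10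
  have k3 := norm_mul_le_four h2 hδ (key 1 om _ _ hone hw) s2 m20 s2 m21
  rw [one_mul] at k2 k3
  have h := norm_sum_three_le k1 k2 k3
  rw [cramerDet_one, norm_mul, norm_mul, norm_mul, norm_neg, norm_pow, ha, Complex.norm_I, one_pow,
    one_mul, one_mul]
  calc _ ≤ ‖ρ‖ * (3 * (4 * δ * gr ρ)) := by gcongr
    _ = _ := by ring

include ha hβ hδ h0 h1 h2 in
lemma norm_numPlus_le (j : Fin 3) : ‖numPlus a β f j ρ‖ ≤ 12 * δ * ‖ρ‖ * gr ρ := by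
  have hg : 0 ≤ gr ρ := zero_le_one.trans (one_le_gr ρ)
  fin_cases j
  · simp [numPlus]; positivity
  · have h := norm_cramerDet_two_le (β := β) ha hδ h0 h1 h2
    have hb := norm_beta_le hβ
    simp only [numPlus, Fin.mk_one, coeff_one, Matrix.cons_val_one, Matrix.cons_val_zero]
    rw [norm_mul, norm_mul, ha, one_mul]
    calc _ ≤ ‖ρ‖ * (12 * δ * gr ρ) := by
          gcongr
          exact (norm_mul_le_one hb).trans h
      _ = _ := by ring
  · have h := norm_cramerDet_zero_le ha hβ hδ h0 h1 h2
    have e : numPlus a β f 2 ρ = -a * Complex.I * cramerDet a β f ρ 0 := by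
      simp [numPlus, coeff_two]
    change ‖numPlus a β f 2 ρ‖ ≤ _
    rw [e, norm_mul, norm_mul, norm_neg, ha, Complex.norm_I, one_mul, one_mul]
    exact h

include ha hβ hδ h0 h1 h2 in
lemma norm_numMinus_le (j : Fin 3) : ‖numMinus a β f j ρ‖ ≤ 12 * δ * ‖ρ‖ * gr ρ := by
  have hg : 0 ≤ gr ρ := zero_le_one.trans (one_le_gr ρ)
  fin_cases j
  · simp [numMinus]; positivity
  · have h := norm_cramerDet_two_le (β := β) ha hδ h0 h1 h2
    simp only [numMinus, Fin.mk_one, coeff_one, Matrix.cons_val_one, Matrix.cons_val_zero]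
    rw [norm_mul, norm_mul, ha, one_mul]
    calc _ ≤ ‖ρ‖ * (12 * δ * gr ρ) := by gcongr
      _ = _ := by ring
  · have h := norm_cramerDet_one_le ha hβ hδ h0 h1 h2
    have e : numMinus a β f 2 ρ = -a * Complex.I * cramerDet a β f ρ 1 := by
      simp [numMinus, coeff_two]
    change ‖numMinus a β f 2 ρ‖ ≤ _
    rw [e, norm_mul, norm_mul, norm_neg, ha, Complex.norm_I, one_mul, one_mul]
    exact h

end NumeratorBounds

lemma differentiable_ee (r : ℕ) : Differentiable ℂ (ee r) := fun ρ =>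
  (hasDerivAt_ee r ρ).differentiableAt

lemma differentiable_ee_inv (r : ℕ) : Differentiable ℂ fun ρ => (ee r ρ)⁻¹ := fun ρ =>
  (hasDerivAt_ee_inv r ρ).differentiableAt

lemma differentiable_cramerDet (a : ℂ) (β : ℝ) {f : ℝ → ℂ} (hf : ContinuousOn f (Set.Icc 0 1))
    (l : Fin 3) : Differentiable ℂ fun ρ => cramerDet a β f ρ l := by
  have f0 := differentiable_fourier hf
  have f1 : Differentiable ℂ fun ρ => fourier f (om * ρ) :=
    f0.comp (differentiable_id.const_mul om)
  have f2 : Differentiable ℂ fun ρ => fourier f (om ^ 2 * ρ) :=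
    f0.comp (differentiable_id.const_mul (om ^ 2))
  have e0 := differentiable_ee 0
  have e1 := differentiable_ee 1
  have e2 := differentiable_ee 2
  have i0 := differentiable_ee_inv 0
  have i1 := differentiable_ee_inv 1
  have i2 := differentiable_ee_inv 2
  fin_cases l
  · simp only [Fin.zero_eta, cramerDet_zero]; fun_prop
  · simp only [Fin.mk_one, cramerDet_one]; fun_prop
  · simp only [Fin.reduceFinMk, cramerDet_two]; fun_prop

lemma differentiable_numPlus (a : ℂ) (β : ℝ) {f : ℝ → ℂ} (hf : ContinuousOn f (Set.Icc 0 1))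
    (j : Fin 3) : Differentiable ℂ (numPlus a β f j) := by
  have h0 := differentiable_cramerDet a β hf 0
  have h2 := differentiable_cramerDet a β hf 2
  unfold numPlus coeff
  fin_cases j
  · simp
  · simp; fun_prop
  · simp; fun_prop

lemma differentiable_numMinus (a : ℂ) (β : ℝ) {f : ℝ → ℂ} (hf : ContinuousOn f (Set.Icc 0 1))
    (j : Fin 3) : Differentiable ℂ (numMinus a β f j) := by
  have h1 := differentiable_cramerDet a β hf 1
  have h2 := differentiable_cramerDet a β hf 2
  unfold numMinus coeff
  fin_cases j
  · simp
  · simp; fun_prop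
  · simp; fun_prop

/-- The decay of the transform, in the form in which it enters the numerators. -/
lemma fourier_le_of_decay {f : ℝ → ℂ} {C : ℝ} {n : ℕ}
    (h : ∀ ρ : ℂ, ‖ρ‖ ^ n * ‖fourier f ρ‖ ≤ C * max 1 ‖Complex.exp (-Complex.I * ρ)‖)
    {ρ : ℂ} (hρ : ρ ≠ 0) (r : ℕ) :
    ‖fourier f (om ^ r * ρ)‖ ≤ C / ‖ρ‖ ^ n * max 1 ‖(ee r ρ)⁻¹‖ := by
  have h1 := h (om ^ r * ρ)
  rw [exp_neg_eq, norm_mul, norm_pow, norm_om, one_pow, one_mul] at h1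
  have hp : 0 < ‖ρ‖ ^ n := by have := norm_pos_iff.2 hρ; positivity
  rw [div_mul_eq_mul_div, le_div_iff₀ hp, mul_comm]
  exact h1

/-- A numerator of the size of the growth scale suffices, because away from the zeros the
determinant is larger by a factor of order `|ρ|`. -/
lemma decaysInD_of_norm_le {a : ℂ} (ha : ‖a‖ = 1) {β : ℝ} (hβ : β ∈ Set.Ioo (0 : ℝ) 1)
    {η : ℂ → ℂ} {C : ℝ} (h : ∀ ρ : ℂ, ρ ≠ 0 → ‖η ρ‖ ≤ C * gr ρ) :
    DecaysInD a β fun ρ => η ρ / ΔP a β ρ := by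
  intro ε hε
  obtain ⟨c, hc, R, hR⟩ := exists_norm_charF_ge hβ hε
  have hC : 0 ≤ C := by
    have h1 := (norm_nonneg _).trans (h 1 one_ne_zero)
    exact nonneg_of_mul_nonneg_left h1 (by linarith [one_le_gr 1])
  have ht : Tendsto (fun ρ : ℂ => C / (Real.sqrt 3 * c) * ‖ρ‖⁻¹)
      (Bornology.cobounded ℂ ⊓
      𝓟 {ρ : ℂ | (a * ρ ^ 3).re < 0 ∧ ∀ σ : ℂ, ΔP a β σ = 0 → ε ≤ dist ρ σ}) (𝓝 0) := by
    rw [← mul_zero (C / (Real.sqrt 3 * c))]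
    exact ((tendsto_inv_atTop_zero.comp tendsto_norm_cobounded_atTop).const_mul _).mono_left
      inf_le_left
  refine squeeze_zero_norm' ?_ ht
  have e1 : ∀ᶠ ρ : ℂ in Bornology.cobounded ℂ, max R 1 ≤ ‖ρ‖ :=
    tendsto_norm_cobounded_atTop.eventually_ge_atTop _
  filter_upwards [e1.filter_mono inf_le_left, mem_inf_of_right (mem_principal_self _)] with ρ h1 h2
  have hρ : 0 < ‖ρ‖ := lt_of_lt_of_le one_pos ((le_max_right _ _).trans h1)
  have h3 := hR ρ ((le_max_left _ _).trans h1) fun σ hσ => h2.2 σ ((ΔP_eq_zero_iff ha).2 hσ)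
  have hs : 0 < Real.sqrt 3 := by positivity
  have hg : 0 < gr ρ := zero_lt_one.trans_le (one_le_gr ρ)
  rw [norm_div, norm_ΔP ha]
  calc ‖η ρ‖ / (Real.sqrt 3 * ‖ρ‖ * ‖charF β ρ‖)
      ≤ C * gr ρ / (Real.sqrt 3 * ‖ρ‖ * (c * gr ρ)) := by
        gcongr
        exact h ρ (norm_pos_iff.1 hρ)
    _ = _ := by field_simp

/-- Both problems are well-conditioned: the ratios decay like `1/ρ` in the whole plane, away from
the zeros of the determinant. -/
lemma wellConditioned {a : ℂ} (ha : ‖a‖ = 1) {β : ℝ} (hβ : β ∈ Set.Ioo (0 : ℝ) 1) :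
    WellConditioned a β := by
  intro f hf j
  obtain ⟨C, hC, hd⟩ := exists_fourier_decay hf
  have hd' : ∀ ρ : ℂ, ‖ρ‖ ^ 1 * ‖fourier f ρ‖ ≤ C * max 1 ‖Complex.exp (-Complex.I * ρ)‖ := by
    simpa using hd
  have key : ∀ ρ : ℂ, ρ ≠ 0 → 12 * (C / ‖ρ‖ ^ 1) * ‖ρ‖ * gr ρ = 12 * C * gr ρ := by
    intro ρ hρ
    have := norm_pos_iff.2 hρ
    field_simp
  have hF : ∀ ρ : ℂ, ρ ≠ 0 → ‖fourier f ρ‖ ≤ C / ‖ρ‖ ^ 1 * max 1 ‖(ee 0 ρ)⁻¹‖ ∧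
      ‖fourier f (om * ρ)‖ ≤ C / ‖ρ‖ ^ 1 * max 1 ‖(ee 1 ρ)⁻¹‖ := fun ρ hρ =>
    ⟨by simpa using fourier_le_of_decay hd' hρ 0, by simpa using fourier_le_of_decay hd' hρ 1⟩
  refine ⟨⟨differentiable_numPlus a β hf.continuousOn j,
    decaysInD_of_norm_le ha hβ (C := 12 * C) fun ρ hρ => ?_⟩,
    differentiable_numMinus a β hf.continuousOn j,
    decaysInD_of_norm_le ha hβ (C := 12 * C) fun ρ hρ => ?_⟩
  · rw [← key ρ hρ]
    exact norm_numPlus_le ha hβ (by positivity) (hF ρ hρ).1 (hF ρ hρ).2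
      (fourier_le_of_decay hd' hρ 2) j
  · rw [← key ρ hρ]
    exact norm_numMinus_le ha hβ (by positivity) (hF ρ hρ).1 (hF ρ hρ).2
      (fourier_le_of_decay hd' hρ 2) j

/-! ### Residues and the convergent series -/

/-- The residue of a quotient at a simple zero of the denominator. -/
lemma residue_div {g h : ℂ → ℂ} (hg : Differentiable ℂ g) (hh : Differentiable ℂ h) {σ d : ℂ}
    (h0 : h σ = 0) (hd : HasDerivAt h d σ) (hd0 : d ≠ 0) :
    residue (fun z => g z / h z) σ = g σ / d := by
  set k := dslope h σ with hk
  have hkd : Differentiable ℂ k := by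
    intro z
    exact ((Complex.differentiableOn_dslope (s := Set.univ) univ_mem).2
      hh.differentiableOn).differentiableAt univ_mem
  have hkσ : k σ = d := by rw [hk, dslope_same, hd.deriv]
  have hne : ∀ᶠ z in 𝓝 σ, k z ≠ 0 :=
    hkd.continuous.continuousAt.eventually_ne (by rwa [hkσ])
  obtain ⟨ε, hε, hball⟩ := Metric.eventually_nhds_iff_ball.1 hne
  have hev : ∀ᶠ r in 𝓝[>] (0 : ℝ), (2 * Real.pi * Complex.I)⁻¹ * (∮ z in C(σ, r), g z / h z)
      = g σ / d := by
    filter_upwards [Ioo_mem_nhdsGT hε] with r hr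
    have hsub : ∀ z ∈ Metric.closedBall σ r, k z ≠ 0 := fun z hz =>
      hball z (lt_of_le_of_lt hz hr.2)
    have hdiff : DifferentiableOn ℂ (fun z => g z / k z) (Metric.closedBall σ r) :=
      fun z hz => ((hg z).div (hkd z) (hsub z hz)).differentiableWithinAt
    have hc := (hdiff.diffContOnCl_ball subset_rfl).circleIntegral_sub_inv_smul
      (Metric.mem_ball_self hr.1)
    have he : (∮ z in C(σ, r), g z / h z) = ∮ z in C(σ, r), (z - σ)⁻¹ • (g z / k z) := by
      refine circleIntegral.integral_congr hr.1.le fun z hz => ?_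
      have hz' : z - σ ≠ 0 := sub_ne_zero.2 (Metric.ne_of_mem_sphere hz hr.1.ne')
      have hkz := hsub z (Metric.sphere_subset_closedBall hz)
      have h1 : h z = (z - σ) * k z := by
        have := sub_smul_dslope h σ z
        rw [h0, sub_zero, smul_eq_mul] at this
        exact this.symm
      simp only [h1, smul_eq_mul]
      field_simp
    rw [he, hc, hkσ, smul_eq_mul, ← mul_assoc, inv_mul_cancel₀ Complex.two_pi_I_ne_zero, one_mul]
  refine Tendsto.limUnder_eq (Tendsto.congr' ?_ tendsto_const_nhds)
  filter_upwards [hev] with r hr using hr.symm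

lemma hasDerivAt_ΔP (a : ℂ) {β : ℝ} {σ : ℂ} (h0 : charF β σ = 0) :
    HasDerivAt (ΔP a β) (a ^ 3 * (om - om ^ 2) * σ * charF' β σ) σ := by
  have : ΔP a β = fun ρ => a ^ 3 * (om - om ^ 2) * ρ * charF β ρ := funext (ΔP_eq a β)
  rw [this]
  refine (((hasDerivAt_id σ).const_mul _).mul (hasDerivAt_charF β σ)).congr_deriv ?_
  simp [h0]

lemma differentiable_ΔP (a : ℂ) (β : ℝ) : Differentiable ℂ (ΔP a β) := by
  have : ΔP a β = fun ρ => a ^ 3 * (om - om ^ 2) * ρ * charF β ρ := funext (ΔP_eq a β)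
  rw [this]
  exact (differentiable_id.const_mul _).mul (differentiable_charF β)

lemma deriv_ΔP_ne_zero {a : ℂ} (ha : ‖a‖ = 1) {σ d : ℂ} (hσ : σ ≠ 0) (hd : d ≠ 0) :
    a ^ 3 * (om - om ^ 2) * σ * d ≠ 0 := by
  have ha0 : a ≠ 0 := fun h => by rw [h, norm_zero] at ha; exact zero_ne_one ha
  have h3 : om - om ^ 2 ≠ 0 := sub_ne_zero.2 om_pow_ne_one.2.2.symm
  exact mul_ne_zero (mul_ne_zero (mul_ne_zero (pow_ne_zero 3 ha0) h3) hσ) hd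

section Terms

variable {a : ℂ} {β : ℝ} {f : ℝ → ℂ} {σ : ℂ}

lemma termPlus_eq (ha : ‖a‖ = 1) (hf : ContinuousOn f (Set.Icc 0 1)) (hσ : σ ≠ 0)
    (h0 : charF β σ = 0) (hd : charF' β σ ≠ 0) (x t : ℝ) :
    termPlus a β f x t σ = Complex.I * (Complex.exp (Complex.I * σ * x - a * σ ^ 3 * t)
      * (∑ j : Fin 3, numPlus a β f j σ) / (a ^ 3 * (om - om ^ 2) * σ * charF' β σ)) := by
  have hn := differentiable_numPlus a β hf
  rw [termPlus, ← residue_div (h := ΔP a β)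
    (g := fun ρ => Complex.exp (Complex.I * ρ * x - a * ρ ^ 3 * t) * ∑ j, numPlus a β f j ρ)
    (by fun_prop) (differentiable_ΔP a β) ((ΔP_eq_zero_iff ha).2 h0) (hasDerivAt_ΔP a h0)
    (deriv_ΔP_ne_zero ha hσ hd)]
  simp only [div_mul_eq_mul_div]

lemma termMinus_eq (ha : ‖a‖ = 1) (hf : ContinuousOn f (Set.Icc 0 1)) (hσ : σ ≠ 0)
    (h0 : charF β σ = 0) (hd : charF' β σ ≠ 0) (x t : ℝ) :
    termMinus a β f x t σ = Complex.I * (Complex.exp (Complex.I * σ * (x - 1) - a * σ ^ 3 * t)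
      * (∑ j : Fin 3, numMinus a β f j σ) / (a ^ 3 * (om - om ^ 2) * σ * charF' β σ)) := by
  have hn := differentiable_numMinus a β hf
  rw [termMinus, ← residue_div (h := ΔP a β)
    (g := fun ρ => Complex.exp (Complex.I * ρ * (x - 1) - a * ρ ^ 3 * t)
      * ∑ j, numMinus a β f j ρ)
    (by fun_prop) (differentiable_ΔP a β) ((ΔP_eq_zero_iff ha).2 h0) (hasDerivAt_ΔP a h0)
    (deriv_ΔP_ne_zero ha hσ hd)]
  simp only [div_mul_eq_mul_div]

end Terms

lemma exists_index_of_occurrences_ne_zero {s : ℕ → ℂ} {ρ : ℂ} (h : occurrences s ρ ≠ 0) :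
    ∃ (k : ℕ) (j : Fin 3), 1 ≤ k ∧ om ^ (j : ℕ) * s k = ρ := by
  rw [occurrences, Set.encard_ne_zero] at h
  obtain ⟨p, hp⟩ := h
  exact ⟨p.2, p.1, hp.1, hp.2⟩

/-- The zeros are sparse enough for `∑ |σ|⁻²` to converge. -/
lemma summable_zeros_inv_sq {β : ℝ} (hβ : β ∈ Set.Ioo (0 : ℝ) 1) :
    Summable fun σ : {σ : ℂ | charF β σ = 0 ∧ σ ≠ 0} => (‖(σ : ℂ)‖ ^ 2)⁻¹ := by
  obtain ⟨N, lam, mu, hord, -, hbig⟩ := exists_zero_sequences hβ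
  set s : ℕ → ℝ := fun k => max (‖lam k‖ ^ 2)⁻¹ (‖mu k‖ ^ 2)⁻¹ with hs
  have hsum : Summable s := by
    refine Summable.of_norm_bounded_eventually_nat (Real.summable_nat_pow_inv.2 one_lt_two) ?_
    filter_upwards [eventually_gt_atTop (N + 1)] with k hk
    obtain ⟨-, hmu, hlow, -⟩ := hbig k (by omega)
    have h1 : ‖mu k‖ = ‖lam k‖ := by rw [hmu, norm_neg, RCLike.norm_conj]
    have h2 : (k : ℝ) ≤ ‖lam k‖ := by
      refine le_trans ?_ hlow.le
      rw [rad, Nat.cast_sub (by omega)]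
      have := Real.pi_gt_three
      have hk1 : (1 : ℝ) ≤ k := by exact_mod_cast (by omega : 1 ≤ k)
      push_cast
      nlinarith
    have hk0 : (0 : ℝ) < k := by exact_mod_cast (by omega : 0 < k)
    rw [hs]
    simp only [h1, max_self]
    rw [Real.norm_of_nonneg (by positivity)]
    gcongr
  have hsum2 : Summable fun p : ℕ × (Fin 3 × Bool) => s p.1 := by
    refine (summable_prod_of_nonneg fun p => ?_).2 ⟨fun k => Summable.of_finite, ?_⟩
    · exact le_max_of_le_left (by positivity)
    · simp only [tsum_fintype, Finset.sum_const]
      exact hsum.const_smul _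
  have hex : ∀ σ : {σ : ℂ | charF β σ = 0 ∧ σ ≠ 0}, ∃ p : ℕ × (Fin 3 × Bool),
      om ^ (p.2.1 : ℕ) * (if p.2.2 then lam p.1 else mu p.1) = σ := by
    rintro ⟨σ, h0, hσ⟩
    have h1 := hord σ hσ
    have h2 : analyticOrderAt (charF β) σ ≠ 0 :=
      analyticOrderAt_ne_zero.2 ⟨(differentiable_charF β).analyticAt σ, h0⟩
    rw [h1] at h2
    by_cases h3 : occurrences lam σ = 0
    · rw [h3, zero_add] at h2
      obtain ⟨k, j, -, h⟩ := exists_index_of_occurrences_ne_zero h2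
      exact ⟨(k, j, false), by simpa using h⟩
    · obtain ⟨k, j, -, h⟩ := exists_index_of_occurrences_ne_zero h3
      exact ⟨(k, j, true), by simpa using h⟩
  choose i hi using hex
  have hinj : Function.Injective i := fun σ τ h => Subtype.ext (by rw [← hi σ, ← hi τ, h])
  refine Summable.of_nonneg_of_le (fun σ => by positivity) (fun σ => ?_)
    (hsum2.comp_injective hinj)
  have h1 := congrArg norm (hi σ)
  rw [norm_mul, norm_pow, norm_om, one_pow, one_mul] at h1
  rw [← h1]
  simp only [Function.comp_apply, hs]
  split_ifs
  · exact le_max_left _ _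
  · exact le_max_right _ _

/-- A family over the zeros that is `O(|σ|⁻²)` at infinity is summable: only finitely many zeros
escape the bound. -/
lemma summable_of_bound_on_zeros {β : ℝ} (hβ : β ∈ Set.Ioo (0 : ℝ) 1) {Z : Set ℂ}
    (hZ : Z ⊆ {σ : ℂ | charF β σ = 0 ∧ σ ≠ 0}) {g : ℂ → ℂ} {C R : ℝ}
    (h : ∀ σ ∈ Z, R ≤ ‖σ‖ → ‖g σ‖ ≤ C * (‖σ‖ ^ 2)⁻¹) : Summable fun σ : Z => g σ := by
  have hs : Summable fun σ : Z => C * (‖(σ : ℂ)‖ ^ 2)⁻¹ :=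
    ((summable_zeros_inv_sq hβ).comp_injective (Set.inclusion_injective hZ)).mul_left C
  refine Summable.of_norm_bounded_eventually hs ?_
  obtain ⟨w, hw⟩ := exists_charF_ne_zero hβ
  have hfin := (finite_zeros (differentiable_charF β) hw R).preimage
    (f := ((↑) : Z → ℂ)) Subtype.val_injective.injOn
  refine hfin.subset fun σ hσ => ?_
  by_contra hnot
  refine hσ (h σ σ.2 ?_)
  by_contra! hlt
  exact hnot ⟨hlt, (hZ σ.2).1⟩

/-- The size of a term of the series: at a large zero the numerator is at most of order
`|σ|⁻¹` and the derivative of the denominator at least of order `|σ|`, on the growth scale. -/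
lemma exists_term_bound {a : ℂ} (ha : ‖a‖ = 1) {β : ℝ} (hβ : β ∈ Set.Ioo (0 : ℝ) 1) {f : ℝ → ℂ}
    (hf : ContDiffOn ℝ ∞ f (Set.Icc 0 1)) (hf0 : f 0 = 0) (hf1 : f 1 = 0) :
    ∃ C R : ℝ, ∀ σ : ℂ, σ ≠ 0 → charF β σ = 0 → R ≤ ‖σ‖ → charF' β σ ≠ 0 ∧
      ∀ e : ℂ, ‖e‖ ≤ 1 →
      ‖Complex.I * (e * (∑ j : Fin 3, numPlus a β f j σ)
        / (a ^ 3 * (om - om ^ 2) * σ * charF' β σ))‖ ≤ C * (‖σ‖ ^ 2)⁻¹ ∧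
      ‖Complex.I * (e * (∑ j : Fin 3, numMinus a β f j σ)
        / (a ^ 3 * (om - om ^ 2) * σ * charF' β σ))‖ ≤ C * (‖σ‖ ^ 2)⁻¹ := by
  obtain ⟨c, hc, R, hR⟩ := exists_norm_charF'_ge hβ
  obtain ⟨C, hC, hd⟩ := exists_fourier_decay_two hf hf0 hf1
  refine ⟨36 * C / (Real.sqrt 3 * c), R, fun σ hσ h0 hRσ => ?_⟩
  have hg : 0 < gr σ := zero_lt_one.trans_le (one_le_gr σ)
  have h1 := hR σ hRσ h0
  have hσ' := norm_pos_iff.2 hσ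
  have f0 : ‖fourier f σ‖ ≤ C / ‖σ‖ ^ 2 * max 1 ‖(ee 0 σ)⁻¹‖ := by
    simpa using fourier_le_of_decay hd hσ 0
  have f1 : ‖fourier f (om * σ)‖ ≤ C / ‖σ‖ ^ 2 * max 1 ‖(ee 1 σ)⁻¹‖ := by
    simpa using fourier_le_of_decay hd hσ 1
  have f2 := fourier_le_of_decay hd hσ 2
  have key : ∀ e S : ℂ, ‖e‖ ≤ 1 → ‖S‖ ≤ 3 * (12 * (C / ‖σ‖ ^ 2) * ‖σ‖ * gr σ) →
      ‖Complex.I * (e * S / (a ^ 3 * (om - om ^ 2) * σ * charF' β σ))‖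
        ≤ 36 * C / (Real.sqrt 3 * c) * (‖σ‖ ^ 2)⁻¹ := by
    intro e S he hS
    have hs : 0 < Real.sqrt 3 := by positivity
    rw [om_sub_sq, norm_mul, norm_div, norm_mul, norm_mul, norm_mul, norm_mul, norm_mul, norm_pow,
      ha, Complex.norm_I, one_pow, one_mul, one_mul, Complex.norm_real, one_mul,
      Real.norm_of_nonneg hs.le]
    calc ‖e‖ * ‖S‖ / (Real.sqrt 3 * ‖σ‖ * ‖charF' β σ‖)
        ≤ 1 * (3 * (12 * (C / ‖σ‖ ^ 2) * ‖σ‖ * gr σ)) / (Real.sqrt 3 * ‖σ‖ * (c * gr σ)) := by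
          gcongr
      _ = _ := by field_simp; ring
  refine ⟨fun h => ?_, fun e he => ⟨key e _ he ?_, key e _ he ?_⟩⟩
  · rw [h, norm_zero] at h1
    have := mul_pos hc hg
    linarith
  · rw [Fin.sum_univ_three]
    exact norm_sum_three_le (norm_numPlus_le ha hβ (by positivity) f0 f1 f2 0)
      (norm_numPlus_le ha hβ (by positivity) f0 f1 f2 1)
      (norm_numPlus_le ha hβ (by positivity) f0 f1 f2 2)
  · rw [Fin.sum_univ_three]
    exact norm_sum_three_le (norm_numMinus_le ha hβ (by positivity) f0 f1 f2 0)
      (norm_numMinus_le ha hβ (by positivity) f0 f1 f2 1)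
      (norm_numMinus_le ha hβ (by positivity) f0 f1 f2 2)

/-- The series converge absolutely as long as none of the time factors grows. -/
lemma seriesConverges {a : ℂ} (ha : ‖a‖ = 1) {β : ℝ} (hβ : β ∈ Set.Ioo (0 : ℝ) 1) {f : ℝ → ℂ}
    (hf : ContDiffOn ℝ ∞ f (Set.Icc 0 1)) (hf0 : f 0 = 0) (hf1 : f 1 = 0) {x t : ℝ}
    (hx : x ∈ Set.Icc (0 : ℝ) 1)
    (ht : ∀ σ : ℂ, σ ≠ 0 → charF β σ = 0 → 0 ≤ (a * σ ^ 3).re * t) :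
    SeriesConverges a β f x t := by
  obtain ⟨C, R, h⟩ := exists_term_bound ha hβ hf hf0 hf1
  constructor
  · have hZ : zerosPlus a β ⊆ {σ : ℂ | charF β σ = 0 ∧ σ ≠ 0} := fun σ hσ =>
      ⟨(ΔP_eq_zero_iff ha).1 hσ.1, fun h => by simpa [h] using hσ.2⟩
    refine summable_of_bound_on_zeros hβ hZ (C := C) (R := R) fun σ hσ hR => ?_
    obtain ⟨h0, hne⟩ := hZ hσ
    obtain ⟨h1, h2⟩ := h σ hne h0 hR
    rw [termPlus_eq ha hf.continuousOn hne h0 h1]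
    refine (h2 _ ?_).1
    rw [Complex.norm_exp, Real.exp_le_one_iff]
    have e : (Complex.I * σ * x - a * σ ^ 3 * t).re = -(σ.im * x) - (a * σ ^ 3).re * t := by
      rw [Complex.sub_re, Complex.re_mul_ofReal, Complex.re_mul_ofReal]; simp
    have := ht σ hne h0
    have := mul_nonneg hσ.2.le hx.1
    rw [e]; linarith
  · have hZ : zerosMinus a β ⊆ {σ : ℂ | charF β σ = 0 ∧ σ ≠ 0} := fun σ hσ =>
      ⟨(ΔP_eq_zero_iff ha).1 hσ.1, fun h => by simpa [h] using hσ.2⟩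
    refine summable_of_bound_on_zeros hβ hZ (C := C) (R := R) fun σ hσ hR => ?_
    obtain ⟨h0, hne⟩ := hZ hσ
    obtain ⟨h1, h2⟩ := h σ hne h0 hR
    rw [termMinus_eq ha hf.continuousOn hne h0 h1]
    refine (h2 _ ?_).2
    rw [Complex.norm_exp, Real.exp_le_one_iff]
    have e : (Complex.I * σ * (x - 1) - a * σ ^ 3 * t).re
        = -(σ.im * (x - 1)) - (a * σ ^ 3).re * t := by
      rw [← Complex.ofReal_one, ← Complex.ofReal_sub, Complex.sub_re, Complex.re_mul_ofReal,
        Complex.re_mul_ofReal]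
      simp
    have := ht σ hne h0
    have := mul_nonneg_of_nonpos_of_nonpos hσ.2.le (sub_nonpos.2 hx.2)
    rw [e]; linarith

/-! ### Biorthogonality of the eigenfunctions -/

/-- The pairing with the adjoint exponential solution in terms of the transform. -/
lemma integral_mul_efun_neg {f : ℝ → ℂ} (hf : ContinuousOn f (Set.Icc 0 1)) (ρ : ℂ) :
    (∫ x in (0 : ℝ)..1, f x * efun (-ρ) 0 x) =
      fourier f ρ * ((ee 2 ρ)⁻¹ - (ee 1 ρ)⁻¹) + fourier f (om * ρ) * ((ee 0 ρ)⁻¹ - (ee 2 ρ)⁻¹)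
      + fourier f (om ^ 2 * ρ) * ((ee 1 ρ)⁻¹ - (ee 0 ρ)⁻¹) := by
  have hi : ∀ τ c : ℂ, IntervalIntegrable
      (fun x : ℝ => Complex.exp (-Complex.I * τ * x) * f x * c) MeasureTheory.volume 0 1 :=
    fun τ c => (intervalIntegrable_exp_mul hf (by fun_prop)).mul_const c
  simp only [fourier, ← intervalIntegral.integral_mul_const]
  rw [← intervalIntegral.integral_add (hi _ _) (hi _ _),
    ← intervalIntegral.integral_add ((hi _ _).add (hi _ _)) (hi _ _)]
  refine intervalIntegral.integral_congr fun x _ => ?_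
  simp only [efun, ee_neg, pow_zero, mul_one, mul_neg, neg_mul]
  ring

/-- The third Cramer determinant is the pairing of `f` with an adjoint exponential solution. -/
lemma cramerDet_two_eq_integral (a : ℂ) (β : ℝ) {f : ℝ → ℂ} (hf : ContinuousOn f (Set.Icc 0 1))
    (ρ : ℂ) : cramerDet a β f ρ 2 = a ^ 2 * ∫ x in (0 : ℝ)..1, f x * efun (-ρ) 0 x := by
  rw [cramerDet_two, integral_mul_efun_neg hf]

lemma continuous_efun_real (ρ : ℂ) (n : ℕ) : Continuous fun x : ℝ => efun ρ n x :=
  continuous_iff_continuousAt.2 fun x => (hasDerivAt_efun_real ρ n x).continuousAt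

/-- Lagrange's identity, integrated: the boundary form reduces to `charF β ρ` because both
functions vanish at the end points and the second one satisfies the adjoint coupling condition. -/
lemma cube_sub_mul_integral {β : ℝ} {σ : ℂ} (h0 : charF β σ = 0) (ρ : ℂ) :
    (ρ ^ 3 - σ ^ 3) * (∫ x in (0 : ℝ)..1, efun (-σ) 0 x * efun ρ 0 x) =
      -(efun (-σ) 1 0 * (om - om ^ 2)) * (ρ * charF β ρ) := by
  have hd : ∀ x ∈ Set.uIcc (0 : ℝ) 1, HasDerivAt (fun x : ℝ => efun ρ 2 x * efun (-σ) 0 x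
      - efun ρ 1 x * efun (-σ) 1 x + efun ρ 0 x * efun (-σ) 2 x)
      (-Complex.I * (ρ ^ 3 - σ ^ 3) * (efun (-σ) 0 x * efun ρ 0 x)) x := by
    intro x _
    have a := hasDerivAt_efun_real ρ
    have b := hasDerivAt_efun_real (-σ)
    refine ((((a 2 x).mul (b 0 x)).sub ((a 1 x).mul (b 1 x))).add
      ((a 0 x).mul (b 2 x))).congr_deriv ?_
    rw [show 2 + 1 = 0 + 3 from rfl, efun_add_three, efun_add_three]
    simp only [Nat.reduceAdd]
    linear_combination (Complex.I * (ρ ^ 3 - σ ^ 3) * (efun (-σ) 0 x * efun ρ 0 x)) * Complex.I_sq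
  have h := intervalIntegral.integral_eq_sub_of_hasDerivAt hd (Continuous.intervalIntegrable
    (((continuous_efun_real _ _).mul (continuous_efun_real _ _)).const_mul _) _ _)
  rw [intervalIntegral.integral_const_mul] at h
  simp only [Complex.ofReal_one, Complex.ofReal_zero, efun_left, efun_right, efun_neg_one_right h0]
    at h
  have hc := efun_coupled β ρ
  linear_combination Complex.I * h + Complex.I * efun (-σ) 1 0 * hc
    + ((ρ ^ 3 - σ ^ 3) * (∫ x in (0 : ℝ)..1, efun (-σ) 0 x * efun ρ 0 x)
      + efun (-σ) 1 0 * (om - om ^ 2) * ρ * charF β ρ) * Complex.I_sq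

/-- Eigenfunctions and adjoint eigenfunctions belonging to different eigenvalues are orthogonal. -/
lemma integral_efun_mul_efun_eq_zero {β : ℝ} {σ ρ : ℂ} (h0 : charF β σ = 0) (h1 : charF β ρ = 0)
    (hne : ρ ^ 3 ≠ σ ^ 3) : (∫ x in (0 : ℝ)..1, efun (-σ) 0 x * efun ρ 0 x) = 0 := by
  have h := cube_sub_mul_integral h0 ρ
  rw [h1, mul_zero, mul_zero] at h
  exact (mul_eq_zero.1 h).resolve_left (sub_ne_zero.2 hne)

/-- The diagonal pairing, from the derivative at `ρ = σ` of the integrated Lagrange identity. -/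
lemma integral_efun_mul_efun_self {β : ℝ} {σ : ℂ} (hσ : σ ≠ 0) (h0 : charF β σ = 0) :
    3 * σ * (∫ x in (0 : ℝ)..1, efun (-σ) 0 x * efun σ 0 x) =
      -(efun (-σ) 1 0 * (om - om ^ 2)) * charF' β σ := by
  set G : ℂ → ℂ := fun ρ => ∫ x in (0 : ℝ)..1, efun (-σ) 0 x * efun ρ 0 x with hG
  have hGd : DifferentiableAt ℂ G σ := by
    have hc : ContinuousOn (fun x : ℝ => efun (-σ) 0 x) (Set.Icc 0 1) :=
      (continuous_efun_real _ _).continuousOn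
    have f0 := differentiable_fourier hc
    have e : G = fun ρ => fourier (fun x : ℝ => efun (-σ) 0 x) (-ρ) * (ee 2 ρ - ee 1 ρ)
        + fourier (fun x : ℝ => efun (-σ) 0 x) (om * -ρ) * (ee 0 ρ - ee 2 ρ)
        + fourier (fun x : ℝ => efun (-σ) 0 x) (om ^ 2 * -ρ) * (ee 1 ρ - ee 0 ρ) := by
      funext ρ
      have := integral_mul_efun_neg hc (-ρ)
      simpa only [neg_neg, ee_neg, inv_inv] using this
    rw [e]
    have f1 : Differentiable ℂ fun ρ => fourier (fun x : ℝ => efun (-σ) 0 x) (-ρ) :=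
      f0.comp differentiable_id.neg
    have f2 : Differentiable ℂ fun ρ => fourier (fun x : ℝ => efun (-σ) 0 x) (om * -ρ) :=
      f0.comp (differentiable_id.neg.const_mul om)
    have f3 : Differentiable ℂ fun ρ => fourier (fun x : ℝ => efun (-σ) 0 x) (om ^ 2 * -ρ) :=
      f0.comp (differentiable_id.neg.const_mul (om ^ 2))
    have e0 := differentiable_ee 0
    have e1 := differentiable_ee 1
    have e2 := differentiable_ee 2
    fun_prop
  -- Both sides of the Lagrange identity vanish at `ρ = σ`; comparing their derivatives there gives
  -- the claim after division by `σ`.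
  have hl := (((hasDerivAt_pow 3 σ).sub_const (σ ^ 3))).mul hGd.hasDerivAt
  have hr := ((hasDerivAt_id σ).mul (hasDerivAt_charF β σ)).const_mul
    (-(efun (-σ) 1 0 * (om - om ^ 2)))
  have heq := hl.unique (hr.congr_of_eventuallyEq
    (Filter.Eventually.of_forall fun ρ => cube_sub_mul_integral h0 ρ))
  simp only [h0, sub_self, zero_mul, add_zero, mul_zero, zero_add, id_eq] at heq
  refine mul_left_cancel₀ hσ ?_
  push_cast at heq
  linear_combination heq

/-! ### A sequence of zeros with rapidly growing exponents -/

/-- In the sector, `Re (iσ³) = -Im σ (3 (Re σ)² - (Im σ)²)` grows quadratically along zeros whose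
imaginary part stays below a negative constant. -/
lemma re_I_mul_cube_ge {σ : ℂ} (h : InSector σ) {L : ℝ} (hL : 0 ≤ L) (him : σ.im ≤ -L) :
    L / 2 * ‖σ‖ ^ 2 ≤ (Complex.I * σ ^ 3).re := by
  have e : (Complex.I * σ ^ 3).re = -σ.im * (3 * σ.re ^ 2 - σ.im ^ 2) := by
    simp [pow_succ]; ring
  have h3 : 3 * σ.im ^ 2 ≤ σ.re ^ 2 := by
    have hs : Real.sqrt 3 ^ 2 = 3 := Real.sq_sqrt (by norm_num)
    have h1 := pow_le_pow_left₀ (by positivity) h 2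
    rwa [mul_pow, hs, sq_abs] at h1
  rw [e, ← Complex.normSq_eq_norm_sq, Complex.normSq_apply]
  nlinarith [sq_nonneg σ.im]

/-- At a zero in the sector, the slope at `0` of the adjoint eigenfunction is bounded below:
one of the three exponentials dominates. -/
lemma norm_efun_neg_one_ge {σ : ℂ} (h : InSector σ) (him : σ.im ≤ 0) (hσ : 8 ≤ ‖σ‖) :
    Real.sqrt 3 * ‖σ‖ ≤ ‖efun (-σ) 1 0‖ := by
  have hre : 4 ≤ σ.re := by linarith [h.norm_le]
  obtain ⟨-, a2, -, a4⟩ := h.small_le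
  have hb : 3 * Real.exp |σ.im| ≤ ‖(ee 1 σ)⁻¹‖ := by
    have h3 : (3 : ℝ) ≤ Real.exp 2 := by linarith [Real.add_one_le_exp (2 : ℝ)]
    rw [norm_inv, norm_ee_one, ← Real.exp_neg]
    calc 3 * Real.exp |σ.im| ≤ Real.exp 2 * Real.exp |σ.im| := by gcongr
      _ = Real.exp (2 + |σ.im|) := (Real.exp_add _ _).symm
      _ ≤ _ := by
        rw [Real.exp_le_exp, abs_of_nonpos him]
        have h4 := h.three_mul_abs_le
        rw [abs_of_nonpos him] at h4
        nlinarith [sqrt_three_bounds.1]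
  have h1 : 1 ≤ Real.exp |σ.im| := Real.one_le_exp (abs_nonneg _)
  have hsum : 1 ≤ ‖(ee 0 σ)⁻¹ + om * (ee 1 σ)⁻¹ + om ^ 2 * (ee 2 σ)⁻¹‖ := by
    have e : om * (ee 1 σ)⁻¹ = ((ee 0 σ)⁻¹ + om * (ee 1 σ)⁻¹ + om ^ 2 * (ee 2 σ)⁻¹)
        - (ee 0 σ)⁻¹ - om ^ 2 * (ee 2 σ)⁻¹ := by ring
    have n1 := congrArg norm e
    have n2 := norm_sub_le (((ee 0 σ)⁻¹ + om * (ee 1 σ)⁻¹ + om ^ 2 * (ee 2 σ)⁻¹)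
        - (ee 0 σ)⁻¹) (om ^ 2 * (ee 2 σ)⁻¹)
    have n3 := norm_sub_le ((ee 0 σ)⁻¹ + om * (ee 1 σ)⁻¹ + om ^ 2 * (ee 2 σ)⁻¹) (ee 0 σ)⁻¹
    rw [norm_mul, norm_om, one_mul] at n1
    rw [norm_mul (om ^ 2), norm_pow, norm_om, one_pow, one_mul] at n2
    linarith
  rw [efun_one_left, om_sub_sq]
  simp only [ee_neg]
  rw [norm_mul, norm_mul, norm_mul, norm_mul, norm_neg, Complex.norm_I, Complex.norm_real, one_mul,
    one_mul, Real.norm_of_nonneg (Real.sqrt_nonneg 3), mul_comm ‖σ‖]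
  exact le_mul_of_one_le_right (by positivity) hsum

/-- A sequence of zeros of `charF β` in the sector and in the lower half plane, of strictly
increasing modulus, along which `Re (iσ³)` grows like `|σ|²` and the derivative of `charF β` is
bounded below. The constant `c` serves for both bounds. Distinct moduli guarantee distinct cubes,
that is, distinct eigenvalues. -/
structure GrowingZeros (β c : ℝ) (l : ℕ → ℂ) : Prop where
  pos : 0 < c
  zero : ∀ k, charF β (l k) = 0
  sector : ∀ k, InSector (l k)
  im_neg : ∀ k, (l k).im < 0
  norm_ge : ∀ k : ℕ, (k : ℝ) + 8 ≤ ‖l k‖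
  norm_strictMono : StrictMono fun k => ‖l k‖
  growth : ∀ k, c * ‖l k‖ ^ 2 ≤ (Complex.I * l k ^ 3).re
  deriv_ge : ∀ k, c ≤ ‖charF' β (l k)‖

lemma GrowingZeros.ne_zero {β c : ℝ} {l : ℕ → ℂ} (h : GrowingZeros β c l) (k : ℕ) : l k ≠ 0 := by
  intro h0
  have h1 := h.im_neg k
  simp [h0] at h1

/-- A tail of the sequence of zeros near `(2k - 1/3)π + i log β` qualifies, because `log β < 0`. -/
lemma exists_growingZeros {β : ℝ} (hβ : β ∈ Set.Ioo (0 : ℝ) 1) : ∃ c l, GrowingZeros β c l := by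
  have hlog : Real.log β < 0 := Real.log_neg hβ.1 hβ.2
  obtain ⟨N, lam, mu, -, hz, hbig⟩ := exists_zero_sequences hβ
  obtain ⟨c, hc, R, hR⟩ := exists_norm_charF'_ge hβ
  have ht : Tendsto (fun k : ℕ => 36 / β * Real.exp (-(Real.sqrt 3 * k * Real.pi / 2))) atTop
      (𝓝 (36 / β * 0)) := by
    refine Tendsto.const_mul _ (Real.tendsto_exp_neg_atTop_nhds_zero.comp ?_)
    have : (fun k : ℕ => Real.sqrt 3 * k * Real.pi / 2)
        = fun k : ℕ => (k : ℝ) * (Real.sqrt 3 * Real.pi / 2) := by ext; ring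
    rw [this]
    exact tendsto_natCast_atTop_atTop.atTop_mul_const (by have := Real.pi_pos; positivity)
  rw [mul_zero] at ht
  obtain ⟨K, hK⟩ := (ht.eventually (gt_mem_nhds
    (by linarith : (0 : ℝ) < -Real.log β / 2))).exists_forall_of_atTop
  obtain ⟨K', hK'⟩ := exists_nat_ge R
  set M := max K (max K' (N + 9)) with hM
  have m1 : K ≤ M := le_max_left _ _
  have m2 : K' ≤ M := (le_max_left _ _).trans (le_max_right _ _)
  have m3 : N + 9 ≤ M := (le_max_right _ _).trans (le_max_right _ _)
  have hnorm : ∀ k : ℕ, (k : ℝ) + M ≤ ‖lam (k + M)‖ := by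
    intro k
    have hlow := (hbig (k + M) (by omega)).2.2.1
    refine le_trans ?_ hlow.le
    rw [rad, Nat.cast_sub (by omega)]
    have := Real.pi_gt_three
    have hk1 : (1 : ℝ) ≤ (k + M : ℕ) := by exact_mod_cast (by omega : 1 ≤ k + M)
    push_cast at hk1 ⊢
    nlinarith
  have him : ∀ k, (lam (k + M)).im ≤ -(-Real.log β / 2) := by
    intro k
    have h1 := (hbig (k + M) (by omega)).2.2.2.2.2.2.trans (hK (k + M) (by omega)).le
    have h2 := (Complex.abs_im_le_norm _).trans h1
    have h3 : (lam (k + M) - ((asymRe (k + M) : ℂ) + Complex.I * Real.log β)).im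
        = (lam (k + M)).im - Real.log β := by
      rw [Complex.sub_im, Complex.add_im, Complex.ofReal_im, Complex.im_mul_ofReal]; simp
    rw [h3, abs_le] at h2
    linarith [h2.2]
  refine ⟨min c (-Real.log β / 4), fun k => lam (k + M), ?_, ?_, ?_, ?_, ?_, ?_, ?_, ?_⟩
  · exact lt_min hc (by linarith)
  · exact fun k => (hz (k + M) (by omega)).2.2.1
  · exact fun k => (hbig (k + M) (by omega)).1
  · exact fun k => (him k).trans_lt (by linarith)
  · intro k
    have h1 : (9 : ℝ) ≤ M := by exact_mod_cast (by omega : 9 ≤ M)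
    linarith [hnorm k]
  · refine strictMono_nat_of_lt_succ fun k => ?_
    have h1 := (hbig (k + M) (by omega)).2.2.2.1
    have h2 := (hbig (k + 1 + M) (by omega)).2.2.1
    rw [show k + 1 + M - 1 = k + M by omega] at h2
    exact h1.trans h2
  · intro k
    have h1 := re_I_mul_cube_ge (hbig (k + M) (by omega)).1 (by linarith) (him k)
    refine le_trans ?_ h1
    gcongr
    exact (min_le_right _ _).trans (by linarith)
  · intro k
    have h0 : (K' : ℝ) ≤ M := by exact_mod_cast m2
    have h1 := hR (lam (k + M)) (by have := hnorm k; have : (0 : ℝ) ≤ k := k.cast_nonneg; linarith)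
      (hz (k + M) (by omega)).2.2.1
    exact (min_le_left _ _).trans ((le_mul_of_one_le_right hc.le (one_le_gr _)).trans h1)

/-! ### The initial datum -/

lemma norm_ee_le (r : ℕ) (ρ : ℂ) : ‖ee r ρ‖ ≤ Real.exp ‖ρ‖ := by
  rw [ee]
  refine (Complex.norm_exp_le_exp_norm _).trans (Real.exp_le_exp.2 ?_)
  rw [norm_mul, norm_mul, norm_pow, norm_om, Complex.norm_I, one_pow, one_mul, one_mul]

lemma norm_efun_le (ρ : ℂ) (n : ℕ) {z : ℂ} {r : ℝ} (hz : ‖z‖ ≤ r) :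
    ‖efun ρ n z‖ ≤ 6 * ‖ρ‖ ^ n * Real.exp ((1 + r) * ‖ρ‖) := by
  have key : ∀ (p q : ℕ) (τ : ℂ), ‖τ‖ = ‖ρ‖ →
      ‖(ee p ρ - ee q ρ) * (Complex.I * τ) ^ n * Complex.exp (Complex.I * τ * z)‖
        ≤ 2 * ‖ρ‖ ^ n * Real.exp ((1 + r) * ‖ρ‖) := by
    intro p q τ hτ
    have h1 : ‖ee p ρ - ee q ρ‖ ≤ 2 * Real.exp ‖ρ‖ := by
      linarith [norm_sub_le (ee p ρ) (ee q ρ), norm_ee_le p ρ, norm_ee_le q ρ]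
    have h2 : ‖Complex.exp (Complex.I * τ * z)‖ ≤ Real.exp (r * ‖ρ‖) := by
      refine (Complex.norm_exp_le_exp_norm _).trans (Real.exp_le_exp.2 ?_)
      rw [norm_mul, norm_mul, Complex.norm_I, one_mul, hτ, mul_comm]
      gcongr
    rw [norm_mul, norm_mul, norm_pow, norm_mul, Complex.norm_I, one_mul, hτ]
    calc _ ≤ 2 * Real.exp ‖ρ‖ * ‖ρ‖ ^ n * Real.exp (r * ‖ρ‖) := by gcongr
      _ = 2 * ‖ρ‖ ^ n * (Real.exp ‖ρ‖ * Real.exp (r * ‖ρ‖)) := by ring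
      _ = _ := by rw [← Real.exp_add]; ring_nf
  have hw : ‖om * ρ‖ = ‖ρ‖ := by rw [norm_mul, norm_om, one_mul]
  have hw2 : ‖om ^ 2 * ρ‖ = ‖ρ‖ := by rw [norm_mul, norm_pow, norm_om, one_pow, one_mul]
  refine (norm_sum_three_le (key 2 1 ρ rfl) (key 0 2 _ hw) (key 1 0 _ hw2)).trans_eq (by ring)

/-- The `n`-th derivative of the superposition `∑_k e^{-4|σ_k|} φ_k` of the eigenfunctions at
the points `σ_k = l k`. -/
noncomputable def datum (l : ℕ → ℂ) (n : ℕ) (x : ℝ) : ℂ :=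
  ∑' k, (Real.exp (-4 * ‖l k‖) : ℂ) * efun (l k) n x

section Datum

variable {β c : ℝ} {l : ℕ → ℂ} (hl : GrowingZeros β c l)

/-- The coefficients `e^{-4|σ_k|}` outweigh the growth `e^{3|σ_k|}` of the eigenfunctions on
`|x| < 2`, so that the series may be differentiated on a neighbourhood of `[0,1]`. -/
lemma norm_datum_term_le (l : ℕ → ℂ) (n k : ℕ) {x : ℝ} (hx : x ∈ Set.Ioo (-2 : ℝ) 2) :
    ‖(Real.exp (-4 * ‖l k‖) : ℂ) * efun (l k) n x‖ ≤ 6 * (‖l k‖ ^ n * Real.exp (-‖l k‖)) := by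
  have hx' : ‖(x : ℂ)‖ ≤ 2 := by
    rw [Complex.norm_real, Real.norm_eq_abs, abs_le]; exact ⟨hx.1.le, hx.2.le⟩
  rw [norm_mul, Complex.norm_real, Real.norm_of_nonneg (Real.exp_pos _).le]
  calc _ ≤ Real.exp (-4 * ‖l k‖) * (6 * ‖l k‖ ^ n * Real.exp ((1 + 2) * ‖l k‖)) := by
        gcongr; exact norm_efun_le _ _ hx'
    _ = 6 * (‖l k‖ ^ n * (Real.exp (-4 * ‖l k‖) * Real.exp ((1 + 2) * ‖l k‖))) := by ring
    _ = _ := by rw [← Real.exp_add]; ring_nf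

include hl in
lemma summable_datum_bound (n : ℕ) :
    Summable fun k => 6 * (‖l k‖ ^ n * Real.exp (-‖l k‖)) := by
  have hg : Summable fun k : ℕ => 6 * (2 ^ n * (n.factorial : ℝ)) * Real.exp (-1 / 2) ^ k :=
    (summable_geometric_of_lt_one (Real.exp_pos _).le
      (by rw [← Real.exp_zero]; exact Real.exp_lt_exp.2 (by norm_num))).mul_left _
  refine Summable.of_nonneg_of_le (fun k => by positivity) (fun k => ?_) hg
  have h1 := Real.pow_div_factorial_le_exp (‖l k‖ / 2) (by positivity) n
  rw [div_le_iff₀ (by positivity), div_pow, div_le_iff₀ (by positivity)] at h1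
  have h2 : Real.exp (‖l k‖ / 2) * Real.exp (-‖l k‖) ≤ Real.exp (-1 / 2) ^ k := by
    rw [← Real.exp_add, ← Real.exp_nat_mul, Real.exp_le_exp]
    linarith [hl.norm_ge k]
  calc 6 * (‖l k‖ ^ n * Real.exp (-‖l k‖))
      ≤ 6 * ((Real.exp (‖l k‖ / 2) * n.factorial * 2 ^ n) * Real.exp (-‖l k‖)) := by gcongr
    _ = 6 * (2 ^ n * (n.factorial : ℝ)) * (Real.exp (‖l k‖ / 2) * Real.exp (-‖l k‖)) := by ring
    _ ≤ _ := by gcongr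

include hl in
lemma summable_datum_term (n : ℕ) {x : ℝ} (hx : x ∈ Set.Ioo (-2 : ℝ) 2) :
    Summable fun k => (Real.exp (-4 * ‖l k‖) : ℂ) * efun (l k) n x :=
  Summable.of_norm_bounded (summable_datum_bound hl n) fun k => norm_datum_term_le l n k hx

include hl in
lemma hasDerivAt_datum (n : ℕ) {x : ℝ} (hx : x ∈ Set.Ioo (-2 : ℝ) 2) :
    HasDerivAt (datum l n) (datum l (n + 1) x) x :=
  hasDerivAt_tsum_of_isPreconnected (summable_datum_bound hl (n + 1)) isOpen_Ioo
    isPreconnected_Ioo (fun k y _ => (hasDerivAt_efun_real (l k) n y).const_mul _)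
    (fun k _ hy => norm_datum_term_le l (n + 1) k hy) hx (summable_datum_term hl n hx) hx

lemma Icc_subset_Ioo_two {x : ℝ} (hx : x ∈ Set.Icc (0 : ℝ) 1) : x ∈ Set.Ioo (-2 : ℝ) 2 :=
  ⟨by linarith [hx.1], by linarith [hx.2]⟩

include hl in
lemma dx_datum (n : ℕ) {x : ℝ} (hx : x ∈ Set.Icc (0 : ℝ) 1) :
    dx n (datum l 0) x = datum l n x := by
  unfold dx
  induction n generalizing x with
  | zero => simp
  | succ n ih =>
    rw [iteratedDerivWithin_succ, derivWithin_congr (fun y hy => ih hy) (ih hx)]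
    exact (hasDerivAt_datum hl n (Icc_subset_Ioo_two hx)).hasDerivWithinAt.derivWithin
      (uniqueDiffOn_Icc zero_lt_one x hx)

include hl in
/-- Each eigenfunction satisfies the compatibility conditions of every order, since its third
derivative is a multiple of it. -/
lemma admissible_datum : Admissible β (datum l 0) where
  smooth := by
    refine contDiffOn_of_differentiableOn_deriv fun m _ => ?_
    have h : Set.EqOn (iteratedDerivWithin m (datum l 0) (Set.Icc 0 1)) (datum l m)
      (Set.Icc 0 1) := fun x hx => dx_datum hl m hx
    refine DifferentiableOn.congr (fun x hx => ?_) h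
    exact (hasDerivAt_datum hl m (Icc_subset_Ioo_two hx)).differentiableAt.differentiableWithinAt
  left m := by
    rw [dx_datum hl _ (by simp), datum]
    have h : ∀ ρ, efun ρ (3 * m) 0 = 0 := fun ρ => by
      have := efun_three_mul_add ρ m 0 0
      rwa [efun_left, mul_zero] at this
    simp [h]
  right m := by
    rw [dx_datum hl _ (by simp), datum]
    have h : ∀ ρ, efun ρ (3 * m) 1 = 0 := fun ρ => by
      have := efun_three_mul_add ρ m 0 1
      rwa [efun_right, mul_zero] at this
    simp [h]
  coupled m := by
    rw [dx_datum hl _ (by simp), dx_datum hl _ (by simp), datum, datum, ← tsum_mul_left]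
    congr 1
    funext k
    have h := efun_coupled β (l k)
    rw [hl.zero k, mul_zero, sub_eq_zero] at h
    rw [Complex.ofReal_zero, Complex.ofReal_one, efun_three_mul_add, efun_three_mul_add, h]
    ring

include hl in
lemma continuousOn_datum : ContinuousOn (datum l 0) (Set.Icc 0 1) := fun _ hx =>
  (hasDerivAt_datum hl 0 (Icc_subset_Ioo_two hx)).continuousAt.continuousWithinAt

include hl in
/-- By biorthogonality, pairing with an adjoint eigenfunction picks out one coefficient. -/
lemma integral_datum_mul_efun (j : ℕ) : (∫ x in (0 : ℝ)..1, datum l 0 x * efun (-l j) 0 x)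
    = (Real.exp (-4 * ‖l j‖) : ℂ) * ∫ x in (0 : ℝ)..1, efun (-l j) 0 x * efun (l j) 0 x := by
  have hB : ∀ x ∈ Set.uIoc (0 : ℝ) 1, ‖efun (-l j) 0 x‖ ≤ 6 * Real.exp (2 * ‖l j‖) := by
    intro x hx
    rw [Set.uIoc_of_le zero_le_one] at hx
    have h := norm_efun_le (-l j) 0 (z := x) (r := 1) (by
      rw [Complex.norm_real, Real.norm_of_nonneg hx.1.le]; exact hx.2)
    rw [norm_neg, pow_zero] at h
    exact h.trans_eq (by ring_nf)
  have hmem : ∀ x ∈ Set.uIoc (0 : ℝ) 1, x ∈ Set.Ioo (-2 : ℝ) 2 := by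
    intro x hx
    rw [Set.uIoc_of_le zero_le_one] at hx
    exact ⟨by linarith [hx.1], by linarith [hx.2]⟩
  have hsum := intervalIntegral.hasSum_integral_of_dominated_convergence
    (μ := MeasureTheory.volume) (a := (0 : ℝ)) (b := 1)
    (F := fun k x => (Real.exp (-4 * ‖l k‖) : ℂ) * efun (l k) 0 x * efun (-l j) 0 x)
    (f := fun x => datum l 0 x * efun (-l j) 0 x)
    (fun k _ => 6 * (‖l k‖ ^ 0 * Real.exp (-‖l k‖)) * (6 * Real.exp (2 * ‖l j‖)))
    (fun k => (((continuous_efun_real _ _).const_mul _).mul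
      (continuous_efun_real _ _)).aestronglyMeasurable)
    (fun k => MeasureTheory.ae_of_all _ fun x hx => by
      rw [norm_mul]
      gcongr
      · exact norm_datum_term_le l 0 k (hmem x hx)
      · exact hB x hx)
    (MeasureTheory.ae_of_all _ fun x _ => (summable_datum_bound hl 0).mul_right _)
    (by simp)
    (MeasureTheory.ae_of_all _ fun x hx =>
      ((summable_datum_term hl 0 (hmem x hx)).hasSum.mul_right _))
  have hterm : ∀ k, (∫ x in (0 : ℝ)..1,
      (Real.exp (-4 * ‖l k‖) : ℂ) * efun (l k) 0 x * efun (-l j) 0 x)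
      = (Real.exp (-4 * ‖l k‖) : ℂ) * ∫ x in (0 : ℝ)..1, efun (-l j) 0 x * efun (l k) 0 x := by
    intro k
    rw [← intervalIntegral.integral_const_mul]
    refine intervalIntegral.integral_congr fun x _ => ?_
    ring
  simp only [hterm] at hsum
  refine hsum.unique (hasSum_single j fun k hk => ?_)
  rw [integral_efun_mul_efun_eq_zero (hl.zero j) (hl.zero k), mul_zero]
  intro hcube
  exact hk (hl.norm_strictMono.injective (norm_eq_of_cube_eq hcube))

include hl in
/-- The coefficients of the datum are not smaller than exponentially small. -/
lemma norm_integral_datum_ge (j : ℕ) : c * Real.exp (-4 * ‖l j‖)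
    ≤ ‖∫ x in (0 : ℝ)..1, datum l 0 x * efun (-l j) 0 x‖ := by
  rw [integral_datum_mul_efun hl, norm_mul, Complex.norm_real,
    Real.norm_of_nonneg (Real.exp_pos _).le, mul_comm]
  refine mul_le_mul_of_nonneg_left ?_ (Real.exp_pos _).le
  have h := congrArg norm (integral_efun_mul_efun_self (hl.ne_zero j) (hl.zero j))
  have h8 : (8 : ℝ) ≤ ‖l j‖ := by
    have := hl.norm_ge j
    have : (0 : ℝ) ≤ j := j.cast_nonneg
    linarith
  have h1 := norm_efun_neg_one_ge (hl.sector j) (hl.im_neg j).le h8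
  have hs : Real.sqrt 3 * Real.sqrt 3 = 3 := Real.mul_self_sqrt (by norm_num)
  rw [om_sub_sq, norm_mul, norm_mul, norm_mul, norm_neg, norm_mul, norm_mul, Complex.norm_I,
    Complex.norm_real, one_mul, Real.norm_of_nonneg (Real.sqrt_nonneg 3)] at h
  have h3 : ‖(3 : ℂ)‖ = 3 := by simp
  rw [h3] at h
  have h2 : 3 * ‖l j‖ * c ≤ ‖efun (-l j) 1 0‖ * Real.sqrt 3 * ‖charF' β (l j)‖ := by
    have hd := hl.deriv_ge j
    have hc := hl.pos
    calc 3 * ‖l j‖ * c = Real.sqrt 3 * ‖l j‖ * Real.sqrt 3 * c := by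
          linear_combination (-(‖l j‖ * c)) * hs
      _ ≤ _ := by gcongr
  rw [← h] at h2
  exact le_of_mul_le_mul_left h2 (by linarith)

end Datum

/-! ### Divergence of the series of the second problem -/

section AtZeros

variable {a : ℂ} {β : ℝ} {f : ℝ → ℂ} {σ : ℂ}

/-- At a zero of the determinant the two numerators are proportional. -/
lemma sum_numPlus_eq_mul_sum_numMinus (h0 : ΔP a β σ = 0) :
    ∑ j : Fin 3, numPlus a β f j σ = (ee 0 σ)⁻¹ * ∑ j : Fin 3, numMinus a β f j σ := by
  have h := cramer_row a β f σ 0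
  simp only [h0, zero_mul, Fin.val_zero, pow_zero, mul_one] at h
  simp only [Fin.sum_univ_three, numPlus, numMinus, coeff_one, coeff_two, Matrix.cons_val_zero,
    Matrix.cons_val_one, Matrix.cons_val, mul_zero, zero_add]
  linear_combination h

/-- At a zero of the determinant the numerators are determined by the third Cramer determinant. -/
lemma sum_numMinus_mul_sub (h0 : ΔP a β σ = 0) :
    (∑ j : Fin 3, numMinus a β f j σ) * ((ee 0 σ)⁻¹ - (ee 1 σ)⁻¹)
      = a * σ * cramerDet a β f σ 2 * ((1 - om) * (β - (ee 1 σ)⁻¹)) := by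
  have h := cramer_row a β f σ 0
  have h' := cramer_row a β f σ 1
  simp only [h0, zero_mul, Fin.val_zero, Fin.val_one, pow_zero, pow_one, mul_one] at h h'
  simp only [Fin.sum_univ_three, numMinus, coeff_one, coeff_two, Matrix.cons_val_zero,
    Matrix.cons_val_one, Matrix.cons_val, mul_zero, zero_add]
  linear_combination h' - h

end AtZeros

lemma norm_ee_inv_le (r : ℕ) (ρ : ℂ) : ‖(ee r ρ)⁻¹‖ ≤ Real.exp ‖ρ‖ := by
  have := norm_ee_le r (-ρ)
  rwa [ee_neg, norm_neg] at this

lemma norm_charF'_le {β : ℝ} (hβ : β ∈ Set.Ioo (0 : ℝ) 1) (ρ : ℂ) :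
    ‖charF' β ρ‖ ≤ 6 * Real.exp ‖ρ‖ := by
  have hb := norm_beta_le hβ
  have key : ∀ (r : ℕ) (w : ℂ), ‖w‖ ≤ 1 →
      ‖w * (ee r ρ - β * (ee r ρ)⁻¹)‖ ≤ 2 * Real.exp ‖ρ‖ := by
    intro r w hw
    refine norm_mul_le_of_le_one hw ?_
    have h1 := norm_sub_le (ee r ρ) (β * (ee r ρ)⁻¹)
    have h2 := norm_mul_le_of_le_one hb (norm_ee_inv_le r ρ)
    linarith [norm_ee_le r ρ]
  have h := norm_sum_three_le (key 0 1 (by simp)) (key 1 (om ^ 2) (by simp [norm_om]))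
    (key 2 om norm_om.le)
  rw [one_mul] at h
  rw [charF', norm_mul, Complex.norm_I, one_mul]
  linarith

lemma one_le_norm_one_sub_om : 1 ≤ ‖1 - om‖ := by
  have h : (1 - om).re = 3 / 2 := by rw [Complex.sub_re, om_re, Complex.one_re]; norm_num
  have := (le_abs_self _).trans (Complex.abs_re_le_norm (1 - om))
  linarith

/-- Terms growing like a Gaussian in the size of the zeros are unbounded. -/
lemma not_bddAbove_of_growth {Z : Set ℂ} {g : ℂ → ℂ} {s : ℕ → ℂ} {L : ℕ → ℝ} {B d : ℝ}
    (hB : 0 < B) (hd : 0 < d) (hL : ∀ k : ℕ, (k : ℝ) ≤ L k) (hs : ∀ k, s k ∈ Z)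
    (hg : ∀ᶠ k in atTop, B * Real.exp (d * L k ^ 2 - 8 * L k) ≤ ‖g (s k)‖) :
    ¬ BddAbove (Set.range fun σ : Z => ‖g σ‖) := by
  rintro ⟨M, hM⟩
  have hLt : Tendsto L atTop atTop := tendsto_atTop_mono hL tendsto_natCast_atTop_atTop
  have ht : Tendsto (fun k => B * Real.exp (L k * (d * L k - 8))) atTop atTop :=
    (Real.tendsto_exp_atTop.comp (hLt.atTop_mul_atTop₀
      (tendsto_atTop_add_const_right _ _ (hLt.const_mul_atTop hd)))).const_mul_atTop hB
  obtain ⟨k, hk1, hk2⟩ := (hg.and (ht.eventually_gt_atTop M)).exists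
  have h1 : ‖g (s k)‖ ≤ M := hM ⟨⟨s k, hs k⟩, rfl⟩
  rw [show L k * (d * L k - 8) = d * L k ^ 2 - 8 * L k by ring] at hk2
  linarith

section Divergence

variable {β c : ℝ} {l : ℕ → ℂ}

lemma GrowingZeros.eight_le (hl : GrowingZeros β c l) (k : ℕ) : 8 ≤ ‖l k‖ := by
  have := hl.norm_ge k
  have : (0 : ℝ) ≤ k := k.cast_nonneg
  linarith

lemma GrowingZeros.charF'_ne_zero (hl : GrowingZeros β c l) (k : ℕ) : charF' β (l k) ≠ 0 := by
  intro h
  have h1 := hl.deriv_ge k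
  rw [h, norm_zero] at h1
  linarith [hl.pos]

/-- A common lower bound for the modulus of a term of either series. -/
lemma norm_term_ge (hβ : β ∈ Set.Ioo (0 : ℝ) 1) {a e S σ : ℂ} (ha : ‖a‖ = 1) {A b : ℝ}
    (hσ : σ ≠ 0) (hd : charF' β σ ≠ 0)
    (he : Real.exp A ≤ ‖e‖) (hb : 0 ≤ b) (hS : b * ‖σ‖ * Real.exp (-6 * ‖σ‖) ≤ ‖S‖) :
    b / 12 * Real.exp (A - 7 * ‖σ‖)
      ≤ ‖Complex.I * (e * S / (a ^ 3 * (om - om ^ 2) * σ * charF' β σ))‖ := by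
  have hs : 0 < Real.sqrt 3 := by positivity
  have h3 : Real.sqrt 3 ≤ 2 := by linarith [sqrt_three_bounds.2]
  have hσ' := norm_pos_iff.2 hσ
  have hd' := norm_pos_iff.2 hd
  rw [om_sub_sq, norm_mul, norm_div, norm_mul, norm_mul, norm_mul, norm_mul, norm_mul, norm_pow,
    ha, Complex.norm_I, one_pow, one_mul, one_mul, Complex.norm_real, one_mul,
    Real.norm_of_nonneg hs.le, le_div_iff₀ (by positivity)]
  calc b / 12 * Real.exp (A - 7 * ‖σ‖) * (Real.sqrt 3 * ‖σ‖ * ‖charF' β σ‖)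
      ≤ b / 12 * Real.exp (A - 7 * ‖σ‖) * (2 * ‖σ‖ * (6 * Real.exp ‖σ‖)) := by
        gcongr; exact norm_charF'_le hβ σ
    _ = b * ‖σ‖ * (Real.exp (A - 7 * ‖σ‖) * Real.exp ‖σ‖) := by ring
    _ = b * ‖σ‖ * (Real.exp A * Real.exp (-6 * ‖σ‖)) := by
        rw [← Real.exp_add, ← Real.exp_add]; ring_nf
    _ = Real.exp A * (b * ‖σ‖ * Real.exp (-6 * ‖σ‖)) := by ring
    _ ≤ _ := by gcongr

lemma GrowingZeros.norm_cramerDet_ge (hl : GrowingZeros β c l) {a : ℂ} (ha : ‖a‖ = 1) (k : ℕ) :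
    c * Real.exp (-4 * ‖l k‖) ≤ ‖cramerDet a β (datum l 0) (l k) 2‖ := by
  rw [cramerDet_two_eq_integral a β (continuousOn_datum hl), norm_mul, norm_pow, ha, one_pow,
    one_mul]
  exact norm_integral_datum_ge hl k

/-- In the sector, `e^{-iωσ}` is large and `e^{-iω²σ}` is small. -/
lemma InSector.ee_inv_bounds {σ : ℂ} (h : InSector σ) (him : σ.im ≤ 0) (hσ : 8 ≤ ‖σ‖) :
    3 ≤ ‖(ee 1 σ)⁻¹‖ ∧ ‖(ee 2 σ)⁻¹‖ ≤ Real.exp (-‖σ‖ / 4) := by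
  have hn := h.norm_le
  have h4 := h.three_mul_abs_le
  rw [abs_of_nonpos him] at h4
  have h3 : (3 : ℝ) ≤ Real.exp 2 := by linarith [Real.add_one_le_exp (2 : ℝ)]
  rw [norm_inv, norm_inv, norm_ee_one, norm_ee_two, ← Real.exp_neg, ← Real.exp_neg]
  refine ⟨h3.trans ?_, ?_⟩ <;> rw [Real.exp_le_exp] <;> nlinarith [sqrt_three_bounds.1]

/-- The zeros `σ_k` lie in the lower half plane and give large terms of the second series. -/
lemma GrowingZeros.norm_sum_numMinus_ge (hl : GrowingZeros β c l) (hβ : β ∈ Set.Ioo (0 : ℝ) 1)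
    {a : ℂ} (ha : ‖a‖ = 1) (k : ℕ) :
    c / 2 * ‖l k‖ * Real.exp (-6 * ‖l k‖) ≤ ‖∑ j : Fin 3, numMinus a β (datum l 0) j (l k)‖ := by
  have h := congrArg norm (sum_numMinus_mul_sub (f := datum l 0)
    ((ΔP_eq_zero_iff ha).2 (hl.zero k)))
  rw [norm_mul, norm_mul, norm_mul, norm_mul, norm_mul, ha, one_mul] at h
  have h1 : ‖(ee 0 (l k))⁻¹ - (ee 1 (l k))⁻¹‖ ≤ 2 * Real.exp ‖l k‖ := by
    linarith [norm_sub_le (ee 0 (l k))⁻¹ (ee 1 (l k))⁻¹, norm_ee_inv_le 0 (l k),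
      norm_ee_inv_le 1 (l k)]
  have h2 : 1 ≤ ‖(β : ℂ) - (ee 1 (l k))⁻¹‖ := by
    have h3 := ((hl.sector k).ee_inv_bounds (hl.im_neg k).le (hl.eight_le k)).1
    have h4 := norm_sub_norm_le (ee 1 (l k))⁻¹ (β : ℂ)
    rw [norm_sub_rev] at h4
    linarith [norm_beta_le hβ]
  have h5 := hl.norm_cramerDet_ge ha k
  have h6 := one_le_norm_one_sub_om
  have hc := hl.pos
  set S := ‖∑ j : Fin 3, numMinus a β (datum l 0) j (l k)‖ with hS
  have h7 : ‖l k‖ * (c * Real.exp (-4 * ‖l k‖)) * (1 * 1) ≤ S * (2 * Real.exp ‖l k‖) := by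
    calc _ ≤ ‖l k‖ * ‖cramerDet a β (datum l 0) (l k) 2‖
          * (‖1 - om‖ * ‖(β : ℂ) - (ee 1 (l k))⁻¹‖) := by
          gcongr
      _ = S * ‖(ee 0 (l k))⁻¹ - (ee 1 (l k))⁻¹‖ := h.symm
      _ ≤ _ := by gcongr
  calc c / 2 * ‖l k‖ * Real.exp (-6 * ‖l k‖)
      ≤ c / 2 * ‖l k‖ * Real.exp (-4 * ‖l k‖ - ‖l k‖) := by
        gcongr; linarith [norm_nonneg (l k)]
    _ = ‖l k‖ * (c * Real.exp (-4 * ‖l k‖)) * (1 * 1) / (2 * Real.exp ‖l k‖) := by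
        rw [Real.exp_sub]; field_simp
    _ ≤ S := (div_le_iff₀ (by positivity)).2 h7

/-- The Cramer determinant for the rotation-invariant unknown is itself invariant. -/
lemma cramerDet_two_om (a : ℂ) (β : ℝ) (f : ℝ → ℂ) (ρ : ℂ) :
    cramerDet a β f (om * ρ) 2 = cramerDet a β f ρ 2 := by
  have h3 : ee 3 ρ = ee 0 ρ := ee_mod 0 ρ
  have e1 : om * (om * ρ) = om ^ 2 * ρ := by ring
  have e2 : om ^ 2 * (om * ρ) = ρ := by linear_combination ρ * om_cube
  rw [cramerDet_two, cramerDet_two]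
  simp only [ee_om, zero_add, Nat.reduceAdd, h3, e1, e2]
  ring

/-- The rotated zeros `ωσ_k` lie in the upper half plane and give large terms of the first series.
Once `e^{-iω²σ_k}` is small against `β`, the factor `β - e^{-iω²σ_k}` is harmless. -/
lemma GrowingZeros.norm_sum_numPlus_ge (hl : GrowingZeros β c l) (hβ : β ∈ Set.Ioo (0 : ℝ) 1)
    {a : ℂ} (ha : ‖a‖ = 1) {k : ℕ} (hk : Real.exp (-‖l k‖ / 4) ≤ β / 2) :
    β * c / 4 * ‖om * l k‖ * Real.exp (-6 * ‖om * l k‖)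
      ≤ ‖∑ j : Fin 3, numPlus a β (datum l 0) j (om * l k)‖ := by
  have h0 : ΔP a β (om * l k) = 0 := by
    rw [ΔP_eq_zero_iff ha, charF_om, hl.zero k, mul_zero]
  have h := congrArg norm (sum_numMinus_mul_sub (f := datum l 0) h0)
  rw [sum_numPlus_eq_mul_sum_numMinus h0]
  simp only [ee_om, zero_add, Nat.reduceAdd, norm_mul, norm_om, ha, one_mul, cramerDet_two_om]
    at h ⊢
  obtain ⟨b1, b2⟩ := (hl.sector k).ee_inv_bounds (hl.im_neg k).le (hl.eight_le k)
  have hβ0 := hβ.1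
  have h1 : ‖(ee 1 (l k))⁻¹ - (ee 2 (l k))⁻¹‖ ≤ 2 * ‖(ee 1 (l k))⁻¹‖ := by
    linarith [norm_sub_le (ee 1 (l k))⁻¹ (ee 2 (l k))⁻¹, hβ.2]
  have h2 : β / 2 ≤ ‖(β : ℂ) - (ee 2 (l k))⁻¹‖ := by
    have h4 := norm_sub_norm_le (β : ℂ) (ee 2 (l k))⁻¹
    rw [Complex.norm_real, Real.norm_of_nonneg hβ0.le] at h4
    linarith
  have h5 := hl.norm_cramerDet_ge ha k
  have h6 := one_le_norm_one_sub_om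
  have hc := hl.pos
  set S := ‖∑ j : Fin 3, numMinus a β (datum l 0) j (om * l k)‖ with hS
  have h7 : ‖l k‖ * (c * Real.exp (-4 * ‖l k‖)) * (1 * (β / 2))
      ≤ 2 * (‖(ee 1 (l k))⁻¹‖ * S) := by
    calc _ ≤ ‖l k‖ * ‖cramerDet a β (datum l 0) (l k) 2‖
          * (‖1 - om‖ * ‖(β : ℂ) - (ee 2 (l k))⁻¹‖) := by
          gcongr
      _ = S * ‖(ee 1 (l k))⁻¹ - (ee 2 (l k))⁻¹‖ := h.symm
      _ ≤ S * (2 * ‖(ee 1 (l k))⁻¹‖) := by gcongr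
      _ = _ := by ring
  calc β * c / 4 * ‖l k‖ * Real.exp (-6 * ‖l k‖)
      ≤ β * c / 4 * ‖l k‖ * Real.exp (-4 * ‖l k‖) := by
        gcongr; linarith [norm_nonneg (l k)]
    _ = ‖l k‖ * (c * Real.exp (-4 * ‖l k‖)) * (1 * (β / 2)) / 2 := by ring
    _ ≤ _ := by linarith

/-- With `a = -i` the time factors grow like a Gaussian in the size of the zeros, which no
exponentially small coefficient compensates. -/
lemma GrowingZeros.seriesDiverges (hl : GrowingZeros β c l) (hβ : β ∈ Set.Ioo (0 : ℝ) 1) {x t : ℝ}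
    (hx : x ∈ Set.Icc (0 : ℝ) 1) (ht : 0 < t) :
    SeriesDiverges (-Complex.I) β (datum l 0) x t := by
  have ha : ‖(-Complex.I : ℂ)‖ = 1 := by simp
  have hc := hl.pos
  have hβ0 := hβ.1
  have hL : ∀ k : ℕ, (k : ℝ) ≤ ‖l k‖ := fun k => by linarith [hl.norm_ge k]
  have hn : ∀ k, ‖om * l k‖ = ‖l k‖ := fun k => by rw [norm_mul, norm_om, one_mul]
  have hgrow : ∀ k, c * t * ‖l k‖ ^ 2 ≤ (Complex.I * l k ^ 3).re * t := fun k => by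
    have := mul_le_mul_of_nonneg_right (hl.growth k) ht.le
    linarith
  have hprod : ∀ (u : ℂ) (r : ℝ), r ∈ Set.Icc (0 : ℝ) 1 → |u.im * r| ≤ ‖u‖ := fun u r hr => by
    rw [abs_mul, abs_of_nonneg hr.1]
    exact (mul_le_of_le_one_right (abs_nonneg _) hr.2).trans (Complex.abs_im_le_norm u)
  constructor
  · refine not_bddAbove_of_growth (s := fun k => om * l k) (L := fun k => ‖l k‖)
      (B := β * c / 4 / 12) (d := c * t) (by positivity) (by positivity) hL (fun k => ⟨?_, ?_⟩) ?_
    · rw [ΔP_eq_zero_iff ha, charF_om, hl.zero k, mul_zero]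
    · have h1 : 0 ≤ (l k).re := (hl.sector k).re_nonneg
      have h2 := hl.im_neg k
      rw [Complex.mul_im, om_re, om_im]
      have := mul_nonneg (Real.sqrt_nonneg 3) h1
      linarith
    · have hLt : Tendsto (fun k => ‖l k‖) atTop atTop :=
        tendsto_atTop_mono hL tendsto_natCast_atTop_atTop
      have hsmall : ∀ᶠ k in atTop, Real.exp (-‖l k‖ / 4) ≤ β / 2 := by
        have h1 : Tendsto (fun k => Real.exp (-‖l k‖ / 4)) atTop (𝓝 0) := by
          have h2 := Real.tendsto_exp_neg_atTop_nhds_zero.comp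
            (hLt.atTop_div_const (by norm_num : (0 : ℝ) < 4))
          refine h2.congr fun k => ?_
          rw [Function.comp_apply, neg_div]
        exact (h1.eventually (gt_mem_nhds (half_pos hβ0))).mono fun k hk => hk.le
      filter_upwards [hsmall] with k hk
      have h0 : charF β (om * l k) = 0 := by rw [charF_om, hl.zero k, mul_zero]
      have hne : om * l k ≠ 0 := mul_ne_zero om_ne_zero (hl.ne_zero k)
      have hd : charF' β (om * l k) ≠ 0 := by
        rw [← norm_ne_zero_iff, norm_charF'_om]
        exact norm_ne_zero_iff.2 (hl.charF'_ne_zero k)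
      rw [termPlus_eq ha (continuousOn_datum hl) hne h0 hd]
      refine le_trans ?_ (norm_term_ge hβ ha (A := c * t * ‖l k‖ ^ 2 - ‖l k‖) hne hd ?_
        (by positivity) (hl.norm_sum_numPlus_ge hβ ha hk))
      · rw [hn]
        exact mul_le_mul_of_nonneg_left (Real.exp_le_exp.2 (by linarith)) (by positivity)
      · rw [Complex.norm_exp, Real.exp_le_exp, Complex.sub_re, Complex.re_mul_ofReal,
          Complex.re_mul_ofReal]
        have e : (-Complex.I * (om * l k) ^ 3).re = -(Complex.I * l k ^ 3).re := by
          rw [mul_pow, om_cube, one_mul, neg_mul, Complex.neg_re]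
        have e2 : (Complex.I * (om * l k)).re = -(om * l k).im := by
          rw [Complex.I_mul_re]
        rw [e, e2]
        have h3 := hprod (om * l k) x hx
        rw [hn, abs_le] at h3
        linarith [hgrow k, h3.1, h3.2]
  · refine not_bddAbove_of_growth (s := l) (L := fun k => ‖l k‖)
      (B := c / 2 / 12) (d := c * t) (by positivity) (by positivity) hL
      (fun k => ⟨(ΔP_eq_zero_iff ha).2 (hl.zero k), hl.im_neg k⟩) (Filter.Eventually.of_forall ?_)
    intro k
    have hne := hl.ne_zero k
    have hd := hl.charF'_ne_zero k
    rw [termMinus_eq ha (continuousOn_datum hl) hne (hl.zero k) hd]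
    refine le_trans ?_ (norm_term_ge hβ ha (A := c * t * ‖l k‖ ^ 2 - ‖l k‖) hne hd ?_
      (by positivity) (hl.norm_sum_numMinus_ge hβ ha k))
    · exact mul_le_mul_of_nonneg_left (Real.exp_le_exp.2 (by linarith)) (by positivity)
    · rw [Complex.norm_exp, Real.exp_le_exp, ← Complex.ofReal_one, ← Complex.ofReal_sub,
        Complex.sub_re, Complex.re_mul_ofReal, Complex.re_mul_ofReal]
      have e : (-Complex.I * l k ^ 3).re = -(Complex.I * l k ^ 3).re := by
        rw [neg_mul, Complex.neg_re]
      rw [e, Complex.I_mul_re]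
      have h3 := hprod (l k) (1 - x) ⟨by linarith [hx.2], by linarith [hx.1]⟩
      rw [abs_le] at h3
      linarith [hgrow k, h3.1, h3.2]

end Divergence

/-! ### Nonexistence of solutions of the second problem -/

lemma hasDerivAt_dx {u : ℝ → ℂ} (hu : ContDiffOn ℝ ∞ u (Set.Icc 0 1)) (n : ℕ) {x : ℝ}
    (hx : x ∈ Set.Ioo (0 : ℝ) 1) : HasDerivAt (dx n u) (dx (n + 1) u x) x := by
  have h := (hu.differentiableOn_iteratedDerivWithin (m := n)
    (by exact_mod_cast ENat.natCast_lt_top n) (uniqueDiffOn_Icc zero_lt_one)) x ⟨hx.1.le, hx.2.le⟩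
  unfold dx
  rw [iteratedDerivWithin_succ]
  exact h.hasDerivWithinAt.hasDerivAt (Icc_mem_nhds hx.1 hx.2)

lemma continuousOn_dx {u : ℝ → ℂ} (hu : ContDiffOn ℝ ∞ u (Set.Icc 0 1)) (n : ℕ) :
    ContinuousOn (dx n u) (Set.Icc 0 1) :=
  hu.continuousOn_iteratedDerivWithin (by exact_mod_cast le_top) (uniqueDiffOn_Icc zero_lt_one)

/-- Integrating by parts three times against an adjoint eigenfunction: all boundary terms cancel. -/
lemma integral_dx_three_mul_efun {β : ℝ} {σ : ℂ} (h0 : charF β σ = 0) {u : ℝ → ℂ}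
    (hu : ContDiffOn ℝ ∞ u (Set.Icc 0 1)) (hu0 : u 0 = 0) (hu1 : u 1 = 0)
    (hc : dx 1 u 0 = β * dx 1 u 1) :
    (∫ x in (0 : ℝ)..1, dx 3 u x * efun (-σ) 0 x)
      = -(Complex.I * σ ^ 3) * ∫ x in (0 : ℝ)..1, u x * efun (-σ) 0 x := by
  have hdx0 : dx 0 u = u := by funext x; simp [dx]
  have hw := fun n => continuousOn_dx hu n
  have hψ := fun n => (continuous_efun_real (-σ) n).continuousOn (s := Set.Icc (0 : ℝ) 1)
  have hcont : ContinuousOn (fun x : ℝ => dx 2 u x * efun (-σ) 0 x - dx 1 u x * efun (-σ) 1 x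
      + dx 0 u x * efun (-σ) 2 x) (Set.Icc 0 1) :=
    (((hw 2).mul (hψ 0)).sub ((hw 1).mul (hψ 1))).add ((hw 0).mul (hψ 2))
  have hd : ∀ x ∈ Set.Ioo (0 : ℝ) 1, HasDerivAt (fun x : ℝ => dx 2 u x * efun (-σ) 0 x
      - dx 1 u x * efun (-σ) 1 x + dx 0 u x * efun (-σ) 2 x)
      (dx 3 u x * efun (-σ) 0 x + (Complex.I * σ ^ 3) * (u x * efun (-σ) 0 x)) x := by
    intro x hx
    have a := fun n => hasDerivAt_dx hu n hx
    have b := fun n => hasDerivAt_efun_real (-σ) n x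
    refine ((((a 2).mul (b 0)).sub ((a 1).mul (b 1))).add ((a 0).mul (b 2))).congr_deriv ?_
    rw [show 2 + 1 = 0 + 3 from rfl, efun_add_three]
    simp only [Nat.reduceAdd, zero_add, hdx0]
    linear_combination -(Complex.I * σ ^ 3 * (u x * efun (-σ) 0 x)) * Complex.I_sq
  have i1 : IntervalIntegrable (fun x : ℝ => dx 3 u x * efun (-σ) 0 x)
      MeasureTheory.volume 0 1 := by
    apply ContinuousOn.intervalIntegrable
    rw [Set.uIcc_of_le zero_le_one]
    exact (hw 3).mul (hψ 0)
  have i2 : IntervalIntegrable (fun x : ℝ => u x * efun (-σ) 0 x) MeasureTheory.volume 0 1 := by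
    apply ContinuousOn.intervalIntegrable
    rw [Set.uIcc_of_le zero_le_one]
    exact hu.continuousOn.mul (hψ 0)
  have h := intervalIntegral.integral_eq_sub_of_hasDerivAt_of_le zero_le_one hcont hd
    (i1.add (i2.const_mul _))
  rw [intervalIntegral.integral_add i1 (i2.const_mul _), intervalIntegral.integral_const_mul] at h
  simp only [Complex.ofReal_one, Complex.ofReal_zero, efun_left, efun_right,
    efun_neg_one_right h0, hdx0, hu0, hu1, hc] at h
  linear_combination h

section Evolution

variable {β T : ℝ} {q₀ : ℝ → ℂ} {q : ℝ → ℝ → ℂ}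

lemma IsSolution.smooth_slice {a : ℂ} (hq : IsSolution a β T q₀ q) {t : ℝ}
    (ht : t ∈ Set.Icc (0 : ℝ) T) : ContDiffOn ℝ ∞ (fun x => q x t) (Set.Icc 0 1) :=
  hq.smooth.comp (contDiff_id.prodMk contDiff_const).contDiffOn fun _ hx => ⟨hx, ht⟩

lemma IsSolution.exists_norm_le {a : ℂ} (hq : IsSolution a β T q₀ q) :
    ∃ C : ℝ, ∀ x ∈ Set.Icc (0 : ℝ) 1, ∀ t ∈ Set.Icc (0 : ℝ) T, ‖q x t‖ ≤ C := by
  obtain ⟨C, hC⟩ := (isCompact_Icc.prod isCompact_Icc).exists_bound_of_continuousOn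
    hq.smooth.continuousOn
  exact ⟨C, fun x hx t ht => hC (x, t) ⟨hx, ht⟩⟩

/-- The time derivative exists and is bounded, uniformly in the space variable. -/
lemma IsSolution.exists_hasDerivWithinAt {a : ℂ} (hT : 0 < T) (hq : IsSolution a β T q₀ q) :
    ∃ C : ℝ, ∀ x ∈ Set.Icc (0 : ℝ) 1, ∀ t ∈ Set.Icc (0 : ℝ) T,
      HasDerivWithinAt (fun s => q x s) (derivWithin (fun s => q x s) (Set.Icc 0 T) t)
        (Set.Icc 0 T) t ∧ ‖derivWithin (fun s => q x s) (Set.Icc 0 T) t‖ ≤ C := by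
  set U : Set (ℝ × ℝ) := Set.Icc 0 1 ×ˢ Set.Icc 0 T with hU
  have hUd : UniqueDiffOn ℝ U := (uniqueDiffOn_Icc zero_lt_one).prod (uniqueDiffOn_Icc hT)
  have hcont := (hq.smooth.continuousOn_fderivWithin hUd (by simp)).clm_apply
    (continuousOn_const (c := ((0, 1) : ℝ × ℝ)))
  obtain ⟨C, hC⟩ := (isCompact_Icc.prod isCompact_Icc).exists_bound_of_continuousOn hcont
  refine ⟨C, fun x hx t ht => ?_⟩
  have h1 := (hq.smooth.differentiableOn (by simp) (x, t) ⟨hx, ht⟩).hasFDerivWithinAt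
  have h2 : HasDerivWithinAt (fun s : ℝ => (x, s)) ((0, 1) : ℝ × ℝ) (Set.Icc 0 T) t :=
    (hasDerivWithinAt_const t _ x).prodMk (hasDerivWithinAt_id t _)
  have h3 := h1.comp_hasDerivWithinAt t h2 (fun s hs => ⟨hx, hs⟩)
  have h4 := h3.derivWithin (uniqueDiffOn_Icc hT t ht)
  have h5 : derivWithin (fun s => q x s) (Set.Icc 0 T) t
      = fderivWithin ℝ (fun p : ℝ × ℝ => q p.1 p.2) U (x, t) (0, 1) := h4
  rw [h5]
  exact ⟨h3, hC (x, t) ⟨hx, ht⟩⟩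

/-- For a solution of the second problem the coefficient along an adjoint eigenfunction obeys
`y' = iσ³ y` in the interior of the time interval. -/
lemma IsSolution.hasDerivAt_integral (hT : 0 < T) (hq : IsSolution (-Complex.I) β T q₀ q) {σ : ℂ}
    (h0 : charF β σ = 0) {t : ℝ} (ht : t ∈ Set.Ioo (0 : ℝ) T) :
    HasDerivAt (fun t => ∫ x in (0 : ℝ)..1, q x t * efun (-σ) 0 x)
      (Complex.I * σ ^ 3 * ∫ x in (0 : ℝ)..1, q x t * efun (-σ) 0 x) t := by
  obtain ⟨C, hC⟩ := hq.exists_hasDerivWithinAt hT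
  obtain ⟨D, hD0, hD⟩ := exists_bound_of_continuousOn
    (continuous_efun_real (-σ) 0).continuousOn
  have hmem : ∀ x ∈ Set.uIoc (0 : ℝ) 1, x ∈ Set.Icc (0 : ℝ) 1 := fun x hx => by
    rw [Set.uIoc_of_le zero_le_one] at hx; exact ⟨hx.1.le, hx.2⟩
  have ht' : t ∈ Set.Icc (0 : ℝ) T := ⟨ht.1.le, ht.2.le⟩
  have hmeas : ∀ g : ℝ → ℂ, ContinuousOn g (Set.Icc 0 1) →
      IntervalIntegrable g MeasureTheory.volume 0 1 := fun g hg => by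
    apply ContinuousOn.intervalIntegrable
    rwa [Set.uIcc_of_le zero_le_one]
  have hψ := (continuous_efun_real (-σ) 0).continuousOn (s := Set.Icc (0 : ℝ) 1)
  have hslice : ∀ s ∈ Set.Icc (0 : ℝ) T,
      IntervalIntegrable (fun x : ℝ => q x s * efun (-σ) 0 x) MeasureTheory.volume 0 1 :=
    fun s hs => hmeas _ ((hq.smooth_slice hs).continuousOn.mul hψ)
  have hI3 : (-Complex.I) * (-Complex.I) ^ 3 = 1 := by
    linear_combination (Complex.I ^ 2 - 1) * Complex.I_sq
  have hpde : ∀ x ∈ Set.Icc (0 : ℝ) 1, derivWithin (fun s => q x s) (Set.Icc 0 T) t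
      = -dx 3 (fun y => q y t) x := fun x hx => by
    have h := hq.pde x hx t ht'
    linear_combination h - dx 3 (fun y => q y t) x * hI3
  have hd3 : IntervalIntegrable (fun x : ℝ => -dx 3 (fun y => q y t) x * efun (-σ) 0 x)
      MeasureTheory.volume 0 1 :=
    hmeas _ ((continuousOn_dx (hq.smooth_slice ht') 3).neg.mul hψ)
  have hmeas3 : MeasureTheory.AEStronglyMeasurable
      (fun x : ℝ => derivWithin (fun s => q x s) (Set.Icc 0 T) t * efun (-σ) 0 x)
      (MeasureTheory.volume.restrict (Set.uIoc 0 1)) := by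
    refine (intervalIntegrable_iff.1 hd3).aestronglyMeasurable.congr ?_
    refine (MeasureTheory.ae_restrict_iff' measurableSet_uIoc).2
      (MeasureTheory.ae_of_all _ fun x hx => ?_)
    simp only [hpde x (hmem x hx)]
  have h := intervalIntegral.hasDerivAt_integral_of_dominated_loc_of_deriv_le
    (μ := MeasureTheory.volume) (a := (0 : ℝ)) (b := 1) (x₀ := t) (s := Set.Ioo 0 T)
    (F := fun (s : ℝ) (x : ℝ) => q x s * efun (-σ) 0 x)
    (F' := fun (s : ℝ) (x : ℝ) => derivWithin (fun s => q x s) (Set.Icc 0 T) s * efun (-σ) 0 x)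
    (bound := fun _ => C * D) (Ioo_mem_nhds ht.1 ht.2)
    (by
      filter_upwards [Ioo_mem_nhds ht.1 ht.2] with s hs
      exact (intervalIntegrable_iff.1 (hslice s ⟨hs.1.le, hs.2.le⟩)).aestronglyMeasurable)
    (hslice t ht') hmeas3
    (MeasureTheory.ae_of_all _ fun x hx s hs => by
      have hb := (hC x (hmem x hx) s ⟨hs.1.le, hs.2.le⟩).2
      rw [norm_mul]
      exact mul_le_mul hb (hD x (hmem x hx)) (norm_nonneg _) ((norm_nonneg _).trans hb))
    (by simp)
    (MeasureTheory.ae_of_all _ fun x hx s hs =>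
      (((hC x (hmem x hx) s ⟨hs.1.le, hs.2.le⟩).1.hasDerivAt
        (Icc_mem_nhds hs.1 hs.2)).mul_const _))
  refine h.2.congr_deriv ?_
  have e : (∫ x in (0 : ℝ)..1, derivWithin (fun s => q x s) (Set.Icc 0 T) t * efun (-σ) 0 x)
      = -∫ x in (0 : ℝ)..1, dx 3 (fun y => q y t) x * efun (-σ) 0 x := by
    rw [← intervalIntegral.integral_neg]
    refine intervalIntegral.integral_congr fun x hx => ?_
    rw [Set.uIcc_of_le zero_le_one] at hx
    simp only [hpde x hx]
    ring
  rw [e, integral_dx_three_mul_efun h0 (hq.smooth_slice ht') (hq.left t ht') (hq.right t ht')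
    (hq.coupled t ht')]
  ring

/-- The coefficient is continuous up to the ends of the time interval. -/
lemma IsSolution.continuousOn_integral {a : ℂ} (hq : IsSolution a β T q₀ q) (σ : ℂ) :
    ContinuousOn (fun t => ∫ x in (0 : ℝ)..1, q x t * efun (-σ) 0 x) (Set.Icc 0 T) := by
  obtain ⟨C, hC⟩ := hq.exists_norm_le
  obtain ⟨D, hD0, hD⟩ := exists_bound_of_continuousOn
    (continuous_efun_real (-σ) 0).continuousOn
  have hmem : ∀ x ∈ Set.uIoc (0 : ℝ) 1, x ∈ Set.Icc (0 : ℝ) 1 := fun x hx => by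
    rw [Set.uIoc_of_le zero_le_one] at hx; exact ⟨hx.1.le, hx.2⟩
  have hψ := (continuous_efun_real (-σ) 0).continuousOn (s := Set.Icc (0 : ℝ) 1)
  intro t ht
  refine intervalIntegral.continuousWithinAt_of_dominated_interval (bound := fun _ => C * D)
    ?_ ?_ (by simp) (MeasureTheory.ae_of_all _ fun x hx => ?_)
  · filter_upwards [self_mem_nhdsWithin] with s hs
    refine (intervalIntegrable_iff.1 (ContinuousOn.intervalIntegrable ?_)).aestronglyMeasurable
    rw [Set.uIcc_of_le zero_le_one]
    exact (hq.smooth_slice hs).continuousOn.mul hψ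
  · filter_upwards [self_mem_nhdsWithin] with s hs
    refine MeasureTheory.ae_of_all _ fun x hx => ?_
    have hb := hC x (hmem x hx) s hs
    rw [norm_mul]
    exact mul_le_mul hb (hD x (hmem x hx)) (norm_nonneg _) ((norm_nonneg _).trans hb)
  · have h : ContinuousOn (fun s => q x s) (Set.Icc 0 T) :=
      hq.smooth.continuousOn.comp (continuous_const.prodMk continuous_id).continuousOn
        fun s hs => ⟨hmem x hx, hs⟩
    exact (h t ht).mul continuousWithinAt_const

/-- The coefficient at the final time, by integrating `y' = iσ³ y`. -/
lemma IsSolution.integral_final (hT : 0 < T) (hq : IsSolution (-Complex.I) β T q₀ q) {σ : ℂ}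
    (h0 : charF β σ = 0) : (∫ x in (0 : ℝ)..1, q x T * efun (-σ) 0 x)
      = Complex.exp (Complex.I * σ ^ 3 * T) * ∫ x in (0 : ℝ)..1, q₀ x * efun (-σ) 0 x := by
  set y : ℝ → ℂ := fun t => ∫ x in (0 : ℝ)..1, q x t * efun (-σ) 0 x with hy
  set z : ℝ → ℂ := fun t => Complex.exp (-(Complex.I * σ ^ 3 * t)) * y t with hz
  have hzc : ContinuousOn z (Set.Icc 0 T) :=
    (Continuous.continuousOn (by fun_prop)).mul (hq.continuousOn_integral σ)
  have hzd : ∀ t ∈ Set.Ioo (0 : ℝ) T, HasDerivAt z 0 t := by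
    intro t ht
    have h1 : HasDerivAt (fun t : ℝ => Complex.exp (-(Complex.I * σ ^ 3 * t)))
        (-(Complex.I * σ ^ 3) * Complex.exp (-(Complex.I * σ ^ 3 * t))) t := by
      have := (((hasDerivAt_id (t : ℂ)).const_mul (Complex.I * σ ^ 3)).neg.cexp).comp_ofReal
      refine this.congr_deriv ?_
      simp; ring
    refine (h1.mul (hq.hasDerivAt_integral hT h0 ht)).congr_deriv ?_
    change _ * y t + _ * (_ * y t) = 0
    ring
  have hconst : ∀ s ∈ Set.Ioo (0 : ℝ) T, z T = z s := fun s hs =>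
    constant_of_has_deriv_right_zero (hzc.mono (Set.Icc_subset_Icc_left hs.1.le))
      (fun t ht => (hzd t ⟨hs.1.trans_le ht.1, ht.2⟩).hasDerivWithinAt) T ⟨hs.2.le, le_rfl⟩
  have hlim : Tendsto z (𝓝[>] 0) (𝓝 (z 0)) :=
    (hzc 0 ⟨le_rfl, hT.le⟩).mono_left (nhdsWithin_le_of_mem (Icc_mem_nhdsGT hT))
  have hlim' : Tendsto z (𝓝[>] 0) (𝓝 (z T)) := by
    refine tendsto_const_nhds.congr' ?_
    filter_upwards [Ioo_mem_nhdsGT hT] with s hs using hconst s hs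
  have h := tendsto_nhds_unique hlim' hlim
  have hy0 : y 0 = ∫ x in (0 : ℝ)..1, q₀ x * efun (-σ) 0 x := by
    refine intervalIntegral.integral_congr fun x hx => ?_
    rw [Set.uIcc_of_le zero_le_one] at hx
    simp only [hq.initial x hx]
  simp only [hz, Complex.ofReal_zero, mul_zero, neg_zero, Complex.exp_zero, one_mul] at h
  rw [← hy0, ← h, ← mul_assoc, ← Complex.exp_add, add_neg_cancel, Complex.exp_zero, one_mul]

end Evolution

/-- The coefficients of a solution would have to grow like a Gaussian in the size of the zeros,
whereas those of a bounded function grow at most exponentially. -/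
lemma GrowingZeros.not_exists_isSolution {β c : ℝ} {l : ℕ → ℂ} (hl : GrowingZeros β c l) {T : ℝ}
    (hT : 0 < T) : ¬ ∃ q : ℝ → ℝ → ℂ, IsSolution (-Complex.I) β T (datum l 0) q := by
  rintro ⟨q, hq⟩
  obtain ⟨C, hC⟩ := hq.exists_norm_le
  have hC0 : 0 ≤ C := (norm_nonneg _).trans (hC 0 (by simp) 0 ⟨le_rfl, hT.le⟩)
  have hc := hl.pos
  have hupper : ∀ k, ‖∫ x in (0 : ℝ)..1, q x T * efun (-l k) 0 x‖
      ≤ C * (6 * Real.exp (2 * ‖l k‖)) := by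
    intro k
    have h := intervalIntegral.norm_integral_le_of_norm_le_const (a := (0 : ℝ)) (b := 1)
      (f := fun x : ℝ => q x T * efun (-l k) 0 x) (C := C * (6 * Real.exp (2 * ‖l k‖))) (by
        intro x hx
        rw [Set.uIoc_of_le zero_le_one] at hx
        have h1 := norm_efun_le (-l k) 0 (z := x) (r := 1) (by
          rw [Complex.norm_real, Real.norm_of_nonneg hx.1.le]; exact hx.2)
        rw [norm_neg, pow_zero, mul_one, one_add_one_eq_two] at h1
        rw [norm_mul]
        exact mul_le_mul (hC x ⟨hx.1.le, hx.2⟩ T ⟨hT.le, le_rfl⟩) h1 (norm_nonneg _) hC0)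
    simpa using h
  have hlower : ∀ k, c * Real.exp (c * T * ‖l k‖ ^ 2 - 4 * ‖l k‖)
      ≤ ‖∫ x in (0 : ℝ)..1, q x T * efun (-l k) 0 x‖ := by
    intro k
    rw [hq.integral_final hT (hl.zero k), norm_mul, Complex.norm_exp, Complex.re_mul_ofReal]
    have h1 := norm_integral_datum_ge hl k
    have h2 : c * T * ‖l k‖ ^ 2 ≤ (Complex.I * l k ^ 3).re * T := by
      have := mul_le_mul_of_nonneg_right (hl.growth k) hT.le
      linarith
    calc c * Real.exp (c * T * ‖l k‖ ^ 2 - 4 * ‖l k‖)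
        = Real.exp (c * T * ‖l k‖ ^ 2) * (c * Real.exp (-4 * ‖l k‖)) := by
          rw [sub_eq_add_neg, Real.exp_add, neg_mul]; ring
      _ ≤ _ := by gcongr
  have hLt : Tendsto (fun k => ‖l k‖) atTop atTop :=
    tendsto_atTop_mono (fun k : ℕ => by linarith [hl.norm_ge k]) tendsto_natCast_atTop_atTop
  have ht : Tendsto (fun k => c * Real.exp (‖l k‖ * (c * T * ‖l k‖ - 6))) atTop atTop :=
    (Real.tendsto_exp_atTop.comp (hLt.atTop_mul_atTop₀ (tendsto_atTop_add_const_right _ _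
      (hLt.const_mul_atTop (mul_pos hc hT))))).const_mul_atTop hc
  obtain ⟨k, hk⟩ := (ht.eventually_gt_atTop (6 * C)).exists
  have h1 := (hlower k).trans (hupper k)
  have h2 : Real.exp (c * T * ‖l k‖ ^ 2 - 4 * ‖l k‖)
      = Real.exp (‖l k‖ * (c * T * ‖l k‖ - 6)) * Real.exp (2 * ‖l k‖) := by
    rw [← Real.exp_add]; ring_nf
  rw [h2, ← mul_assoc, ← mul_assoc, mul_comm C 6] at h1
  exact absurd (le_of_mul_le_mul_right h1 (Real.exp_pos _)) (not_le.2 hk)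

/-! ### Orders of the zeros and asymptotics of the exponents -/

lemma analyticOrderAt_ΔP {a : ℂ} (ha : ‖a‖ = 1) (β : ℝ) {ρ : ℂ} (hρ : ρ ≠ 0) :
    analyticOrderAt (ΔP a β) ρ = analyticOrderAt (charF β) ρ := by
  have h : ΔP a β = (fun ρ => a ^ 3 * (om - om ^ 2) * ρ) * charF β := funext (ΔP_eq a β)
  have h1 : AnalyticAt ℂ (fun ρ => a ^ 3 * (om - om ^ 2) * ρ) ρ :=
    (differentiable_id.const_mul _).analyticAt ρ
  have h2 : a ^ 3 * (om - om ^ 2) * ρ ≠ 0 := by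
    simpa using deriv_ΔP_ne_zero ha hρ one_ne_zero
  rw [h, analyticOrderAt_mul h1 ((differentiable_charF β).analyticAt ρ),
    h1.analyticOrderAt_eq_zero.2 h2, zero_add]

lemma norm_cube_sub_cube_le {z w : ℂ} {e r : ℝ} (h : ‖z - w‖ ≤ e) (hz : ‖z‖ ≤ r) (hw : ‖w‖ ≤ r) :
    ‖z ^ 3 - w ^ 3‖ ≤ e * (3 * r ^ 2) := by
  have hr : 0 ≤ r := (norm_nonneg _).trans hz
  have e1 : z ^ 3 - w ^ 3 = (z - w) * (z * z + z * w + w * w) := by ring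
  have key : ∀ u v : ℂ, ‖u‖ ≤ r → ‖v‖ ≤ r → ‖u * v‖ ≤ r ^ 2 := fun u v hu hv => by
    rw [norm_mul, pow_two]; exact mul_le_mul hu hv (norm_nonneg _) hr
  rw [e1, norm_mul]
  exact mul_le_mul h (norm_sum_three_le (key _ _ hz hz) (key _ _ hz hw) (key _ _ hw hw))
    (norm_nonneg _) ((norm_nonneg _).trans h)

/-- Cubing the asymptotic form of a zero: the exponentially small error survives multiplication
by the square of the modulus. -/
lemma abs_re_I_mul_cube_add_le {β : ℝ} (hβ : β ∈ Set.Ioo (0 : ℝ) 1) {k : ℕ} (hk : 1 ≤ k) {z : ℂ}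
    (h1 : ‖z - ((asymRe k : ℂ) + Complex.I * Real.log β)‖ ≤ 1 / 10)
    (h2 : ‖z - ((asymRe k : ℂ) + Complex.I * Real.log β)‖
      ≤ 36 / β * Real.exp (-(Real.sqrt 3 * k * Real.pi / 2))) :
    |(Complex.I * z ^ 3).re + 3 * asymRe k ^ 2 * Real.log β|
      ≤ |Real.log β| ^ 3 + 216 / β * (8 + |Real.log β|) ^ 2 := by
  have hβ0 := hβ.1
  have hk1 : (1 : ℝ) ≤ k := by exact_mod_cast hk
  have hp := Real.pi_gt_three
  have hp4 := Real.pi_lt_d2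
  set L := Real.log β with hL
  set w : ℂ := (asymRe k : ℂ) + Complex.I * L with hw
  have hA0 : 0 ≤ asymRe k := by rw [asymRe]; exact mul_nonneg (by linarith) (by linarith)
  have hA1 : asymRe k ≤ 7 * k := by rw [asymRe]; nlinarith
  have hwn : ‖w‖ ≤ 7 * k + |L| := by
    have h3 := norm_add_le (asymRe k : ℂ) (Complex.I * L)
    rw [norm_mul, Complex.norm_I, one_mul, Complex.norm_real, Complex.norm_real,
      Real.norm_of_nonneg hA0, Real.norm_eq_abs] at h3
    linarith
  have hLk : |L| ≤ |L| * k := le_mul_of_one_le_right (abs_nonneg _) hk1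
  have hwr : ‖w‖ ≤ (8 + |L|) * k := by linarith
  have hzr : ‖z‖ ≤ (8 + |L|) * k := by
    have h3 := norm_sub_norm_le z w
    linarith
  have hexp : Real.exp (-(Real.sqrt 3 * k * Real.pi / 2)) * (k : ℝ) ^ 2 ≤ 2 := by
    have h3 := Real.pow_div_factorial_le_exp (k : ℝ) (by positivity) 2
    rw [div_le_iff₀ (by positivity)] at h3
    have h4 : Real.exp (-(Real.sqrt 3 * k * Real.pi / 2)) ≤ Real.exp (-k) := by
      rw [Real.exp_le_exp]
      have h5 := mul_le_mul sqrt_three_bounds.1.le hp.le (by norm_num) (Real.sqrt_nonneg 3)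
      nlinarith
    calc _ ≤ Real.exp (-k) * (Real.exp k * (2 : ℕ).factorial) := by gcongr
      _ = 2 := by
        rw [← mul_assoc, ← Real.exp_add, neg_add_cancel, Real.exp_zero]; norm_num
  have hcube := norm_cube_sub_cube_le h2 hzr hwr
  have hcube' : ‖z ^ 3 - w ^ 3‖ ≤ 216 / β * (8 + |L|) ^ 2 := by
    refine hcube.trans ?_
    calc _ = 108 / β * (8 + |L|) ^ 2 *
          (Real.exp (-(Real.sqrt 3 * k * Real.pi / 2)) * (k : ℝ) ^ 2) := by ring
      _ ≤ 108 / β * (8 + |L|) ^ 2 * 2 := by gcongr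
      _ = _ := by ring
  have hmain : (Complex.I * w ^ 3).re = -3 * asymRe k ^ 2 * L + L ^ 3 := by
    rw [hw]; simp [pow_succ]; ring
  have e : (Complex.I * z ^ 3).re + 3 * asymRe k ^ 2 * L
      = L ^ 3 + (Complex.I * (z ^ 3 - w ^ 3)).re := by
    rw [mul_sub, Complex.sub_re, hmain]; ring
  rw [e]
  refine (abs_add_le _ _).trans (add_le_add (abs_pow _ _).le ?_)
  refine (Complex.abs_re_le_norm _).trans ?_
  rwa [norm_mul, Complex.norm_I, one_mul]

lemma norm_eq_one_of_eq_I_or {a : ℂ} (h : a = Complex.I ∨ a = -Complex.I) : ‖a‖ = 1 := by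
  rcases h with rfl | rfl <;> simp

end ThirdOrderIBVP

open ThirdOrderIBVP in
theorem mainTheorem5 (β : ℝ) (hβ : β ∈ Set.Ioo (0 : ℝ) 1) :
    -- both problems are well-conditioned
    (WellConditioned Complex.I β ∧ WellConditioned (-Complex.I) β) ∧
    -- the zeros of the characteristic determinant, and the real parts of the exponents
    (∃ lam mu : ℕ → ℂ,
      (∀ a : ℂ, a = Complex.I ∨ a = -Complex.I →
        ΔP a β 0 = 0 ∧
        ∀ ρ : ℂ, ρ ≠ 0 →
          analyticOrderAt (ΔP a β) ρ = occurrences lam ρ + occurrences mu ρ) ∧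
      ((fun k : ℕ => lam k - ((asymRe k : ℂ) + Complex.I * Real.log β)) =O[atTop]
        fun k : ℕ => Real.exp (-(Real.sqrt 3 * k * Real.pi / 2))) ∧
      ((fun k : ℕ => mu k - (-(asymRe k : ℂ) + Complex.I * Real.log β)) =O[atTop]
        fun k : ℕ => Real.exp (-(Real.sqrt 3 * k * Real.pi / 2))) ∧
      ((fun k : ℕ => (-Complex.I * lam k ^ 3).re - 3 * asymRe k ^ 2 * Real.log β) =O[atTop]
        fun _ : ℕ => (1 : ℝ)) ∧
      ((fun k : ℕ => (-Complex.I * mu k ^ 3).re - 3 * asymRe k ^ 2 * Real.log β) =O[atTop]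
        fun _ : ℕ => (1 : ℝ)) ∧
      ((fun k : ℕ => (Complex.I * lam k ^ 3).re + 3 * asymRe k ^ 2 * Real.log β) =O[atTop]
        fun _ : ℕ => (1 : ℝ)) ∧
      ((fun k : ℕ => (Complex.I * mu k ^ 3).re + 3 * asymRe k ^ 2 * Real.log β) =O[atTop]
        fun _ : ℕ => (1 : ℝ)) ∧
      ∀ k : ℕ, 1 ≤ k →
        (-Complex.I * lam k ^ 3).re < 0 ∧ (-Complex.I * mu k ^ 3).re < 0 ∧
        0 < (Complex.I * lam k ^ 3).re ∧ 0 < (Complex.I * mu k ^ 3).re) ∧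
    -- both series converge at time zero, and that of the first problem at all later times
    (∀ q₀ : ℝ → ℂ, Admissible β q₀ → ∀ x ∈ Set.Icc (0 : ℝ) 1,
      SeriesConverges (-Complex.I) β q₀ x 0 ∧
      ∀ t : ℝ, 0 ≤ t → SeriesConverges Complex.I β q₀ x t) ∧
    -- the second problem: divergence for positive time, and no solution on any time interval
    (∃ q₀ : ℝ → ℂ, Admissible β q₀ ∧
      (∀ x ∈ Set.Icc (0 : ℝ) 1, ∀ t : ℝ, 0 < t → SeriesDiverges (-Complex.I) β q₀ x t) ∧
      ∀ T : ℝ, 0 < T → ¬ ∃ q : ℝ → ℝ → ℂ, IsSolution (-Complex.I) β T q₀ q) ∧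
    -- the second problem is ill-posed
    (∀ T : ℝ, 0 < T → IllPosed (-Complex.I) β T) := by
  have hI : ‖Complex.I‖ = 1 := Complex.norm_I
  have hnI : ‖(-Complex.I : ℂ)‖ = 1 := by simp
  have hdx0 : ∀ f : ℝ → ℂ, dx 0 f = f := fun f => by funext x; simp [dx]
  obtain ⟨c, l, hl⟩ := exists_growingZeros hβ
  have hnone : ∀ T : ℝ, 0 < T → ¬ ∃ q : ℝ → ℝ → ℂ, IsSolution (-Complex.I) β T (datum l 0) q :=
    fun T hT => hl.not_exists_isSolution hT
  refine ⟨⟨wellConditioned hI hβ, wellConditioned hnI hβ⟩, ?_, ?_,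
    ⟨datum l 0, admissible_datum hl, fun x hx t ht => hl.seriesDiverges hβ hx ht, hnone⟩, ?_⟩
  · obtain ⟨N, lam, mu, hord, hz, hbig⟩ := exists_zero_sequences hβ
    -- For large `k` the two sequences are mirror images of each other under `ρ ↦ -ρ̄`.
    have hmu : ∀ k, N < k → ‖mu k - (-(asymRe k : ℂ) + Complex.I * Real.log β)‖
        = ‖lam k - ((asymRe k : ℂ) + Complex.I * Real.log β)‖ := by
      intro k hk
      rw [(hbig k hk).2.1, ← RCLike.norm_conj (lam k - _), ← norm_neg]
      congr 1
      simp only [map_sub, map_add, map_mul, Complex.conj_ofReal, Complex.conj_I]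
      ring
    have hre : ∀ k, N < k → (Complex.I * mu k ^ 3).re = (Complex.I * lam k ^ 3).re := by
      intro k hk
      rw [(hbig k hk).2.1, Odd.neg_pow (by decide), ← map_pow, Complex.I_mul_re, Complex.I_mul_re,
        Complex.neg_im, Complex.conj_im, neg_neg]
    have hlam3 : (fun k : ℕ => (Complex.I * lam k ^ 3).re + 3 * asymRe k ^ 2 * Real.log β)
        =O[atTop] fun _ : ℕ => (1 : ℝ) := by
      refine IsBigO.of_bound (|Real.log β| ^ 3 + 216 / β * (8 + |Real.log β|) ^ 2) ?_
      filter_upwards [eventually_gt_atTop N] with k hk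
      rw [norm_one, mul_one]
      exact abs_re_I_mul_cube_add_le hβ (by omega) (hbig k hk).2.2.2.2.2.1 (hbig k hk).2.2.2.2.2.2
    have hmu3 : (fun k : ℕ => (Complex.I * mu k ^ 3).re + 3 * asymRe k ^ 2 * Real.log β)
        =O[atTop] fun _ : ℕ => (1 : ℝ) := by
      refine hlam3.congr' ?_ EventuallyEq.rfl
      filter_upwards [eventually_gt_atTop N] with k hk
      rw [hre k hk]
    refine ⟨lam, mu, fun a ha => ?_, ?_, ?_, ?_, ?_, hlam3, hmu3, fun k hk => ?_⟩
    · have ha1 := norm_eq_one_of_eq_I_or ha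
      exact ⟨(ΔP_eq_zero_iff ha1).2 (charF_zero β), fun ρ hρ => by
        rw [analyticOrderAt_ΔP ha1 β hρ, hord ρ hρ]⟩
    · refine IsBigO.of_bound (36 / β) ?_
      filter_upwards [eventually_gt_atTop N] with k hk
      rw [Real.norm_of_nonneg (Real.exp_pos _).le]
      exact (hbig k hk).2.2.2.2.2.2
    · refine IsBigO.of_bound (36 / β) ?_
      filter_upwards [eventually_gt_atTop N] with k hk
      rw [Real.norm_of_nonneg (Real.exp_pos _).le, hmu k hk]
      exact (hbig k hk).2.2.2.2.2.2
    · refine hlam3.neg_left.congr_left fun k => ?_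
      rw [neg_mul, Complex.neg_re]; ring
    · refine hmu3.neg_left.congr_left fun k => ?_
      rw [neg_mul, Complex.neg_re]; ring
    · obtain ⟨h1, h2, h3, h4⟩ := hz k hk
      have h5 := re_I_mul_cube_pos hβ h1 h3
      have h6 := re_I_mul_cube_pos hβ h2 h4
      simp only [neg_mul, Complex.neg_re]
      exact ⟨neg_neg_of_pos h5, neg_neg_of_pos h6, h5, h6⟩
  · intro q₀ hq x hx
    -- The compatibility conditions of order zero make the transform of the datum `O(1/ρ²)`.
    have hf0 : q₀ 0 = 0 := by simpa [hdx0] using hq.left 0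
    have hf1 : q₀ 1 = 0 := by simpa [hdx0] using hq.right 0
    exact ⟨seriesConverges hnI hβ hq.smooth hf0 hf1 hx fun σ _ _ => by simp,
      fun t ht => seriesConverges hI hβ hq.smooth hf0 hf1 hx fun σ hσ h0 =>
        mul_nonneg (re_I_mul_cube_pos hβ hσ h0).le ht⟩
  · intro T hT hwell
    obtain ⟨q, hq, -⟩ := hwell _ (admissible_datum hl)
    exact hnone T hT ⟨q, hq⟩
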